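/- **Proposition (uniform inf-sup stability).** Let $\Omega\subset\mathbb R^3$ be a bounded open set with boundary $\Gamma$ of class $C^1$, let $k\ge 2$, and fix $\sigma>0$ and $0\le s<1$. Then there is $h_0>0$, depending only on $\Omega,k,\sigma,s$, such that the following holds for all meshes, plane skins and spaces as described below with $h:=\max_T h_T\le h_0$. *Mesh.* $\mathcal T_h$ is a finite conforming mesh of closed straight-edged tetrahedra (two of them meet in a common face, edge or vertex, or not at all); $\Omega_h$ is the interior of their union and $\Gamma_h=\partial\Omega_h$. All vertices of the mesh lie in $\overline\Omega$, those on $\Gamma_h$ lie on $\Gamma$. Each $T$, of diameter $h_T$, contains a ball of radius $r$ with $h_T\le\sigma r$. Each $T$ has either at most one edge contained in $\Gamma_h$, or one face $F_T\subset\Gamma_h$ and no edge in $\Gamma_h$ other than those of $F_T$. With each edge $e\subset\Gamma_h$ is associated a plane (that of the "skin" $\delta_e$) containing $e$, the sine of whose angle with the plane bisecting the dihedral angle between two faces of $\Gamma_h$ that meet at $e$ is at most $s$. *Test space.* $V_h$ is the space of continuous functions on $\overline\Omega_h$ that vanish on $\Gamma_h$ and are polynomials of degree $\le k$ on each $T$.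 *Trial space.* The Lagrangian nodes of $T$ are the points whose barycentric coordinates are multiples of $1/k$. $W_h^0$ is the space of functions $w$ on $\overline\Omega_h$, possibly multi-valued on the interfaces of elements, such that: 1. on each $T$, $w$ is a polynomial $w_T$ of degree $\le k$ (also used outside $T$); 2. $w$ is single-valued at all Lagrangian nodes not on $\Gamma_h$ and at all vertices of the mesh; 3. $w=0$ at all vertices on $\Gamma_h$; 4. if $T$ has a face $F_T\subset\Gamma_h$ and $O_T$ is its opposite vertex, then for each of the $(k-1)(k-2)/2$ points $M$ of $F_T$ with positive barycentric coordinates that are multiples of $1/k$, $w_T(P)=0$ at the intersection $P$ nearest to $M$ of $\Gamma$ with the line $O_TM$; 5. for each edge $e\subset\Gamma_h$ of $T$ and each of the $k-1$ inner points $M$ that divide $e$ into $k$ equal segments, $w_T(Q)=0$ at the intersection $Q$ nearest to $M$ of $\Gamma$ with the line through $M$ orthogonal to $e$ in the plane of $\delta_e$. (In 4 and 5, if there are several nearest intersections, the condition is imposed at each of them.) *Claim.* Let $\mathbf{grad}_h$ be the elementwise gradient, $a_h(w,v)=\int_{\Omega_h}\mathbf{grad}_h w\cdot\mathbf{grad}\,v$,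 and $\|\cdot\|_{0,h}$ the norm of $L^2(\Omega_h)$. Then $\|\mathbf{grad}\,v\|_{0,h}>0$ for all $v\in V_h\setminus\{0\}$, and for every $w\in W_h^0\setminus\{0\}$ one has $\|\mathbf{grad}_h w\|_{0,h}>0$ and $$\sup_{v\in V_h\setminus\{0\}}\frac{a_h(w,v)}{\|\mathbf{grad}_h w\|_{0,h}\,\|\mathbf{grad}\,v\|_{0,h}}\ \ge\ \alpha\qquad\text{with }\alpha=\tfrac13 .$$ In particular the set of these quotients is nonempty and bounded above, and $\alpha$ does not depend on $h$. -/

import Mathlib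

noncomputable section

open MeasureTheory

/-- Euclidean three-dimensional space. -/
abbrev E3 : Type := EuclideanSpace ℝ (Fin 3)

/-- The real function on `E3` given by a polynomial in the three coordinates. -/
def polyFun (p : MvPolynomial (Fin 3) ℝ) (x : E3) : ℝ :=
  MvPolynomial.eval (fun i => x i) p

/-- `Ω` has a boundary of class `C¹`: near each boundary point, `Ω` is the sublevel set, and its
boundary the zero set, of a `C¹` function with nonvanishing gradient. -/
def HasC1Boundary (Ω : Set E3) : Prop :=
  ∀ x ∈ frontier Ω, ∃ U : Set E3, IsOpen U ∧ x ∈ U ∧ ∃ ρ : E3 → ℝ,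
    ContDiffOn ℝ 1 ρ U ∧ (∀ y ∈ U, gradient ρ y ≠ 0) ∧
    Ω ∩ U = {y ∈ U | ρ y < 0} ∧ frontier Ω ∩ U = {y ∈ U | ρ y = 0}

/-- A finite conforming mesh of straight-edged tetrahedra; a tetrahedron (and likewise a face or
an edge) is given by its finite set of vertices, the closed set itself being the convex hull.
Conformity: two tetrahedra meet in the convex hull of their common vertices, that is, in a common
face, edge or vertex, or not at all. -/
structure TetMesh where
  elements : Finset (Finset E3)
  card_eq_four : ∀ T ∈ elements, T.card = 4
  affineIndependent : ∀ T ∈ elements, AffineIndependent ℝ ((↑) : T → E3)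
  inter_subset : ∀ T ∈ elements, ∀ T' ∈ elements,
    convexHull ℝ (T : Set E3) ∩ convexHull ℝ (T' : Set E3) ⊆
      convexHull ℝ ((T : Set E3) ∩ (T' : Set E3))

/-- `x` is one of the points of the simplex with vertex set `σ` whose barycentric coordinates are
integer multiples of `1 / k`. For a tetrahedron these are its Lagrangian nodes of order `k`. -/
def IsLatticePoint (k : ℕ) (σ : Finset E3) (x : E3) : Prop :=
  ∃ a : E3 → ℕ, ∑ v ∈ σ, a v = k ∧ x = ∑ v ∈ σ, ((a v : ℝ) / (k : ℝ)) • v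

/-- The lattice points of order `k` of the simplex `σ` with positive barycentric coordinates: for
an edge those different from its end-points, for a triangle those lying on no edge of it. -/
def IsInnerLatticePoint (k : ℕ) (σ : Finset E3) (x : E3) : Prop :=
  ∃ a : E3 → ℕ, (∀ v ∈ σ, 0 < a v) ∧ ∑ v ∈ σ, a v = k ∧
    x = ∑ v ∈ σ, ((a v : ℝ) / (k : ℝ)) • v

/-- `P` is a point of the set `A` nearest to `M`. -/
def IsNearestPoint (A : Set E3) (M P : E3) : Prop :=
  P ∈ A ∧ ∀ y ∈ A, dist M P ≤ dist M y

/-- `τ` is the unit vector in the plane of the triangle `F`, orthogonal to its edge `e` and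
pointing from `e` to the side of the vertex of `F` opposite to `e`. -/
def IsConormal (e F : Finset E3) (τ : E3) : Prop :=
  ‖τ‖ = 1 ∧ (∀ a ∈ e, ∀ b ∈ e, inner ℝ τ (b - a) = 0) ∧
  ∃ c ∈ F, c ∉ e ∧ ∃ y ∈ affineSpan ℝ (e : Set E3), ∃ t : ℝ, 0 < t ∧ c = y + t • τ

namespace TetMesh

variable (K : TetMesh)

/-- The open polyhedron `Ω_h`: the interior of the union of the tetrahedra. -/
def domain : Set E3 := interior (⋃ T ∈ K.elements, convexHull ℝ (T : Set E3))

/-- The boundary `Γ_h` of the polyhedron. -/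
def boundary : Set E3 := frontier K.domain

/-- `e` is an edge of the mesh contained in `Γ_h`. -/
def IsBoundaryEdge (e : Finset E3) : Prop :=
  e.card = 2 ∧ (∃ T ∈ K.elements, e ⊆ T) ∧ convexHull ℝ (e : Set E3) ⊆ K.boundary

/-- `F` is a (triangular) face of the mesh contained in `Γ_h`. -/
def IsBoundaryFace (F : Finset E3) : Prop :=
  F.card = 3 ∧ (∃ T ∈ K.elements, F ⊆ T) ∧ convexHull ℝ (F : Set E3) ⊆ K.boundary

/-- The mesh fits `Ω`: its vertices belong to the closure of `Ω`, those on `Γ_h` lie on the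
boundary of `Ω`, and each tetrahedron has either at most one edge contained in `Γ_h`, or one face
contained in `Γ_h` and no other edge in `Γ_h` than those of that face. -/
structure Fits (Ω : Set E3) : Prop where
  vertex_mem : ∀ T ∈ K.elements, ∀ S ∈ T, S ∈ closure Ω
  boundary_vertex_mem : ∀ T ∈ K.elements, ∀ S ∈ T, S ∈ K.boundary → S ∈ frontier Ω
  edge_or_face : ∀ T ∈ K.elements,
    (∀ e, e ⊆ T → K.IsBoundaryEdge e → ∀ e', e' ⊆ T → K.IsBoundaryEdge e' → e = e') ∨
    (∃ F, F ⊆ T ∧ K.IsBoundaryFace F ∧ ∀ e, e ⊆ T → K.IsBoundaryEdge e → e ⊆ F)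

/-- Shape regularity with parameter `σ`: the diameter of each tetrahedron is at most `σ` times the
radius of some ball contained in it. -/
def ShapeRegular (σ : ℝ) : Prop :=
  ∀ T ∈ K.elements, ∃ (c : E3) (r : ℝ), 0 < r ∧
    Metric.ball c r ⊆ convexHull ℝ (T : Set E3) ∧
    Metric.diam (convexHull ℝ (T : Set E3)) ≤ σ * r

/-- A choice of the plane skins: to each edge `e` of `Γ_h` a plane containing `e` is attached,
given by a unit vector `d e` of that plane orthogonal to `e`. The plane is close to the bisector
plane of two faces of `Γ_h` meeting at `e`: as the bisector plane contains `e` and is orthogonal to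
the difference `τ₁ - τ₂` of the unit conormals of the faces, the sine of the angle of the two
planes is `|⟪d e, τ₁ - τ₂⟫| / ‖τ₁ - τ₂‖`, and it is required to be at most `s`. -/
def IsSkinChoice (s : ℝ) (d : Finset E3 → E3) : Prop :=
  ∀ e, K.IsBoundaryEdge e →
    ‖d e‖ = 1 ∧ (∀ a ∈ e, ∀ b ∈ e, inner ℝ (d e) (b - a) = 0) ∧
    ∃ F₁ F₂ : Finset E3, F₁ ≠ F₂ ∧ e ⊆ F₁ ∧ e ⊆ F₂ ∧
      K.IsBoundaryFace F₁ ∧ K.IsBoundaryFace F₂ ∧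
      ∃ τ₁ τ₂ : E3, IsConormal e F₁ τ₁ ∧ IsConormal e F₂ τ₂ ∧
        |inner ℝ (d e) (τ₁ - τ₂)| ≤ s * ‖τ₁ - τ₂‖

/-- The Lagrange space `V_h`: continuous functions on the closed polyhedron, polynomial of degree
at most `k` on each tetrahedron, vanishing on `Γ_h`, and extended by zero. -/
def testSpace (k : ℕ) : Set (E3 → ℝ) :=
  {v | ContinuousOn v (closure K.domain) ∧ (∀ x ∉ K.domain, v x = 0) ∧
    ∀ T ∈ K.elements, ∃ p : MvPolynomial (Fin 3) ℝ, p.totalDegree ≤ k ∧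
      ∀ x ∈ convexHull ℝ (T : Set E3), v x = polyFun p x}

/-- The manifold `W_h^g`. As its members are in general multi-valued on the interfaces, a member is
given by the family of its polynomial expressions `w T` on the tetrahedra `T` (values of `w` at
finsets that are not tetrahedra of the mesh are irrelevant). -/
structure IsTrial (Ω : Set E3) (k : ℕ) (d : Finset E3 → E3) (g : E3 → ℝ)
    (w : Finset E3 → MvPolynomial (Fin 3) ℝ) : Prop where
  degree_le : ∀ T ∈ K.elements, (w T).totalDegree ≤ k
  /-- single-valued at the Lagrangian nodes that are not on `Γ_h`, and at the vertices -/
  single_valued : ∀ T ∈ K.elements, ∀ T' ∈ K.elements, ∀ x : E3,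
    IsLatticePoint k T x → IsLatticePoint k T' x → (x ∉ K.boundary ∨ x ∈ T) →
      polyFun (w T) x = polyFun (w T') x
  /-- value of `g` at the vertices on `Γ_h` -/
  vertex : ∀ T ∈ K.elements, ∀ S ∈ T, S ∈ K.boundary → polyFun (w T) S = g S
  /-- faces: intersections with the boundary of `Ω`, nearest to `M`, of the line joining the
  opposite vertex `O` to an inner lattice point `M` of the face -/
  face : ∀ T ∈ K.elements, ∀ F, F ⊆ T → K.IsBoundaryFace F → ∀ O ∈ T, O ∉ F →
    ∀ M P : E3, IsInnerLatticePoint k F M →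
      IsNearestPoint (frontier Ω ∩ {x | ∃ t : ℝ, x = M + t • (M - O)}) M P →
      polyFun (w T) P = g P
  /-- edges: intersections with the boundary of `Ω`, nearest to `M`, of the line orthogonal to the
  edge in the plane skin through an inner lattice point `M` of the edge -/
  edge : ∀ T ∈ K.elements, ∀ e, e ⊆ T → K.IsBoundaryEdge e →
    ∀ M Q : E3, IsInnerLatticePoint k e M →
      IsNearestPoint (frontier Ω ∩ {x | ∃ t : ℝ, x = M + t • d e}) M Q →
      polyFun (w T) Q = g Q

/-- The broken gradient of a piecewise polynomial function (set to zero on the interfaces, which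
have measure zero). -/
def brokenGrad (w : Finset E3 → MvPolynomial (Fin 3) ℝ) (x : E3) : E3 :=
  ∑ T ∈ K.elements,
    Set.indicator (interior (convexHull ℝ (T : Set E3))) (gradient (polyFun (w T))) x

/-- The norm of `L²(Ω_h)` of a vector field. -/
def l2Norm (G : E3 → E3) : ℝ := Real.sqrt (∫ x in K.domain, ‖G x‖ ^ 2)

/-- The bilinear form `a_h(w, v)`. -/
def form (w : Finset E3 → MvPolynomial (Fin 3) ℝ) (v : E3 → ℝ) : ℝ :=
  ∫ x in K.domain, inner ℝ (K.brokenGrad w x) (gradient v x)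

end TetMesh

end

/-! Given `w`, let `v` in `V_h` take the values of `w` at the Lagrangian nodes off `Γ_h` and the
value 0 at those on `Γ_h`. Everything follows from `‖grad_h (w - v)‖ ≤ (1/2) ‖grad_h w‖`:
Cauchy-Schwarz then gives `a_h(w, v) ≥ (1/2) ‖grad_h w‖²`, while `‖grad v‖ ≤ (3/2) ‖grad_h w‖`, and
the quotient of the two constants is `1/3` (`TetMesh.inf_sup_of_energy_le`).

On a tetrahedron `T`, the difference `q = w - v` has the nodal values of `w` on `Γ_h` and 0
elsewhere. At a boundary vertex `w` vanishes; every other boundary node is within `ε h_T` of a zero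
of `w_T`. The mean value theorem, the stability of interpolation and the inverse inequalities for
polynomials, scaled to the inscribed ball, bound the energy of `q` on `T` by `κ ε²` times that of
`w`, with `κ` depending on `k` and `σ` only (`exists_energy_le_of_nodes`). The distance need only be
a small multiple of `h_T`, with no rate, which is why a `C¹` boundary suffices.

The zeros are close because the boundary is flat at small scales, uniformly by compactness
(`HasC1Boundary.exists_uniform_normal`), and a line transversal to it through a point near the
tangent plane meets it nearby (`IsApproxNormal.exists_frontier_on_line`). For a face, the line to
the opposite vertex is transversal because `T` contains a ball and so cannot be thin in the normal
direction. For an edge, the two boundary faces at it are nearly tangent, so their conormals nearly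
coincide or are nearly opposite. Near coincidence is impossible: both tetrahedra lie on the inner
side of the tangent plane and would overlap. Hence the difference of the conormals is nearly
tangent, and a skin close to the bisector plane is transversal
(`TetMesh.IsSkinChoice.le_abs_inner`). -/

noncomputable section

open MeasureTheory

/-! ### Lagrange interpolation by forms in barycentric coordinates. -/

section Lagrange

open MvPolynomial

variable {ι : Type*} [Fintype ι]

/-- The point of the standard simplex with barycentric coordinates `b i / k`. -/
def simplexNode (k : ℕ) (b : ι → ℕ) : ι → ℝ := fun i => (b i : ℝ) / k

theorem sum_simplexNode {k : ℕ} (hk : 0 < k) {b : ι → ℕ} (hb : ∑ i, b i = k) :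
    ∑ i, simplexNode k b i = 1 := by
  unfold simplexNode
  rw [← Finset.sum_div, ← Nat.cast_sum, hb]
  exact div_self (by positivity)

/-- Unnormalized Lagrange polynomial, in homogeneous barycentric coordinates. -/
def lagrangeProd (k : ℕ) (a : ι → ℕ) : MvPolynomial ι ℝ :=
  ∏ i, ∏ j ∈ Finset.range (a i), (X i - C ((j : ℝ) / k) * ∑ l, X l)

theorem isHomogeneous_lagrangeProd (k : ℕ) (a : ι → ℕ) (ha : ∑ i, a i = k) :
    (lagrangeProd k a).IsHomogeneous k := by
  have h : (lagrangeProd k a).IsHomogeneous (∑ i, a i) := by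
    refine IsHomogeneous.prod _ _ _ fun i _ => ?_
    have := IsHomogeneous.prod (Finset.range (a i))
      (fun j : ℕ => (X i - C ((j : ℝ) / k) * ∑ l, X l : MvPolynomial ι ℝ)) (fun _ => 1) ?_
    · simpa using this
    · intro j _
      refine (isHomogeneous_X ℝ i).sub (IsHomogeneous.C_mul ?_ _)
      exact IsHomogeneous.sum _ _ _ fun l _ => isHomogeneous_X ℝ l
  rwa [ha] at h

theorem eval_lagrangeProd {k : ℕ} (hk : 0 < k) (a b : ι → ℕ) (hb : ∑ i, b i = k) :
    eval (simplexNode k b) (lagrangeProd k a) =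
      ∏ i, ∏ j ∈ Finset.range (a i), (((b i : ℝ) - j) / k) := by
  unfold lagrangeProd
  rw [map_prod]
  refine Finset.prod_congr rfl fun i _ => ?_
  rw [map_prod]
  refine Finset.prod_congr rfl fun j _ => ?_
  simp only [map_sub, map_mul, map_sum, eval_X, eval_C, sum_simplexNode hk hb]
  simp only [simplexNode]
  ring

theorem eval_lagrangeProd_self_ne_zero {k : ℕ} (hk : 0 < k) (a : ι → ℕ) (ha : ∑ i, a i = k) :
    eval (simplexNode k a) (lagrangeProd k a) ≠ 0 := by
  rw [eval_lagrangeProd hk a a ha]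
  refine Finset.prod_ne_zero_iff.2 fun i _ => Finset.prod_ne_zero_iff.2 fun j hj => ?_
  have : (j : ℝ) < a i := by exact_mod_cast Finset.mem_range.1 hj
  have hk' : (0 : ℝ) < k := by exact_mod_cast hk
  exact div_ne_zero (by linarith) hk'.ne'

/-- As `a` and `b` have the same sum, some `b i < a i`, and the factor with `j = b i` vanishes. -/
theorem eval_lagrangeProd_of_ne {k : ℕ} (hk : 0 < k) (a b : ι → ℕ) (ha : ∑ i, a i = k)
    (hb : ∑ i, b i = k) (hab : b ≠ a) : eval (simplexNode k b) (lagrangeProd k a) = 0 := by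
  rw [eval_lagrangeProd hk a b hb]
  obtain ⟨i, hi⟩ : ∃ i, b i < a i := by
    by_contra! h
    apply hab
    have := (Finset.sum_eq_sum_iff_of_le (s := Finset.univ) (f := a) (g := b)
      (fun i _ => h i)).1 (by rw [ha, hb])
    funext i
    exact (this i (Finset.mem_univ i)).symm
  refine Finset.prod_eq_zero (Finset.mem_univ i) ?_
  exact Finset.prod_eq_zero (Finset.mem_range.2 hi) (by simp)

/-- Lagrange polynomials of degree `k` in homogeneous barycentric coordinates. -/
def lagrangeBasis (k : ℕ) (a : ι → ℕ) : MvPolynomial ι ℝ :=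
  C (eval (simplexNode k a) (lagrangeProd k a))⁻¹ * lagrangeProd k a

theorem isHomogeneous_lagrangeBasis (k : ℕ) (a : ι → ℕ) (ha : ∑ i, a i = k) :
    (lagrangeBasis k a).IsHomogeneous k :=
  IsHomogeneous.C_mul (isHomogeneous_lagrangeProd k a ha) _

theorem eval_lagrangeBasis {k : ℕ} (hk : 0 < k) (a b : ι → ℕ) (ha : ∑ i, a i = k)
    (hb : ∑ i, b i = k) :
    eval (simplexNode k b) (lagrangeBasis k a) = if b = a then 1 else 0 := by
  unfold lagrangeBasis
  rw [map_mul, eval_C]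
  split_ifs with h
  · subst h
    exact inv_mul_cancel₀ (eval_lagrangeProd_self_ne_zero hk b ha)
  · rw [eval_lagrangeProd_of_ne hk a b ha hb h, mul_zero]

theorem MvPolynomial.IsHomogeneous.sum_eq_of_mem_support {k : ℕ} {P : MvPolynomial ι ℝ}
    (hP : P.IsHomogeneous k) {d : ι →₀ ℕ} (hd : d ∈ P.support) : ∑ i, d i = k := by
  rw [hP.degree_eq_sum_deg_support hd]
  exact (Finset.sum_subset (Finset.subset_univ _) fun i _ hi => Finsupp.notMem_support_iff.1 hi).symm

theorem MvPolynomial.IsHomogeneous.eval_eq_sum_coeff [DecidableEq ι] {k : ℕ} {P : MvPolynomial ι ℝ}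
    (hP : P.IsHomogeneous k) (x : ι → ℝ) :
    eval x P = ∑ d : (Finset.finsuppAntidiag (Finset.univ : Finset ι) k),
      coeff d.1 P * ∏ i, x i ^ (d.1 i) := by
  rw [eval_eq', Finset.sum_coe_sort (Finset.finsuppAntidiag (Finset.univ : Finset ι) k)
    (fun d => coeff d P * ∏ i, x i ^ (d i))]
  refine Finset.sum_subset ?_ ?_
  · intro d hd
    rw [Finset.mem_finsuppAntidiag]
    refine ⟨?_, Finset.subset_univ _⟩
    exact hP.sum_eq_of_mem_support hd
  · intro d _ hd
    rw [notMem_support_iff.1 hd, zero_mul]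

/-- A form of degree `k` vanishing at all nodes of the simplex is zero. -/
theorem MvPolynomial.IsHomogeneous.eq_zero_of_simplexNode [DecidableEq ι] {k : ℕ} (hk : 0 < k) {P : MvPolynomial ι ℝ}
    (hP : P.IsHomogeneous k)
    (h : ∀ b : ι → ℕ, ∑ i, b i = k → eval (simplexNode k b) P = 0) : P = 0 := by
  let A := (Finset.finsuppAntidiag (Finset.univ : Finset ι) k)
  have hA : ∀ b : A, ∑ i, (b.1 : ι → ℕ) i = k := fun b => (Finset.mem_finsuppAntidiag.1 b.2).1
  -- Monomials of degree `k` and nodes are indexed by the same finite set, so evaluation at the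
  -- nodes is a square system: solvability, given by the Lagrange polynomials, implies uniqueness.
  let L : (A → ℝ) →ₗ[ℝ] (A → ℝ) :=
    { toFun := fun c b => ∑ d : A, c d * ∏ i, simplexNode k (b.1 : ι → ℕ) i ^ (d.1 i)
      map_add' := by intro x y; ext b; simp [add_mul, Finset.sum_add_distrib]
      map_smul' := by intro r x; ext b; simp [mul_assoc, Finset.mul_sum] }
  have hL : ∀ (Q : MvPolynomial ι ℝ), Q.IsHomogeneous k → ∀ b : A,
      L (fun d => coeff d.1 Q) b = eval (simplexNode k (b.1 : ι → ℕ)) Q :=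
    fun Q hQ b => (IsHomogeneous.eval_eq_sum_coeff hQ _).symm
  have hsurj : Function.Surjective L := by
    intro f
    refine ⟨∑ a : A, f a • (fun d : A => coeff d.1 (lagrangeBasis k (a.1 : ι → ℕ))), ?_⟩
    rw [map_sum]
    ext b
    simp only [map_smul, Finset.sum_apply, Pi.smul_apply, smul_eq_mul]
    rw [Finset.sum_eq_single b]
    · rw [hL _ (isHomogeneous_lagrangeBasis k _ (hA b)), eval_lagrangeBasis hk _ _ (hA b) (hA b)]
      simp
    · intro a _ hab
      rw [hL _ (isHomogeneous_lagrangeBasis k _ (hA a)), eval_lagrangeBasis hk _ _ (hA a) (hA b),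
        if_neg, mul_zero]
      intro h
      exact hab (Subtype.ext (DFunLike.coe_injective h.symm))
    · intro hb
      exact absurd (Finset.mem_univ b) hb
  have hinj : Function.Injective L := LinearMap.injective_iff_surjective.2 hsurj
  have h0 : (fun d : A => coeff d.1 P) = 0 := by
    apply hinj
    rw [map_zero]
    ext b
    rw [hL P hP b]
    exact h _ (hA b)
  ext d
  rw [coeff_zero]
  by_cases hd : d ∈ P.support
  · have hd' : d ∈ A := by
      rw [Finset.mem_finsuppAntidiag]
      refine ⟨?_, Finset.subset_univ _⟩
      exact hP.sum_eq_of_mem_support hd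
    exact congrFun h0 ⟨d, hd'⟩
  · exact notMem_support_iff.1 hd

theorem MvPolynomial.IsHomogeneous.eq_sum_lagrangeBasis [DecidableEq ι] {k : ℕ} (hk : 0 < k) {P : MvPolynomial ι ℝ}
    (hP : P.IsHomogeneous k) :
    P = ∑ b ∈ Finset.piAntidiag (Finset.univ : Finset ι) k,
      C (eval (simplexNode k b) P) * lagrangeBasis k b := by
  rw [← sub_eq_zero]
  have hs : ∀ b ∈ Finset.piAntidiag (Finset.univ : Finset ι) k, ∑ i, b i = k :=
    fun b hb => (Finset.mem_piAntidiag.1 hb).1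
  refine IsHomogeneous.eq_zero_of_simplexNode (k := k) hk ?_ ?_
  · refine hP.sub (IsHomogeneous.sum _ _ _ fun b hb => IsHomogeneous.C_mul ?_ _)
    exact isHomogeneous_lagrangeBasis k b (hs b hb)
  · intro b hb
    rw [map_sub, map_sum, Finset.sum_eq_single b]
    · rw [map_mul, eval_C, eval_lagrangeBasis hk b b hb hb, if_pos rfl, mul_one, sub_self]
    · intro a ha hab
      rw [map_mul, eval_lagrangeBasis hk a b (hs a ha) hb, if_neg (Ne.symm hab), mul_zero]
    · intro h
      exact absurd (Finset.mem_piAntidiag.2 ⟨hb, fun i _ => Finset.mem_univ i⟩) h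

/-- A polynomial of degree at most `k` is a form of degree `k` in barycentric coordinates. -/
theorem exists_isHomogeneous_eval_eq {k : ℕ} (V : ι → E3) {p : MvPolynomial (Fin 3) ℝ}
    (hp : p.totalDegree ≤ k) : ∃ P : MvPolynomial ι ℝ, P.IsHomogeneous k ∧
      ∀ l : ι → ℝ, ∑ i, l i = 1 → eval l P = polyFun p (∑ i, l i • V i) := by
  -- Each coordinate becomes a linear form in the barycentric coordinates; the power of their sum,
  -- equal to 1 at barycentric points, raises every monomial to degree `k`.
  refine ⟨∑ d ∈ p.support, C (coeff d p) *
    ((∏ j, (∑ i, C (V i j) * X i) ^ (d j)) * (∑ i, X i) ^ (k - ∑ j, d j)), ?_, ?_⟩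
  · refine IsHomogeneous.sum _ _ _ fun d hd => IsHomogeneous.C_mul ?_ _
    have hdk : ∑ j, d j ≤ k := by
      have := le_totalDegree hd
      rw [Finsupp.sum_fintype _ _ (fun _ => rfl)] at this
      exact this.trans hp
    have h1 : (∏ j, (∑ i, C (V i j) * X i : MvPolynomial ι ℝ) ^ (d j)).IsHomogeneous
        (∑ j, d j) := by
      refine IsHomogeneous.prod _ _ _ fun j _ => ?_
      have : (∑ i, C (V i j) * X i : MvPolynomial ι ℝ).IsHomogeneous 1 :=
        IsHomogeneous.sum _ _ _ fun i _ => isHomogeneous_C_mul_X _ _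
      simpa using this.pow (d j)
    have h2 : ((∑ i, X i : MvPolynomial ι ℝ) ^ (k - ∑ j, d j)).IsHomogeneous
        (k - ∑ j, d j) := by
      have : (∑ i, X i : MvPolynomial ι ℝ).IsHomogeneous 1 :=
        IsHomogeneous.sum _ _ _ fun i _ => isHomogeneous_X _ _
      simpa using this.pow (k - ∑ j, d j)
    have := h1.mul h2
    rwa [Nat.add_sub_cancel' hdk] at this
  · intro l hl
    unfold polyFun
    rw [map_sum, eval_eq']
    refine Finset.sum_congr rfl fun d _ => ?_
    simp only [map_mul, map_prod, map_pow, map_sum, eval_C, eval_X, hl, one_pow, mul_one]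
    congr 1
    refine Finset.prod_congr rfl fun j _ => ?_
    congr 1
    simp [mul_comm]

/-- Lagrange interpolation formula on a simplex. -/
theorem polyFun_eq_sum_lagrangeBasis [DecidableEq ι] {k : ℕ} (hk : 0 < k) (V : ι → E3)
    {p : MvPolynomial (Fin 3) ℝ} (hp : p.totalDegree ≤ k) (l : ι → ℝ) (hl : ∑ i, l i = 1) :
    polyFun p (∑ i, l i • V i) = ∑ b ∈ Finset.piAntidiag (Finset.univ : Finset ι) k,
      polyFun p (∑ i, simplexNode k b i • V i) * eval l (lagrangeBasis k b) := by
  obtain ⟨P, hP, h⟩ := exists_isHomogeneous_eval_eq V hp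
  rw [← h l hl]
  conv_lhs => rw [IsHomogeneous.eq_sum_lagrangeBasis hk hP]
  rw [map_sum]
  refine Finset.sum_congr rfl fun b hb => ?_
  have hb' := (Finset.mem_piAntidiag.1 hb).1
  rw [map_mul, eval_C, ← h _ (sum_simplexNode hk hb')]

end Lagrange

/-! ### Barycentric coordinates and stable interpolation on tetrahedra. -/

/-- Points of the convex hull of a finset, in barycentric coordinates. -/
theorem mem_convexHull_finset_iff (τ : Finset E3) (x : E3) :
    x ∈ convexHull ℝ (τ : Set E3) ↔
      ∃ l : E3 → ℝ, (∀ v ∈ τ, 0 ≤ l v) ∧ ∑ v ∈ τ, l v = 1 ∧ ∑ v ∈ τ, l v • v = x := by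
  rw [Finset.mem_convexHull]
  constructor
  · rintro ⟨w, h0, h1, h2⟩
    refine ⟨w, h0, h1, ?_⟩
    rw [Finset.centerMass_eq_of_sum_1 _ _ h1] at h2
    exact h2
  · rintro ⟨w, h0, h1, h2⟩
    refine ⟨w, h0, h1, ?_⟩
    rw [Finset.centerMass_eq_of_sum_1 _ _ h1]
    exact h2

/-- Uniqueness of Lagrange interpolation on a simplex. -/
theorem polyFun_eq_zero_of_lattice {k : ℕ} (hk : 0 < k) (τ : Finset E3)
    {p : MvPolynomial (Fin 3) ℝ} (hp : p.totalDegree ≤ k)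
    (h : ∀ x, IsLatticePoint k τ x → polyFun p x = 0) {x : E3}
    (hx : x ∈ convexHull ℝ (τ : Set E3)) : polyFun p x = 0 := by
  classical
  obtain ⟨l, -, h1, rfl⟩ := (mem_convexHull_finset_iff τ x).1 hx
  -- The interpolation formula needs no affine independence, so `τ` can be a face, an edge or a
  -- common part of two tetrahedra.
  have e := polyFun_eq_sum_lagrangeBasis hk (fun i : τ => (i : E3)) hp (fun i => l i)
    (by rw [Finset.sum_coe_sort τ l]; exact h1)
  rw [Finset.sum_coe_sort τ (fun v => l v • v)] at e
  rw [e]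
  refine Finset.sum_eq_zero fun b hb => ?_
  rw [h, zero_mul]
  have hb' := (Finset.mem_piAntidiag.1 hb).1
  refine ⟨fun v => if hv : v ∈ τ then b ⟨v, hv⟩ else 0, ?_, ?_⟩
  · rw [← Finset.sum_coe_sort τ]
    simpa using hb'
  · rw [← Finset.sum_coe_sort τ]
    simp [simplexNode]

theorem continuous_polyFun (p : MvPolynomial (Fin 3) ℝ) : Continuous (polyFun p) := by
  unfold polyFun
  exact (MvPolynomial.continuous_eval p).comp (by fun_prop)

theorem polyFun_add (p q : MvPolynomial (Fin 3) ℝ) (x : E3) :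
    polyFun (p + q) x = polyFun p x + polyFun q x := map_add _ _ _

theorem polyFun_sub (p q : MvPolynomial (Fin 3) ℝ) (x : E3) :
    polyFun (p - q) x = polyFun p x - polyFun q x := map_sub _ _ _

/-- Substitution of polynomials of degree at most one does not raise the degree. -/
theorem totalDegree_aeval_le {ι : Type*} {k : ℕ} {P : MvPolynomial ι ℝ} (hP : P.totalDegree ≤ k)
    (f : ι → MvPolynomial (Fin 3) ℝ) (hf : ∀ i, (f i).totalDegree ≤ 1) :
    (MvPolynomial.aeval f P).totalDegree ≤ k := by
  rw [MvPolynomial.aeval_def, MvPolynomial.eval₂_eq]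
  refine MvPolynomial.totalDegree_finsetSum_le fun d hd => ?_
  refine (MvPolynomial.totalDegree_mul _ _).trans ?_
  rw [MvPolynomial.algebraMap_eq, MvPolynomial.totalDegree_C, zero_add]
  refine (MvPolynomial.totalDegree_finsetProd _ _).trans ?_
  refine le_trans (Finset.sum_le_sum fun i _ => ?_) ((MvPolynomial.le_totalDegree hd).trans hP)
  exact (MvPolynomial.totalDegree_pow _ _).trans
    ((Nat.mul_le_mul_left _ (hf i)).trans (by simp))

theorem polyFun_aeval {ι : Type*} (P : MvPolynomial ι ℝ) (f : ι → MvPolynomial (Fin 3) ℝ)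
    (x : E3) : polyFun (MvPolynomial.aeval f P) x =
      MvPolynomial.eval (fun i => polyFun (f i) x) P := by
  unfold polyFun
  rw [MvPolynomial.aeval_def, MvPolynomial.algebraMap_eq, MvPolynomial.eval, MvPolynomial.eval,
    MvPolynomial.coe_eval₂Hom, MvPolynomial.coe_eval₂Hom]
  induction P using MvPolynomial.induction_on with
  | C a => simp
  | add p q hp hq => simp [MvPolynomial.eval₂_add, hp, hq]
  | mul_X p i hp => simp [MvPolynomial.eval₂_mul, hp]

/-- Affine functions are polynomials of degree at most one. -/
theorem exists_polyFun_eq_affineMap (f : E3 →ᵃ[ℝ] ℝ) :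
    ∃ p : MvPolynomial (Fin 3) ℝ, p.totalDegree ≤ 1 ∧ ∀ x, polyFun p x = f x := by
  refine ⟨MvPolynomial.C (f 0) + ∑ i, MvPolynomial.C (f.linear (EuclideanSpace.single i 1)) *
    MvPolynomial.X i, ?_, ?_⟩
  · refine (MvPolynomial.totalDegree_add _ _).trans (max_le (by simp) ?_)
    refine MvPolynomial.totalDegree_finsetSum_le fun i _ => ?_
    refine (MvPolynomial.totalDegree_mul _ _).trans ?_
    simp
  · intro x
    have hx : x = ∑ i, x i • EuclideanSpace.single i (1 : ℝ) := by
      ext j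
      simp [Pi.single_apply]
    have h1 : f x = f.linear x + f 0 := by
      have := f.map_vadd 0 x
      simpa using this
    rw [h1]
    conv_rhs => rw [hx]
    simp only [polyFun, map_add, map_sum, map_mul, map_smul, MvPolynomial.eval_C,
      MvPolynomial.eval_X, smul_eq_mul]
    rw [add_comm]
    congr 1
    exact Finset.sum_congr rfl fun i _ => mul_comm _ _

/-- The affine basis given by the vertices of a nondegenerate tetrahedron. -/
def tetBasis (T : Finset E3) (hc : T.card = 4) (hi : AffineIndependent ℝ ((↑) : T → E3)) :
    AffineBasis T ℝ E3 :=
  ⟨(↑), hi, by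
    rw [hi.affineSpan_eq_top_iff_card_eq_finrank_add_one]
    simp [hc]⟩

theorem tetBasis_apply {T : Finset E3} (hc : T.card = 4)
    (hi : AffineIndependent ℝ ((↑) : T → E3)) (v : T) : tetBasis T hc hi v = v := rfl

/-- Barycentric coordinates with respect to the vertices of a nondegenerate tetrahedron. -/
structure IsBarycentric (T : Finset E3) (b : E3 → E3 →ᵃ[ℝ] ℝ) : Prop where
  sum_eq_one : ∀ x, ∑ v ∈ T, b v x = 1
  sum_smul : ∀ x, ∑ v ∈ T, b v x • v = x
  apply_sum : ∀ l : E3 → ℝ, ∑ v ∈ T, l v = 1 → ∀ v ∈ T, b v (∑ u ∈ T, l u • u) = l v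
  interior_eq : interior (convexHull ℝ (T : Set E3)) = {x | ∀ v ∈ T, 0 < b v x}

theorem exists_isBarycentric {T : Finset E3} (hc : T.card = 4)
    (hi : AffineIndependent ℝ ((↑) : T → E3)) : ∃ b, IsBarycentric T b := by
  classical
  let B := tetBasis T hc hi
  -- Indexing by all points lets the coordinates of different tetrahedra be compared at common
  -- vertices; the value off `T` plays no role.
  let b : E3 → E3 →ᵃ[ℝ] ℝ := fun v => if hv : v ∈ T then B.coord ⟨v, hv⟩ else AffineMap.const ℝ E3 0
  have hb : ∀ v : T, b v = B.coord v := fun v => by simp [b]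
  refine ⟨b, ?_, ?_, ?_, ?_⟩
  · intro x
    rw [← Finset.sum_coe_sort T]
    simp only [hb]
    exact B.sum_coord_apply_eq_one x
  · intro x
    rw [← Finset.sum_coe_sort T (fun v => b v x • v)]
    simp only [hb]
    exact B.linear_combination_coord_eq_self x
  · intro l hl v hv
    have h1 : ∑ u ∈ T, l u • u = Finset.univ.affineCombination ℝ B (fun u : T => l u) := by
      rw [Finset.affineCombination_eq_linear_combination _ _ _
        (by rw [Finset.sum_coe_sort T l]; exact hl)]
      rw [← Finset.sum_coe_sort T (fun u => l u • u)]
      rfl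
    rw [h1, hb ⟨v, hv⟩]
    exact B.coord_apply_combination_of_mem (Finset.mem_univ _)
      (by rw [Finset.sum_coe_sort T l]; exact hl)
  · have := B.interior_convexHull
    have hr : Set.range B = (T : Set E3) := by
      ext x
      simp [B, tetBasis_apply]
    rw [hr] at this
    rw [this]
    ext x
    constructor
    · intro h v hv
      rw [hb ⟨v, hv⟩]
      exact h ⟨v, hv⟩
    · intro h v
      have := h v v.2
      rwa [hb v] at this

namespace IsBarycentric

variable {T : Finset E3} {b : E3 → E3 →ᵃ[ℝ] ℝ}

theorem mem_convexHull_iff (h : IsBarycentric T b) (x : E3) :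
    x ∈ convexHull ℝ (T : Set E3) ↔ ∀ v ∈ T, 0 ≤ b v x := by
  rw [mem_convexHull_finset_iff]
  constructor
  · rintro ⟨l, h0, h1, rfl⟩ v hv
    rw [h.apply_sum l h1 v hv]
    exact h0 v hv
  · intro h0
    exact ⟨fun v => b v x, h0, h.sum_eq_one x, h.sum_smul x⟩

/-- This turns conformity into equations: at a point common to two elements, the coordinates of all
non-shared vertices vanish. -/
theorem mem_convexHull_subset_iff (h : IsBarycentric T b) {τ : Finset E3} (hτ : τ ⊆ T) (x : E3) :
    x ∈ convexHull ℝ (τ : Set E3) ↔ (∀ v ∈ T, 0 ≤ b v x) ∧ ∀ v ∈ T, v ∉ τ → b v x = 0 := by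
  classical
  constructor
  · intro hx
    refine ⟨(h.mem_convexHull_iff x).1 (convexHull_mono (by exact_mod_cast hτ) hx), ?_⟩
    intro v hv hvτ
    obtain ⟨l, h0, h1, rfl⟩ := (mem_convexHull_finset_iff τ x).1 hx
    have e1 : ∑ u ∈ T, (if u ∈ τ then l u else 0) = 1 := by
      rw [← h1, Finset.sum_ite_mem, Finset.inter_eq_right.2 hτ]
    have e2 : ∑ u ∈ τ, l u • u = ∑ u ∈ T, (if u ∈ τ then l u else 0) • u := by
      simp only [ite_smul, zero_smul]
      rw [Finset.sum_ite_mem, Finset.inter_eq_right.2 hτ]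
    rw [e2, h.apply_sum _ e1 v hv, if_neg hvτ]
  · rintro ⟨h0, h1⟩
    rw [mem_convexHull_finset_iff]
    refine ⟨fun v => b v x, fun v hv => h0 v (hτ hv), ?_, ?_⟩
    · rw [← h.sum_eq_one x]
      exact Finset.sum_subset hτ fun v hv hvτ => h1 v hv hvτ
    · conv_rhs => rw [← h.sum_smul x]
      exact Finset.sum_subset hτ fun v hv hvτ => by
        simp only [h1 v hv hvτ, zero_smul]

theorem interior_nonempty (h : IsBarycentric T b) (hc : T.card = 4) :
    (interior (convexHull ℝ (T : Set E3))).Nonempty := by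
  refine ⟨∑ u ∈ T, (1 / 4 : ℝ) • u, ?_⟩
  rw [h.interior_eq]
  intro v hv
  rw [h.apply_sum (fun _ => 1 / 4) (by simp [hc]) v hv]
  norm_num

end IsBarycentric

/-- Interpolation at the lattice points of a tetrahedron, with a bound on the interpolant. -/
theorem exists_interpolation (k : ℕ) (hk : 0 < k) : ∃ C : ℝ, 0 < C ∧
    ∀ T : Finset E3, T.card = 4 → AffineIndependent ℝ ((↑) : T → E3) → ∀ f : E3 → ℝ,
    ∃ q : MvPolynomial (Fin 3) ℝ, q.totalDegree ≤ k ∧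
      (∀ x, IsLatticePoint k T x → polyFun q x = f x) ∧
      ∀ μ : ℝ, (∀ x, IsLatticePoint k T x → |f x| ≤ μ) →
        ∀ x ∈ convexHull ℝ (T : Set E3), |polyFun q x| ≤ C * μ := by
  classical
  let A := Finset.piAntidiag (Finset.univ : Finset (Fin 4)) k
  let S : (Fin 4 → ℝ) → ℝ := fun l => ∑ a ∈ A, |MvPolynomial.eval l (lagrangeBasis k a)|
  have hS : Continuous S :=
    continuous_finsetSum _ fun a _ => (MvPolynomial.continuous_eval _).abs
  -- A bound for the Lebesgue function in barycentric coordinates, hence the same for all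
  -- tetrahedra.
  obtain ⟨C, hC⟩ := (isCompact_univ_pi (fun _ : Fin 4 => isCompact_Icc (a := (0 : ℝ)) (b := 1))).bddAbove_image
    hS.continuousOn
  refine ⟨max C 1, by positivity, fun T hc hi f => ?_⟩
  obtain ⟨b, hb⟩ := exists_isBarycentric hc hi
  let e : Fin 4 ≃ T := (finCongr hc.symm).trans T.equivFin.symm
  choose Λ hΛ1 hΛ using fun v => exists_polyFun_eq_affineMap (b v)
  let node : (Fin 4 → ℕ) → E3 := fun a => ∑ i, simplexNode k a i • (e i : E3)
  have hsum : ∀ {M : Type} [AddCommMonoid M] (g : E3 → M), ∑ i, g (e i) = ∑ v ∈ T, g v := by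
    intro M _ g
    rw [← Finset.sum_coe_sort T g]
    exact e.sum_comp (fun v : T => g v)
  have hA : ∀ a ∈ A, ∑ i, a i = k := fun a ha => (Finset.mem_piAntidiag.1 ha).1
  have hnode : ∀ a ∈ A, IsLatticePoint k T (node a) := by
    intro a ha
    refine ⟨fun v => if hv : v ∈ T then a (e.symm ⟨v, hv⟩) else 0, ?_, ?_⟩
    · rw [← hsum]
      simpa using hA a ha
    · rw [← hsum (fun v => (((if hv : v ∈ T then a (e.symm ⟨v, hv⟩) else 0 : ℕ) : ℝ) / (k : ℝ)) • v)]
      simp [node, simplexNode]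
  let q : MvPolynomial (Fin 3) ℝ := ∑ a ∈ A, MvPolynomial.C (f (node a)) *
    MvPolynomial.aeval (fun i => Λ (e i)) (lagrangeBasis k a)
  have hq : ∀ x, polyFun q x = ∑ a ∈ A, f (node a) *
      MvPolynomial.eval (fun i => b (e i) x) (lagrangeBasis k a) := by
    intro x
    have : ∀ P : MvPolynomial (Fin 4) ℝ, MvPolynomial.eval (fun i => x i)
        (MvPolynomial.aeval (fun i => Λ (e i)) P) =
        MvPolynomial.eval (fun i => b (e i) x) P := by
      intro P
      have := polyFun_aeval P (fun i => Λ (e i)) x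
      simp only [hΛ] at this
      exact this
    simp only [q, polyFun, map_sum, map_mul, MvPolynomial.eval_C, this]
  refine ⟨q, ?_, ?_, ?_⟩
  · refine MvPolynomial.totalDegree_finsetSum_le fun a ha => ?_
    refine (MvPolynomial.totalDegree_mul _ _).trans ?_
    rw [MvPolynomial.totalDegree_C, zero_add]
    exact totalDegree_aeval_le (isHomogeneous_lagrangeBasis k a (hA a ha)).totalDegree_le _
      fun i => hΛ1 _
  · rintro x ⟨m, hm, rfl⟩
    rw [hq]
    have hk' : (k : ℝ) ≠ 0 := by exact_mod_cast hk.ne'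
    have hm' : ∑ i, (fun i => m (e i)) i = k := by rw [← hm, ← hsum]
    have hx1 : ∑ v ∈ T, ((m v : ℝ) / k) = 1 := by
      rw [← Finset.sum_div, ← Nat.cast_sum, hm]
      exact div_self hk'
    have hco : (fun i => b (e i) (∑ v ∈ T, ((m v : ℝ) / k) • v)) =
        simplexNode k (fun i => m (e i)) := by
      funext i
      rw [hb.apply_sum (fun v => (m v : ℝ) / k) hx1 _ (e i).2]
      rfl
    rw [hco, Finset.sum_eq_single (fun i => m (e i))]
    · rw [eval_lagrangeBasis hk _ _ hm' hm', if_pos rfl, mul_one]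
      congr 1
      exact hsum (fun v => ((m v : ℝ) / k) • v)
    · intro a ha hne
      rw [eval_lagrangeBasis hk _ _ (hA a ha) hm', if_neg hne.symm, mul_zero]
    · intro h
      exact absurd (Finset.mem_piAntidiag.2 ⟨hm', fun i _ => Finset.mem_univ i⟩) h
  · intro μ hμ x hx
    -- The existence of one node, here a vertex, forces the bound to be nonnegative.
    have hμ0 : 0 ≤ μ := (abs_nonneg _).trans (hμ (node fun i => if i = 0 then k else 0)
      (hnode _ (Finset.mem_piAntidiag.2 ⟨by simp, fun i _ => Finset.mem_univ i⟩)))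
    rw [hq]
    have h0 := (hb.mem_convexHull_iff x).1 hx
    have hmem : (fun i => b (e i) x) ∈ Set.univ.pi (fun _ : Fin 4 => Set.Icc (0 : ℝ) 1) := by
      intro i _
      refine ⟨h0 _ (e i).2, ?_⟩
      rw [← hb.sum_eq_one x]
      exact Finset.single_le_sum (f := fun v => b v x) h0 (e i).2
    have hSC : S (fun i => b (e i) x) ≤ C := hC ⟨_, hmem, rfl⟩
    calc |∑ a ∈ A, f (node a) * MvPolynomial.eval (fun i => b (e i) x) (lagrangeBasis k a)|
        ≤ ∑ a ∈ A, |f (node a) * MvPolynomial.eval (fun i => b (e i) x) (lagrangeBasis k a)| :=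
          Finset.abs_sum_le_sum_abs _ _
      _ ≤ ∑ a ∈ A, μ * |MvPolynomial.eval (fun i => b (e i) x) (lagrangeBasis k a)| := by
          refine Finset.sum_le_sum fun a ha => ?_
          rw [abs_mul]
          exact mul_le_mul_of_nonneg_right (hμ _ (hnode a ha)) (abs_nonneg _)
      _ = S (fun i => b (e i) x) * μ := by rw [← Finset.mul_sum, mul_comm]
      _ ≤ max C 1 * μ := mul_le_mul_of_nonneg_right (hSC.trans (le_max_left _ _)) hμ0

/-! ### Gradients of polynomials and inverse inequalities on balls. -/

/-- The gradient of a polynomial function as a vector of polynomials. -/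
theorem hasGradientAt_polyFun (p : MvPolynomial (Fin 3) ℝ) (x : E3) :
    HasGradientAt (polyFun p) (WithLp.toLp 2 fun i => polyFun (MvPolynomial.pderiv i p) x) x := by
  have key : HasFDerivAt (polyFun p) (∑ i, polyFun (MvPolynomial.pderiv i p) x •
      (EuclideanSpace.proj i : E3 →L[ℝ] ℝ)) x := by
    induction p using MvPolynomial.induction_on with
    | C a =>
      have : polyFun (MvPolynomial.C a) = fun _ => a := by funext y; simp [polyFun]
      rw [this]
      simpa [polyFun] using hasFDerivAt_const a x
    | add p q hp hq =>
      have : polyFun (p + q) = polyFun p + polyFun q := by funext y; exact polyFun_add p q y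
      rw [this]
      refine (hp.add hq).congr_fderiv ?_
      simp [polyFun_add, add_smul, Finset.sum_add_distrib]
    | mul_X p j hp =>
      have : polyFun (p * MvPolynomial.X j) = fun y => polyFun p y * y j := by
        funext y; simp [polyFun]
      rw [this]
      have hj : HasFDerivAt (fun y : E3 => y j) (EuclideanSpace.proj j : E3 →L[ℝ] ℝ) x :=
        (EuclideanSpace.proj j : E3 →L[ℝ] ℝ).hasFDerivAt
      refine (hp.mul hj).congr_fderiv ?_
      ext y
      simp [polyFun, Derivation.leibniz, MvPolynomial.pderiv_X, Finset.sum_add_distrib, add_mul,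
        Finset.mul_sum, Pi.single_apply, apply_ite]
      exact Finset.sum_congr rfl fun i _ => by ring
  rw [hasGradientAt_iff_hasFDerivAt]
  refine key.congr_fderiv ?_
  ext y
  simp [PiLp.inner_apply, mul_comm]

theorem gradient_polyFun (p : MvPolynomial (Fin 3) ℝ) (x : E3) :
    gradient (polyFun p) x = WithLp.toLp 2 fun i => polyFun (MvPolynomial.pderiv i p) x :=
  (hasGradientAt_polyFun p x).gradient

theorem differentiable_polyFun (p : MvPolynomial (Fin 3) ℝ) : Differentiable ℝ (polyFun p) :=
  fun x => (hasGradientAt_polyFun p x).differentiableAt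

theorem norm_gradient_polyFun_sq (p : MvPolynomial (Fin 3) ℝ) (x : E3) :
    ‖gradient (polyFun p) x‖ ^ 2 = ∑ i, polyFun (MvPolynomial.pderiv i p) x ^ 2 := by
  rw [gradient_polyFun, EuclideanSpace.norm_sq_eq]
  simp

theorem continuous_gradient_polyFun (p : MvPolynomial (Fin 3) ℝ) :
    Continuous (gradient (polyFun p)) := by
  have : gradient (polyFun p) =
      fun x => WithLp.toLp 2 fun i => polyFun (MvPolynomial.pderiv i p) x :=
    funext fun x => gradient_polyFun p x
  rw [this]
  exact (PiLp.continuous_toLp 2 _).comp (continuous_pi fun i => continuous_polyFun _)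

theorem gradient_polyFun_sub (p q : MvPolynomial (Fin 3) ℝ) (x : E3) :
    gradient (polyFun (p - q)) x = gradient (polyFun p) x - gradient (polyFun q) x := by
  ext i
  simp [gradient_polyFun, polyFun_sub]

theorem totalDegree_pderiv_le (i : Fin 3) (p : MvPolynomial (Fin 3) ℝ) :
    (MvPolynomial.pderiv i p).totalDegree ≤ p.totalDegree := by
  conv_lhs => rw [p.as_sum, map_sum]
  refine MvPolynomial.totalDegree_finsetSum_le fun d hd => ?_
  rw [MvPolynomial.pderiv_monomial]
  refine (MvPolynomial.totalDegree_monomial_le _ _).trans ?_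
  refine le_trans ?_ (MvPolynomial.le_totalDegree hd)
  rw [Finsupp.sum_fintype _ _ (fun _ => rfl), Finsupp.sum_fintype _ _ (fun _ => rfl)]
  exact Finset.sum_le_sum fun j _ => by simp

/-- A polynomial vanishing on a nonempty open set is zero. -/
theorem eq_zero_of_polyFun_eq_zero {p : MvPolynomial (Fin 3) ℝ} {U : Set E3} (hU : IsOpen U)
    (hne : U.Nonempty) (h : ∀ x ∈ U, polyFun p x = 0) : p = 0 := by
  obtain ⟨x0, hx0⟩ := hne
  have hV : IsOpen ((WithLp.toLp 2 : (Fin 3 → ℝ) → E3) ⁻¹' U) :=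
    hU.preimage (PiLp.continuous_toLp 2 _)
  obtain ⟨ε, hε, hball⟩ := Metric.isOpen_iff.1 hV x0.ofLp hx0
  refine MvPolynomial.funext_set (fun i => Set.Ioo (x0 i - ε) (x0 i + ε)) (fun i => ?_) ?_
  · exact Set.Ioo_infinite (by linarith)
  · intro y hy
    rw [map_zero]
    refine h (WithLp.toLp 2 y) (hball ?_)
    rw [Metric.mem_ball, dist_pi_lt_iff hε]
    intro i
    have := hy i (Set.mem_univ i)
    rw [Real.dist_eq, abs_lt]
    exact ⟨by linarith [this.1], by linarith [this.2]⟩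

theorem Continuous.memLp_restrict_of_isBounded {F : Type*} [NormedAddCommGroup F] {f : E3 → F}
    (hf : Continuous f) {s : Set E3} (hs : Bornology.IsBounded s) :
    MemLp f 2 (volume.restrict s) := by
  obtain ⟨R, hR⟩ := hs.subset_closedBall 0
  obtain ⟨C, hC⟩ := (isCompact_closedBall (0 : E3) R).exists_bound_of_continuousOn hf.continuousOn
  have : MemLp f 2 (volume.restrict (Metric.closedBall (0 : E3) R)) := by
    have : IsFiniteMeasure (volume.restrict (Metric.closedBall (0 : E3) R)) :=
      ⟨by rw [Measure.restrict_apply_univ]; exact measure_closedBall_lt_top⟩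
    refine MemLp.of_bound hf.aestronglyMeasurable C ?_
    exact (ae_restrict_iff' measurableSet_closedBall).2 (ae_of_all _ hC)
  exact this.mono_measure (Measure.restrict_mono hR le_rfl)

theorem inner_toLp_eq_integral {F : Type*} [NormedAddCommGroup F] [InnerProductSpace ℝ F]
    {μ : Measure E3} {G H : E3 → F} (hG : MemLp G 2 μ) (hH : MemLp H 2 μ) :
    inner ℝ (hG.toLp G) (hH.toLp H) = ∫ x, inner ℝ (G x) (H x) ∂μ := by
  rw [L2.inner_def]
  refine integral_congr_ae ?_
  filter_upwards [hG.coeFn_toLp, hH.coeFn_toLp] with x h1 h2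
  rw [h1, h2]

theorem norm_toLp_sq_eq_integral {F : Type*} [NormedAddCommGroup F] [InnerProductSpace ℝ F]
    {μ : Measure E3} {G : E3 → F} (hG : MemLp G 2 μ) :
    ‖hG.toLp G‖ ^ 2 = ∫ x, ‖G x‖ ^ 2 ∂μ := by
  rw [← real_inner_self_eq_norm_sq, inner_toLp_eq_integral]
  simp only [real_inner_self_eq_norm_sq]

/-- Equivalence of norms without a norm on `V`: `B ∘ A⁻¹` is linear on the finite-dimensional range
of `A`, hence bounded. Both inverse inequalities come from this. -/
theorem exists_norm_le_of_injective {V X Y : Type*} [AddCommGroup V] [Module ℝ V]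
    [Module.Finite ℝ V] [NormedAddCommGroup X] [NormedSpace ℝ X] [NormedAddCommGroup Y]
    [NormedSpace ℝ Y] (A : V →ₗ[ℝ] X) (hA : Function.Injective A) (B : V →ₗ[ℝ] Y) :
    ∃ C : ℝ, 0 < C ∧ ∀ v, ‖B v‖ ≤ C * ‖A v‖ := by
  let e := LinearEquiv.ofInjective A hA
  let g : LinearMap.range A →L[ℝ] Y := (B ∘ₗ (e.symm : LinearMap.range A →ₗ[ℝ] V)).toContinuousLinearMap
  refine ⟨‖g‖ + 1, by positivity, fun v => ?_⟩
  have h1 : g (e v) = B v := by simp [g]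
  have h2 : ‖e v‖ = ‖A v‖ := rfl
  rw [← h1, ← h2]
  exact (g.le_opNorm _).trans (mul_le_mul_of_nonneg_right (by linarith) (norm_nonneg _))

/-- On polynomials of bounded degree, values and derivatives are controlled by the norm of
`L²` of the unit ball. -/
theorem exists_sq_le_integral_unitBall (k : ℕ) (R : ℝ)
    (D : MvPolynomial (Fin 3) ℝ →ₗ[ℝ] MvPolynomial (Fin 3) ℝ) : ∃ C : ℝ, 0 < C ∧
    ∀ p : MvPolynomial (Fin 3) ℝ, p.totalDegree ≤ k → ∀ x ∈ Metric.closedBall (0 : E3) R,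
      polyFun (D p) x ^ 2 ≤ C * ∫ y in Metric.ball (0 : E3) 1, polyFun p y ^ 2 := by
  let V := MvPolynomial.restrictTotalDegree (Fin 3) ℝ k
  have hmem : ∀ p : MvPolynomial (Fin 3) ℝ,
      MemLp (polyFun p) 2 (volume.restrict (Metric.ball (0 : E3) 1)) :=
    fun p => (continuous_polyFun p).memLp_restrict_of_isBounded Metric.isBounded_ball
  let A : V →ₗ[ℝ] Lp ℝ 2 (volume.restrict (Metric.ball (0 : E3) 1)) :=
    { toFun := fun p => (hmem p.1).toLp
      map_add' := fun p q => by
        rw [← MemLp.toLp_add]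
        exact MemLp.toLp_congr _ _ (ae_of_all _ fun x => polyFun_add _ _ x)
      map_smul' := fun c p => by
        rw [RingHom.id_apply, ← MemLp.toLp_const_smul]
        exact MemLp.toLp_congr _ _ (ae_of_all _ fun x => by simp [polyFun]) }
  -- A polynomial that vanishes almost everywhere on the ball vanishes there by continuity, hence
  -- identically.
  have hA : Function.Injective A := by
    rw [← LinearMap.ker_eq_bot, LinearMap.ker_eq_bot']
    intro p hp
    have h1 : (hmem p.1).toLp = (hmem 0).toLp := by
      have h0 := A.map_zero
      exact hp.trans h0.symm
    rw [MemLp.toLp_eq_toLp_iff] at h1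
    have h2 := Measure.eqOn_open_of_ae_eq h1 Metric.isOpen_ball
      (continuous_polyFun _).continuousOn (continuous_polyFun _).continuousOn
    refine Subtype.ext (eq_zero_of_polyFun_eq_zero Metric.isOpen_ball
      ⟨0, Metric.mem_ball_self one_pos⟩ fun x hx => ?_)
    rw [h2 hx]
    simp [polyFun]
  let B : V →ₗ[ℝ] C(Metric.closedBall (0 : E3) R, ℝ) :=
    { toFun := fun p => ⟨fun x => polyFun (D p.1) x, (continuous_polyFun _).comp continuous_subtype_val⟩
      map_add' := fun p q => by ext x; simp [polyFun]
      map_smul' := fun c p => by ext x; simp [polyFun] }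
  obtain ⟨C, hC, h⟩ := exists_norm_le_of_injective A hA B
  refine ⟨C ^ 2, by positivity, fun p hp x hx => ?_⟩
  have hpV : p ∈ V := (MvPolynomial.mem_restrictTotalDegree _ _ _).2 hp
  have h1 := h ⟨p, hpV⟩
  have h2 : |polyFun (D p) x| ≤ ‖B ⟨p, hpV⟩‖ :=
    ContinuousMap.norm_coe_le_norm (B ⟨p, hpV⟩) ⟨x, hx⟩
  have h3 : ‖A ⟨p, hpV⟩‖ ^ 2 = ∫ y in Metric.ball (0 : E3) 1, polyFun p y ^ 2 := by
    refine (norm_toLp_sq_eq_integral (hmem p)).trans ?_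
    simp
  rw [← h3, ← mul_pow, ← sq_abs (polyFun (D p) x)]
  exact pow_le_pow_left₀ (abs_nonneg _) (h2.trans h1) 2

/-- The polynomial `y ↦ p (c + r y)`. -/
def rescale (c : E3) (r : ℝ) (p : MvPolynomial (Fin 3) ℝ) : MvPolynomial (Fin 3) ℝ :=
  MvPolynomial.aeval (fun i => MvPolynomial.C (c i) + MvPolynomial.C r * MvPolynomial.X i) p

theorem totalDegree_rescale_le (c : E3) (r : ℝ) {k : ℕ} {p : MvPolynomial (Fin 3) ℝ}
    (hp : p.totalDegree ≤ k) : (rescale c r p).totalDegree ≤ k := by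
  refine totalDegree_aeval_le hp _ fun i => ?_
  refine (MvPolynomial.totalDegree_add _ _).trans (max_le (by simp) ?_)
  exact (MvPolynomial.totalDegree_mul _ _).trans (by simp)

theorem polyFun_rescale (c : E3) (r : ℝ) (p : MvPolynomial (Fin 3) ℝ) (y : E3) :
    polyFun (rescale c r p) y = polyFun p (c + r • y) := by
  unfold rescale
  rw [polyFun_aeval]
  simp [polyFun]

theorem pderiv_rescale (c : E3) (r : ℝ) (p : MvPolynomial (Fin 3) ℝ) (i : Fin 3) :
    MvPolynomial.pderiv i (rescale c r p) =
      MvPolynomial.C r * rescale c r (MvPolynomial.pderiv i p) := by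
  unfold rescale
  induction p using MvPolynomial.induction_on with
  | C a => simp
  | add p q hp hq => rw [map_add, map_add, hp, hq, map_add, map_add, mul_add]
  | mul_X p j hp =>
    simp only [map_mul, MvPolynomial.aeval_X, Derivation.leibniz, hp, map_add,
      MvPolynomial.pderiv_X, MvPolynomial.pderiv_C, smul_eq_mul]
    by_cases hij : i = j
    · subst hij
      simp
      ring
    · simp [Ne.symm hij]
      ring

theorem setIntegral_ball_eq_rescale (f : E3 → ℝ) (c : E3) {r : ℝ} (hr : 0 < r) :
    ∫ y in Metric.ball (0 : E3) 1, f (c + r • y) = (r ^ 3)⁻¹ * ∫ x in Metric.ball c r, f x := by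
  have h := Measure.setIntegral_comp_smul_of_pos (volume : Measure E3) (fun z => f (c + z))
    (Metric.ball (0 : E3) 1) hr
  rw [h, smul_unitBall_of_pos hr]
  have h2 := (measurePreserving_add_left (volume : Measure E3) c).setIntegral_preimage_emb
    (MeasurableEquiv.addLeft c).measurableEmbedding f (Metric.ball c r)
  have h3 : (fun x => c + x) ⁻¹' Metric.ball c r = Metric.ball (0 : E3) r := by
    ext x
    simp
  rw [h3] at h2
  rw [h2]
  simp

/-- Scaling from the unit ball; `r ^ 3` is the Jacobian. The factor `R` allows points outside the
ball of integration, since `w_T` is also evaluated outside its tetrahedron. -/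
theorem exists_sq_le_integral_ball (k : ℕ) (R : ℝ) : ∃ C : ℝ, 0 < C ∧
    ∀ p : MvPolynomial (Fin 3) ℝ, p.totalDegree ≤ k → ∀ (c : E3) (r : ℝ), 0 < r →
      ∀ x ∈ Metric.closedBall c (R * r),
        polyFun p x ^ 2 ≤ C * (r ^ 3)⁻¹ * ∫ y in Metric.ball c r, polyFun p y ^ 2 := by
  obtain ⟨C, hC, h⟩ := exists_sq_le_integral_unitBall k R LinearMap.id
  refine ⟨C, hC, fun p hp c r hr x hx => ?_⟩
  have h1 := h (rescale c r p) (totalDegree_rescale_le c r hp) (r⁻¹ • (x - c)) (by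
    rw [mem_closedBall_zero_iff, norm_smul, Real.norm_of_nonneg (by positivity), ← dist_eq_norm,
      inv_mul_le_iff₀ hr, mul_comm]
    exact hx)
  simp only [LinearMap.id_apply, polyFun_rescale] at h1
  rw [setIntegral_ball_eq_rescale (fun x => polyFun p x ^ 2) c hr, smul_inv_smul₀ hr.ne',
    add_sub_cancel, ← mul_assoc] at h1
  exact h1

/-- Under the dilation that carries the ball to the unit ball, a derivative costs a factor `1 / r`.
-/
theorem exists_pderiv_le_of_ball (k : ℕ) (R : ℝ) : ∃ C : ℝ, 0 < C ∧
    ∀ p : MvPolynomial (Fin 3) ℝ, p.totalDegree ≤ k → ∀ (c : E3) (r : ℝ), 0 < r →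
      ∀ μ : ℝ, (∀ y ∈ Metric.ball c r, |polyFun p y| ≤ μ) →
      ∀ x ∈ Metric.closedBall c (R * r), ∀ i,
        polyFun (MvPolynomial.pderiv i p) x ^ 2 ≤ C * (μ / r) ^ 2 := by
  choose C hC h using fun i : Fin 3 => exists_sq_le_integral_unitBall k R
    (MvPolynomial.pderiv i : Derivation ℝ _ _).toLinearMap
  let vol := volume.real (Metric.ball (0 : E3) 1)
  have hvol : 0 ≤ vol := measureReal_nonneg
  refine ⟨(∑ i, C i) * (vol + 1), by
    have : 0 < ∑ i, C i := Finset.sum_pos (fun i _ => hC i) Finset.univ_nonempty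
    positivity, fun p hp c r hr μ hμ x hx i => ?_⟩
  have h1 := h i (rescale c r p) (totalDegree_rescale_le c r hp) (r⁻¹ • (x - c)) (by
    rw [mem_closedBall_zero_iff, norm_smul, Real.norm_of_nonneg (by positivity), ← dist_eq_norm,
      inv_mul_le_iff₀ hr, mul_comm]
    exact hx)
  have h2 : polyFun ((MvPolynomial.pderiv i : Derivation ℝ _ _).toLinearMap (rescale c r p))
      (r⁻¹ • (x - c)) = r * polyFun (MvPolynomial.pderiv i p) x := by
    have : polyFun (MvPolynomial.pderiv i (rescale c r p)) (r⁻¹ • (x - c)) =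
        r * polyFun (rescale c r (MvPolynomial.pderiv i p)) (r⁻¹ • (x - c)) := by
      rw [pderiv_rescale]
      simp [polyFun]
    rw [polyFun_rescale, smul_inv_smul₀ hr.ne', add_sub_cancel] at this
    exact this
  rw [h2] at h1
  have h3 : ∫ y in Metric.ball (0 : E3) 1, polyFun (rescale c r p) y ^ 2 ≤ vol * μ ^ 2 := by
    have : ∫ y in Metric.ball (0 : E3) 1, polyFun (rescale c r p) y ^ 2 ≤
        ∫ _ in Metric.ball (0 : E3) 1, μ ^ 2 := by
      refine setIntegral_mono_on ?_ ?_ measurableSet_ball fun y hy => ?_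
      · have := ((continuous_polyFun (rescale c r p)).memLp_restrict_of_isBounded
          (Metric.isBounded_ball (x := (0 : E3)) (r := 1))).integrable_sq
        exact this
      · exact integrableOn_const (hs := measure_ball_lt_top.ne)
      · rw [polyFun_rescale, ← sq_abs]
        refine pow_le_pow_left₀ (abs_nonneg _) (hμ _ ?_) 2
        rw [Metric.mem_ball, dist_eq_norm, add_sub_cancel_left, norm_smul, Real.norm_of_nonneg hr.le]
        have := mem_ball_zero_iff.1 hy
        nlinarith
    refine this.trans_eq ?_
    rw [setIntegral_const, smul_eq_mul]
  have h4 : C i ≤ ∑ i, C i :=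
    Finset.single_le_sum (f := C) (fun j _ => (hC j).le) (Finset.mem_univ i)
  have h5 : (r * polyFun (MvPolynomial.pderiv i p) x) ^ 2 ≤ (∑ i, C i) * (vol + 1) * μ ^ 2 := by
    refine h1.trans ((mul_le_mul_of_nonneg_left h3 (hC i).le).trans ?_)
    rw [← mul_assoc]
    refine mul_le_mul_of_nonneg_right ?_ (sq_nonneg _)
    exact mul_le_mul h4 (by linarith) hvol ((hC i).le.trans h4)
  rw [div_pow, ← mul_div_assoc, le_div_iff₀ (by positivity)]
  calc _ = (r * polyFun (MvPolynomial.pderiv i p) x) ^ 2 := by ring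
    _ ≤ _ := h5

/-! ### The energy estimate on one tetrahedron. -/

theorem isBounded_convexHull_finset (T : Finset E3) :
    Bornology.IsBounded (convexHull ℝ (T : Set E3)) :=
  (Set.Finite.isCompact_convexHull ℝ T.finite_toSet).isBounded

theorem IsLatticePoint.mem_convexHull {k : ℕ} (hk : 0 < k) {T : Finset E3} {x : E3}
    (hx : IsLatticePoint k T x) : x ∈ convexHull ℝ (T : Set E3) := by
  obtain ⟨a, ha, rfl⟩ := hx
  rw [mem_convexHull_finset_iff]
  refine ⟨fun v => (a v : ℝ) / k, fun v _ => by positivity, ?_, rfl⟩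
  rw [← Finset.sum_div, ← Nat.cast_sum, ha]
  exact div_self (by exact_mod_cast hk.ne')

theorem integrableOn_norm_gradient_polyFun_sq (p : MvPolynomial (Fin 3) ℝ) {s : Set E3}
    (hs : Bornology.IsBounded s) : IntegrableOn (fun x => ‖gradient (polyFun p) x‖ ^ 2) s :=
  ((continuous_gradient_polyFun p).norm.memLp_restrict_of_isBounded hs).integrable_sq

/-- A polynomial whose nodal values are those of `w` at nodes close to a zero of `w`, and vanish
at the other nodes, is small in the energy norm compared to `w`. -/
theorem exists_energy_le_of_nodes (k : ℕ) (hk : 0 < k) {σ : ℝ} (hσ : 0 < σ) :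
    ∃ ε : ℝ, 0 < ε ∧ ∀ T : Finset E3, T.card = 4 → AffineIndependent ℝ ((↑) : T → E3) →
    ∀ w : MvPolynomial (Fin 3) ℝ, w.totalDegree ≤ k → ∀ (c : E3) (r : ℝ), 0 < r →
    Metric.ball c r ⊆ convexHull ℝ (T : Set E3) →
    Metric.diam (convexHull ℝ (T : Set E3)) ≤ σ * r → ∀ f : E3 → ℝ,
    (∀ x, IsLatticePoint k T x → f x = 0 ∨ (f x = polyFun w x ∧
      ∃ P, dist x P ≤ ε * Metric.diam (convexHull ℝ (T : Set E3)) ∧ polyFun w P = 0)) →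
    ∃ q : MvPolynomial (Fin 3) ℝ, q.totalDegree ≤ k ∧
      (∀ x, IsLatticePoint k T x → polyFun q x = f x) ∧
      ∫ x in interior (convexHull ℝ (T : Set E3)), ‖gradient (polyFun q) x‖ ^ 2 ≤
        1 / 4 * ∫ x in interior (convexHull ℝ (T : Set E3)), ‖gradient (polyFun w) x‖ ^ 2 := by
  -- Within `2 σ r` of the centre of the inscribed ball lie `T` itself and all points at distance at
  -- most `ε σ r ≤ σ r` from it.
  obtain ⟨C₁, hC₁, h₁⟩ := exists_sq_le_integral_ball k (2 * σ)
  obtain ⟨C₂, hC₂, h₂⟩ := exists_interpolation k hk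
  obtain ⟨C₃, hC₃, h₃⟩ := exists_pderiv_le_of_ball k σ
  let B := volume.real (Metric.closedBall (0 : E3) 1)
  have hB : 0 ≤ B := measureReal_nonneg
  -- Nodal values are at most `ε σ r G` with `G² = C₁ r⁻³ I`, the squared gradient of the
  -- interpolant is at most `3 C₃ (C₂ ε σ G)²`, and the volume at most `(σ r)³ B`; the product is `κ
  -- ε² I`.
  let κ := 3 * C₃ * C₂ ^ 2 * σ ^ 5 * C₁ * B
  have hκ : 0 ≤ κ := by positivity
  let ε := 1 / (4 * (κ + 1))
  have hε : 0 < ε := by positivity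
  have hε1 : ε ≤ 1 := by
    rw [div_le_one (by positivity)]; linarith
  have hκε : κ * ε ^ 2 ≤ 1 / 4 := by
    have h1 : κ * ε ≤ 1 / 4 := by
      simp only [ε]
      rw [mul_one_div, div_le_div_iff₀ (by positivity) (by positivity)]
      linarith
    nlinarith
  refine ⟨ε, hε, fun T hc hi w hw c r hr hball hdiam f hf => ?_⟩
  obtain ⟨q, hq, hqf, hqb⟩ := h₂ T hc hi f
  refine ⟨q, hq, hqf, ?_⟩
  set H := convexHull ℝ (T : Set E3) with hH
  set h := Metric.diam H with hh
  have hbd : Bornology.IsBounded H := isBounded_convexHull_finset T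
  have hbdi : Bornology.IsBounded (interior H) := hbd.subset interior_subset
  have hcH : c ∈ H := hball (Metric.mem_ball_self hr)
  have hh0 : 0 ≤ h := Metric.diam_nonneg
  have hHc : ∀ x ∈ H, dist x c ≤ σ * r := fun x hx =>
    (Metric.dist_le_diam_of_mem hbd hx hcH).trans hdiam
  set I := ∫ y in Metric.ball c r, ‖gradient (polyFun w) y‖ ^ 2 with hI
  have hI0 : 0 ≤ I := integral_nonneg fun y => sq_nonneg _
  set G := Real.sqrt (C₁ * (r ^ 3)⁻¹ * I) with hG
  have hG0 : 0 ≤ G := Real.sqrt_nonneg _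
  have hGsq : G ^ 2 = C₁ * (r ^ 3)⁻¹ * I := Real.sq_sqrt (by positivity)
  have hgrad : ∀ x ∈ Metric.closedBall c (2 * σ * r), ‖gradient (polyFun w) x‖ ≤ G := by
    intro x hx
    refine Real.le_sqrt_of_sq_le ?_
    rw [norm_gradient_polyFun_sq]
    have e : I = ∑ i, ∫ y in Metric.ball c r, polyFun (MvPolynomial.pderiv i w) y ^ 2 := by
      rw [hI, ← integral_finsetSum]
      · simp only [norm_gradient_polyFun_sq]
      · intro i _
        exact ((continuous_polyFun _).memLp_restrict_of_isBounded
          Metric.isBounded_ball).integrable_sq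
    rw [e, Finset.mul_sum]
    exact Finset.sum_le_sum fun i _ =>
      h₁ _ ((totalDegree_pderiv_le i w).trans hw) c r hr x hx
  have hnode : ∀ x, IsLatticePoint k T x → |f x| ≤ ε * (σ * r) * G := by
    intro x hx
    rcases hf x hx with h0 | ⟨hfx, P, hP, hwP⟩
    · rw [h0, abs_zero]
      positivity
    · have hxc : dist x c ≤ σ * r := hHc x (hx.mem_convexHull hk)
      have hxP : dist x P ≤ ε * (σ * r) := hP.trans (mul_le_mul_of_nonneg_left hdiam hε.le)
      have hx2 : x ∈ Metric.closedBall c (2 * σ * r) := by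
        rw [Metric.mem_closedBall]
        nlinarith [mul_pos hσ hr]
      have hP2 : P ∈ Metric.closedBall c (2 * σ * r) := by
        rw [Metric.mem_closedBall]
        have := dist_triangle P x c
        rw [dist_comm P x] at this
        have h5 : ε * (σ * r) ≤ 1 * (σ * r) := mul_le_mul_of_nonneg_right hε1 (by positivity)
        linarith
      -- Mean value inequality between the node and the nearby zero of `w`.
      have hmv := (convex_closedBall c (2 * σ * r)).norm_image_sub_le_of_norm_fderiv_le
        (𝕜 := ℝ) (f := polyFun w) (C := G) (fun y _ => differentiable_polyFun w y)
        (fun y hy => by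
          rw [← toDual_gradient, LinearIsometryEquiv.norm_map]
          exact hgrad y hy) hP2 hx2
      rw [hwP, sub_zero, ← dist_eq_norm, Real.norm_eq_abs] at hmv
      rw [hfx]
      refine hmv.trans ?_
      rw [mul_comm]
      exact mul_le_mul_of_nonneg_right hxP hG0
  have hqball : ∀ y ∈ Metric.ball c r, |polyFun q y| ≤ C₂ * (ε * (σ * r) * G) :=
    fun y hy => hqb _ hnode y (hball hy)
  have hqgrad : ∀ x ∈ interior H, ‖gradient (polyFun q) x‖ ^ 2 ≤
      3 * C₃ * C₂ ^ 2 * ε ^ 2 * σ ^ 2 * G ^ 2 := by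
    intro x hx
    rw [norm_gradient_polyFun_sq]
    have h5 : ∀ i ∈ (Finset.univ : Finset (Fin 3)), polyFun (MvPolynomial.pderiv i q) x ^ 2 ≤
        C₃ * (C₂ * (ε * (σ * r) * G) / r) ^ 2 := fun i _ =>
      h₃ q hq c r hr _ hqball x (hHc x (interior_subset hx)) i
    refine (Finset.sum_le_card_nsmul _ _ _ h5).trans_eq ?_
    simp only [Finset.card_univ, Fintype.card_fin, nsmul_eq_mul]
    field_simp
    push_cast
    ring
  have hvol : volume.real (interior H) ≤ (σ * r) ^ 3 * B := by
    have h5 : interior H ⊆ Metric.closedBall c (σ * r) := fun x hx => hHc x (interior_subset hx)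
    refine (measureReal_mono h5 measure_closedBall_lt_top.ne).trans_eq ?_
    rw [Measure.real, Measure.addHaar_closedBall' volume c (by positivity : (0 : ℝ) ≤ σ * r),
      ENNReal.toReal_mul, ENNReal.toReal_ofReal (by positivity)]
    simp [B, Measure.real]
  have hIH : I ≤ ∫ x in interior H, ‖gradient (polyFun w) x‖ ^ 2 := by
    refine setIntegral_mono_set (integrableOn_norm_gradient_polyFun_sq w hbdi)
      (ae_of_all _ fun y => sq_nonneg _) (LE.le.eventuallyLE ?_)
    exact interior_maximal hball Metric.isOpen_ball
  have hfin : volume (interior H) ≠ ⊤ := hbdi.measure_lt_top.ne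
  calc ∫ x in interior H, ‖gradient (polyFun q) x‖ ^ 2
      ≤ ∫ _ in interior H, 3 * C₃ * C₂ ^ 2 * ε ^ 2 * σ ^ 2 * G ^ 2 :=
        setIntegral_mono_on (integrableOn_norm_gradient_polyFun_sq q hbdi)
          (integrableOn_const (hs := hfin)) isOpen_interior.measurableSet hqgrad
    _ = volume.real (interior H) * (3 * C₃ * C₂ ^ 2 * ε ^ 2 * σ ^ 2 * G ^ 2) := by
        rw [setIntegral_const, smul_eq_mul]
    _ ≤ (σ * r) ^ 3 * B * (3 * C₃ * C₂ ^ 2 * ε ^ 2 * σ ^ 2 * G ^ 2) :=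
        mul_le_mul_of_nonneg_right hvol (by positivity)
    _ = κ * ε ^ 2 * I := by
        rw [hGsq]
        simp only [κ]
        field_simp
    _ ≤ 1 / 4 * I := mul_le_mul_of_nonneg_right hκε hI0
    _ ≤ _ := mul_le_mul_of_nonneg_left hIH (by norm_num)

/-! ### The boundary of the polyhedron as a union of faces of the mesh. -/

theorem AffineMap.apply_add_eq (f : E3 →ᵃ[ℝ] ℝ) (x u : E3) : f (x + u) = f.linear u + f x := by
  have := f.map_vadd x u
  simpa [add_comm] using this

theorem IsBarycentric.continuous {T : Finset E3} {b : E3 → E3 →ᵃ[ℝ] ℝ} (_ : IsBarycentric T b)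
    (v : E3) : Continuous (b v) := (b v).continuous_of_finiteDimensional

theorem IsBarycentric.apply_sum_subset {T : Finset E3} {b : E3 → E3 →ᵃ[ℝ] ℝ}
    (h : IsBarycentric T b) {τ : Finset E3} (hτ : τ ⊆ T) (l : E3 → ℝ) (hl : ∑ v ∈ τ, l v = 1) :
    (∀ v ∈ τ, b v (∑ u ∈ τ, l u • u) = l v) ∧
      ∀ v ∈ T, v ∉ τ → b v (∑ u ∈ τ, l u • u) = 0 := by
  classical
  have e1 : ∑ u ∈ T, (if u ∈ τ then l u else 0) = 1 := by
    rw [← hl, Finset.sum_ite_mem, Finset.inter_eq_right.2 hτ]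
  have e2 : ∑ u ∈ τ, l u • u = ∑ u ∈ T, (if u ∈ τ then l u else 0) • u := by
    simp only [ite_smul, zero_smul]
    rw [Finset.sum_ite_mem, Finset.inter_eq_right.2 hτ]
  rw [e2]
  refine ⟨fun v hv => ?_, fun v hv hvτ => ?_⟩
  · rw [h.apply_sum _ e1 v (hτ hv), if_pos hv]
  · rw [h.apply_sum _ e1 v hv, if_neg hvτ]

namespace TetMesh

variable (K : TetMesh)

theorem exists_isBarycentric {T : Finset E3} (hT : T ∈ K.elements) : ∃ b, IsBarycentric T b :=
  _root_.exists_isBarycentric (K.card_eq_four T hT) (K.affineIndependent T hT)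

theorem isClosed_convexHull (T : Finset E3) : IsClosed (convexHull ℝ (T : Set E3)) :=
  (Set.Finite.isCompact_convexHull ℝ T.finite_toSet).isClosed

theorem isClosed_iUnion : IsClosed (⋃ T ∈ K.elements, convexHull ℝ (T : Set E3)) :=
  K.elements.finite_toSet.isClosed_biUnion fun T _ => isClosed_convexHull T

theorem isOpen_domain : IsOpen K.domain := isOpen_interior

theorem closure_domain_subset : closure K.domain ⊆ ⋃ T ∈ K.elements, convexHull ℝ (T : Set E3) :=
  K.isClosed_iUnion.closure_interior_subset

theorem isBounded_iUnion : Bornology.IsBounded (⋃ T ∈ K.elements, convexHull ℝ (T : Set E3)) :=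
  (Bornology.isBounded_biUnion_finset _).2 fun T _ => isBounded_convexHull_finset T

theorem isBounded_domain : Bornology.IsBounded K.domain :=
  K.isBounded_iUnion.subset interior_subset

theorem interior_subset_domain {T : Finset E3} (hT : T ∈ K.elements) :
    interior (convexHull ℝ (T : Set E3)) ⊆ K.domain :=
  interior_mono (Set.subset_biUnion_of_mem (u := fun T : Finset E3 => convexHull ℝ (T : Set E3)) hT)

theorem interior_convexHull_nonempty {T : Finset E3} (hT : T ∈ K.elements) :
    (interior (convexHull ℝ (T : Set E3))).Nonempty := by
  obtain ⟨b, hb⟩ := K.exists_isBarycentric hT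
  exact hb.interior_nonempty (K.card_eq_four T hT)

theorem convexHull_subset_closure {T : Finset E3} (hT : T ∈ K.elements) :
    convexHull ℝ (T : Set E3) ⊆ closure K.domain := by
  refine subset_trans ?_ (closure_mono (K.interior_subset_domain hT))
  rw [(convex_convexHull ℝ _).closure_interior_eq_closure_of_nonempty_interior
    (K.interior_convexHull_nonempty hT)]
  exact subset_closure

theorem boundary_eq : K.boundary = closure K.domain \ K.domain := K.isOpen_domain.frontier_eq

theorem mem_boundary_of_notMem_domain {T : Finset E3} (hT : T ∈ K.elements) {x : E3}
    (hx : x ∈ convexHull ℝ (T : Set E3)) (hxd : x ∉ K.domain) : x ∈ K.boundary := by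
  rw [boundary_eq]
  exact ⟨K.convexHull_subset_closure hT hx, hxd⟩

theorem notMem_domain_of_mem_boundary {x : E3} (hx : x ∈ K.boundary) : x ∉ K.domain := by
  rw [boundary_eq] at hx
  exact hx.2

theorem disjoint_interior {T T' : Finset E3} (hT : T ∈ K.elements) (hT' : T' ∈ K.elements)
    (hne : T ≠ T') : Disjoint (interior (convexHull ℝ (T : Set E3)))
      (interior (convexHull ℝ (T' : Set E3))) := by
  classical
  rw [Set.disjoint_left]
  intro x hx hx'
  obtain ⟨b, hb⟩ := K.exists_isBarycentric hT
  have h1 := K.inter_subset T hT T' hT' ⟨interior_subset hx, interior_subset hx'⟩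
  rw [← Finset.coe_inter, hb.mem_convexHull_subset_iff Finset.inter_subset_left] at h1
  rw [hb.interior_eq] at hx
  apply hne
  refine Finset.eq_of_subset_of_card_le (fun v hv => ?_)
    (by rw [K.card_eq_four T hT, K.card_eq_four T' hT'])
  by_contra hv'
  have := h1.2 v hv (fun h => hv' (Finset.mem_inter.1 h).2)
  exact absurd (hx v hv) (by rw [this]; exact lt_irrefl 0)

/-- The mesh is locally the same at all points of the relative interior of a face. -/
theorem mem_domain_of_relint {T τ : Finset E3} (hT : T ∈ K.elements) {b : E3 → E3 →ᵃ[ℝ] ℝ}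
    (hb : IsBarycentric T b) (hτ : τ ⊆ T) {x M : E3} (hxd : x ∈ K.domain)
    (hx0 : ∀ v ∈ τ, 0 < b v x) (hx1 : ∀ v ∈ T, v ∉ τ → b v x = 0)
    (hM0 : ∀ v ∈ τ, 0 < b v M) (hM1 : ∀ v ∈ T, v ∉ τ → b v M = 0) : M ∈ K.domain := by
  classical
  have hsum : ∀ y, (∀ v ∈ T, v ∉ τ → b v y = 0) →
      ∑ v ∈ τ, b v y = 1 ∧ ∑ v ∈ τ, b v y • v = y := by
    intro y hy
    constructor
    · rw [← hb.sum_eq_one y]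
      exact Finset.sum_subset hτ hy
    · conv_rhs => rw [← hb.sum_smul y]
      exact Finset.sum_subset hτ fun v hv hvτ => by simp only [hy v hv hvτ, zero_smul]
  have hxT : x ∈ convexHull ℝ (T : Set E3) := by
    rw [hb.mem_convexHull_iff]
    intro v hv
    by_cases h : v ∈ τ
    · exact (hx0 v h).le
    · exact (hx1 v hv h).ge
  -- The translation carrying `M` to `x` compares the mesh near the two points: what covers a
  -- neighbourhood of `x` covers one of `M`.
  have hcont : Filter.Tendsto (fun y : E3 => x + (y - M)) (nhds M) (nhds x) := by
    have : Continuous fun y : E3 => x + (y - M) := by fun_prop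
    simpa using this.tendsto M
  have hev1 : ∀ᶠ y in nhds M, x + (y - M) ∈ K.domain := hcont (K.isOpen_domain.mem_nhds hxd)
  have hev2 : ∀ᶠ y in nhds M, ∀ T' ∈ K.elements, x + (y - M) ∈ convexHull ℝ (T' : Set E3) →
      y ∈ convexHull ℝ (T' : Set E3) := by
    rw [Filter.eventually_all_finset]
    intro T' hT'
    by_cases hxT' : x ∈ convexHull ℝ (T' : Set E3)
    · have hx' := K.inter_subset T hT T' hT' ⟨hxT, hxT'⟩
      rw [← Finset.coe_inter, hb.mem_convexHull_subset_iff Finset.inter_subset_left] at hx'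
      -- By conformity any element through `x` has all of `τ` among its vertices.
      have hτ' : τ ⊆ T' := by
        intro v hv
        by_contra hv'
        have := hx'.2 v (hτ hv) (fun h => hv' (Finset.mem_inter.1 h).2)
        exact absurd (hx0 v hv) (by rw [this]; exact lt_irrefl 0)
      obtain ⟨b', hb'⟩ := K.exists_isBarycentric hT'
      have hcM := hb'.apply_sum_subset hτ' (fun v => b v M) (hsum M hM1).1
      have hcx := hb'.apply_sum_subset hτ' (fun v => b v x) (hsum x hx1).1
      rw [(hsum M hM1).2] at hcM
      rw [(hsum x hx1).2] at hcx
      have hpos : ∀ᶠ y in nhds M, ∀ v ∈ τ, 0 < b' v y := by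
        rw [Filter.eventually_all_finset]
        intro v hv
        refine (hb'.continuous v).continuousAt.eventually (lt_mem_nhds ?_)
        rw [hcM.1 v hv]
        exact hM0 v hv
      filter_upwards [hpos] with y hy hxy
      rw [hb'.mem_convexHull_iff] at hxy ⊢
      intro v hv
      by_cases hvτ : v ∈ τ
      · exact (hy v hvτ).le
      -- The coordinate of a vertex outside `τ` vanishes at both `x` and `M`, so by affinity it
      -- takes the same value at `y` and at its translate.
      · have h1 := hxy v hv
        rw [AffineMap.apply_add_eq, hcx.2 v hv hvτ] at h1
        have h2 := AffineMap.apply_add_eq (b' v) M (y - M)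
        rw [hcM.2 v hv hvτ, add_sub_cancel] at h2
        rw [h2]
        exact h1
    · filter_upwards [hcont ((isClosed_convexHull T').isOpen_compl.mem_nhds hxT')] with y hy hxy
      exact absurd hxy hy
  refine mem_interior_iff_mem_nhds.2 ?_
  filter_upwards [hev1, hev2] with y h1 h2
  obtain ⟨T', hT', h3⟩ := Set.mem_iUnion₂.1 (interior_subset h1)
  exact Set.mem_iUnion₂.2 ⟨T', hT', h2 T' hT' h3⟩

/-- A face whose relative interior contains a boundary point lies in the boundary. -/
theorem convexHull_subset_boundary {T τ : Finset E3} (hT : T ∈ K.elements)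
    {b : E3 → E3 →ᵃ[ℝ] ℝ} (hb : IsBarycentric T b) (hτ : τ ⊆ T) {M : E3} (hM : M ∈ K.boundary)
    (hM0 : ∀ v ∈ τ, 0 < b v M) (hM1 : ∀ v ∈ T, v ∉ τ → b v M = 0) :
    convexHull ℝ (τ : Set E3) ⊆ K.boundary := by
  intro x hx
  refine K.mem_boundary_of_notMem_domain hT (convexHull_mono (by exact_mod_cast hτ) hx) fun hxd => ?_
  rw [hb.mem_convexHull_subset_iff hτ] at hx
  have hcont : Filter.Tendsto (fun t : ℝ => AffineMap.lineMap x M t) (nhdsWithin 0 (Set.Ioi 0))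
      (nhds x) := by
    have : Continuous fun t : ℝ => AffineMap.lineMap x M t := AffineMap.lineMap_continuous
    have h2 := this.tendsto 0
    rw [AffineMap.lineMap_apply_zero] at h2
    exact h2.mono_left nhdsWithin_le_nhds
  -- If `x` were in the open domain, a small move towards `M` would stay there and enter the
  -- relative interior of the face, and `M` itself would be in the domain.
  have hev : ∀ᶠ t : ℝ in nhdsWithin 0 (Set.Ioi 0), AffineMap.lineMap x M t ∈ K.domain ∧
      t ∈ Set.Ioo (0 : ℝ) 1 :=
    (hcont.eventually (K.isOpen_domain.mem_nhds hxd)).and (Ioo_mem_nhdsGT one_pos)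
  obtain ⟨t, htd, ht0, ht1⟩ := hev.exists
  have hco : ∀ v, b v (AffineMap.lineMap x M t) = (1 - t) * b v x + t * b v M := by
    intro v
    rw [AffineMap.apply_lineMap, AffineMap.lineMap_apply_ring]
  refine K.notMem_domain_of_mem_boundary hM (K.mem_domain_of_relint hT hb hτ htd ?_ ?_ hM0 hM1)
  · intro v hv
    rw [hco]
    have h1 := hx.1 v (hτ hv)
    have h2 := hM0 v hv
    have h3 : 0 < 1 - t := by linarith
    positivity
  · intro v hv hvτ
    rw [hco, hx.2 v hv hvτ, hM1 v hv hvτ]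
    ring

/-- A lattice point on the boundary is a vertex or is inner to a boundary edge or face. -/
theorem lattice_mem_boundary_cases {k : ℕ} (hk : 0 < k) {T : Finset E3} (hT : T ∈ K.elements)
    {x : E3} (hx : IsLatticePoint k T x) (hxb : x ∈ K.boundary) :
    x ∈ T ∨ (∃ e ⊆ T, K.IsBoundaryEdge e ∧ IsInnerLatticePoint k e x) ∨
      ∃ F ⊆ T, K.IsBoundaryFace F ∧ IsInnerLatticePoint k F x := by
  classical
  obtain ⟨b, hb⟩ := K.exists_isBarycentric hT
  obtain ⟨a, ha, rfl⟩ := hx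
  have hk' : (0 : ℝ) < k := by exact_mod_cast hk
  -- The face with `x` in its relative interior; its number of vertices distinguishes the cases.
  set τ := T.filter (fun v => 0 < a v) with hτd
  have hτ : τ ⊆ T := Finset.filter_subset _ _
  have ha0 : ∀ v ∈ T, v ∉ τ → a v = 0 := by
    intro v hv hvτ
    by_contra h
    exact hvτ (Finset.mem_filter.2 ⟨hv, Nat.pos_of_ne_zero h⟩)
  have haτ : ∑ v ∈ τ, a v = k := by
    rw [← ha]
    exact Finset.sum_subset hτ ha0
  have hxτ : ∑ v ∈ T, ((a v : ℝ) / k) • v = ∑ v ∈ τ, ((a v : ℝ) / k) • v :=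
    (Finset.sum_subset hτ fun v hv hvτ => by simp [ha0 v hv hvτ]).symm
  have hl : ∑ v ∈ τ, ((a v : ℝ) / k) = 1 := by
    rw [← Finset.sum_div, ← Nat.cast_sum, haτ]
    exact div_self hk'.ne'
  have hco := hb.apply_sum_subset hτ (fun v => (a v : ℝ) / k) hl
  rw [hxτ] at hxb ⊢
  have hM0 : ∀ v ∈ τ, 0 < b v (∑ v ∈ τ, ((a v : ℝ) / k) • v) := by
    intro v hv
    rw [hco.1 v hv]
    have : (0 : ℝ) < a v := by exact_mod_cast (Finset.mem_filter.1 hv).2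
    positivity
  have hsub := K.convexHull_subset_boundary hT hb hτ hxb hM0 hco.2
  have hinner : IsInnerLatticePoint k τ (∑ v ∈ τ, ((a v : ℝ) / k) • v) :=
    ⟨a, fun v hv => (Finset.mem_filter.1 hv).2, haτ, rfl⟩
  have hcard : τ.card ≤ 4 := (Finset.card_le_card hτ).trans_eq (K.card_eq_four T hT)
  have h0 : τ.card ≠ 0 := by
    intro h
    rw [Finset.card_eq_zero] at h
    rw [h] at haτ
    simp at haτ
    omega
  have h4 : τ.card ≠ 4 := by
    intro h
    have hτT : τ = T := Finset.eq_of_subset_of_card_le hτ (by rw [h, K.card_eq_four T hT])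
    refine K.notMem_domain_of_mem_boundary hxb (K.interior_subset_domain hT ?_)
    rw [hb.interior_eq]
    intro v hv
    exact hM0 v (by rw [hτT]; exact hv)
  have : τ.card = 1 ∨ τ.card = 2 ∨ τ.card = 3 := by omega
  rcases this with h | h | h
  · left
    obtain ⟨v, hv⟩ := Finset.card_eq_one.1 h
    rw [hv] at hl ⊢
    simp only [Finset.sum_singleton] at hl ⊢
    rw [hl, one_smul]
    exact hτ (by rw [hv]; simp)
  · right; left
    exact ⟨τ, hτ, ⟨h, ⟨T, hT, hτ⟩, hsub⟩, hinner⟩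
  · right; right
    exact ⟨τ, hτ, ⟨h, ⟨T, hT, hτ⟩, hsub⟩, hinner⟩

end TetMesh

/-! ### Flatness of the `C¹` boundary at small scales, and lines crossing it. -/

/-- `n` is an approximate outward unit normal, with relative error `η`, in the ball of centre `x`
and radius `δ`. -/
structure IsApproxNormal (Ω : Set E3) (η δ : ℝ) (x n : E3) : Prop where
  norm_eq : ‖n‖ = 1
  notMem_closure : ∀ y ∈ Metric.ball x δ, ∀ z ∈ Metric.ball x δ, z ∈ frontier Ω →
    η * ‖y - z‖ < inner ℝ n (y - z) → y ∉ closure Ω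
  mem : ∀ y ∈ Metric.ball x δ, ∀ z ∈ Metric.ball x δ, z ∈ frontier Ω →
    inner ℝ n (y - z) < -(η * ‖y - z‖) → y ∈ Ω

/-- Uniform flatness of a `C¹` boundary: at small scales the set lies, up to a small relative
error, on one side of a plane. -/
theorem HasC1Boundary.exists_uniform_normal {Ω : Set E3} (hΩ : IsOpen Ω)
    (hΩb : Bornology.IsBounded Ω) (hΓ : HasC1Boundary Ω) {η : ℝ} (hη : 0 < η) :
    ∃ δ : ℝ, 0 < δ ∧ ∀ x ∈ frontier Ω, ∃ n : E3, IsApproxNormal Ω η δ x n := by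
  have hcomp : IsCompact (frontier Ω) :=
    Metric.isCompact_of_isClosed_isBounded isClosed_frontier
      (hΩb.closure.subset frontier_subset_closure)
  have hloc : ∀ x0 : frontier Ω, ∃ W : Set E3, IsOpen W ∧ (x0 : E3) ∈ W ∧ ∃ n : E3, ‖n‖ = 1 ∧
      ∀ y ∈ W, ∀ z ∈ W, z ∈ frontier Ω →
        (η * ‖y - z‖ < inner ℝ n (y - z) → y ∉ closure Ω) ∧
        (inner ℝ n (y - z) < -(η * ‖y - z‖) → y ∈ Ω) := by
    rintro ⟨x0, hx0⟩
    obtain ⟨U, hU, hxU, ρ, hρ, hg, hΩU, hfU⟩ := hΓ x0 hx0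
    -- Strict differentiability controls `ρ y - ρ z` for all pairs near `x0`, so the same normal
    -- serves at every boundary point `z` nearby, where `ρ z = 0`.
    have hstrict : HasStrictFDerivAt ρ (fderiv ℝ ρ x0) x0 :=
      (hρ.contDiffAt (hU.mem_nhds hxU)).hasStrictFDerivAt one_ne_zero
    set g := gradient ρ x0 with hgdef
    have hg0 : 0 < ‖g‖ := norm_pos_iff.2 (hg x0 hxU)
    have hgf : ∀ v, fderiv ℝ ρ x0 v = inner ℝ g v := by
      intro v
      rw [← toDual_gradient]
      rfl
    have hsm := hstrict.isLittleO.def (c := η * ‖g‖) (by positivity)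
    obtain ⟨W0, hW0, hW0o, hxW0, hW⟩ : ∃ W0 : Set E3, W0 ⊆ U ∧ IsOpen W0 ∧ x0 ∈ W0 ∧
        ∀ y ∈ W0, ∀ z ∈ W0, |ρ y - ρ z - inner ℝ g (y - z)| ≤ η * ‖g‖ * ‖y - z‖ := by
      rw [nhds_prod_eq] at hsm
      obtain ⟨s, hs, h⟩ := Filter.eventually_prod_self_iff'.1 hsm
      obtain ⟨W1, hW1, hW1o, hxW1⟩ := mem_nhds_iff.1 hs
      refine ⟨W1 ∩ U, Set.inter_subset_right, hW1o.inter hU, ⟨hxW1, hxU⟩, fun y hy z hz => ?_⟩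
      have := h y (hW1 hy.1) z (hW1 hz.1)
      simpa [hgf] using this
    refine ⟨W0, hW0o, hxW0, ‖g‖⁻¹ • g, ?_, fun y hy z hz hzf => ?_⟩
    · rw [norm_smul, norm_inv, norm_norm, inv_mul_cancel₀ hg0.ne']
    · have hz0 : ρ z = 0 := by
        have : z ∈ frontier Ω ∩ U := ⟨hzf, hW0 hz⟩
        rw [hfU] at this
        exact this.2
      have h := hW y hy z hz
      rw [hz0, sub_zero, abs_le] at h
      have hin : inner ℝ (‖g‖⁻¹ • g) (y - z) = ‖g‖⁻¹ * inner ℝ g (y - z) := real_inner_smul_left _ _ _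
      rw [hin]
      have hmul : ‖g‖ * (‖g‖⁻¹ * inner ℝ g (y - z)) = inner ℝ g (y - z) :=
        mul_inv_cancel_left₀ hg0.ne' _
      constructor
      · intro hlt hcl
        have h1 := mul_lt_mul_of_pos_left hlt hg0
        rw [hmul] at h1
        have hpos : 0 < ρ y := by nlinarith [h.1]
        by_cases hyΩ : y ∈ Ω
        · have : y ∈ Ω ∩ U := ⟨hyΩ, hW0 hy⟩
          rw [hΩU] at this
          linarith [this.2]
        · have : y ∈ frontier Ω ∩ U := ⟨by rw [hΩ.frontier_eq]; exact ⟨hcl, hyΩ⟩, hW0 hy⟩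
          rw [hfU] at this
          linarith [this.2]
      · intro hlt
        have h1 := mul_lt_mul_of_pos_left hlt hg0
        rw [hmul] at h1
        have hneg : ρ y < 0 := by nlinarith [h.2]
        have : y ∈ {y ∈ U | ρ y < 0} := ⟨hW0 hy, hneg⟩
        rw [← hΩU] at this
        exact this.1
  choose W hWo hxW n hn hW using hloc
  -- A Lebesgue number of the cover makes the scale uniform over the compact boundary.
  obtain ⟨δ, hδ, h⟩ := lebesgue_number_lemma_of_metric hcomp hWo
    (fun x hx => Set.mem_iUnion.2 ⟨⟨x, hx⟩, hxW _⟩)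
  refine ⟨δ, hδ, fun x hx => ?_⟩
  obtain ⟨i, hi⟩ := h x hx
  exact ⟨n i, hn i, fun y hy z hz hzf => (hW i y (hi hy) z (hi hz) hzf).1,
    fun y hy z hz hzf => (hW i y (hi hy) z (hi hz) hzf).2⟩

namespace IsApproxNormal

variable {Ω : Set E3} {η δ : ℝ} {x n : E3}

theorem inner_le (h : IsApproxNormal Ω η δ x n) {y z : E3} (hy : y ∈ Metric.ball x δ)
    (hz : z ∈ Metric.ball x δ) (hzf : z ∈ frontier Ω) (hyc : y ∈ closure Ω) :
    inner ℝ n (y - z) ≤ η * ‖y - z‖ := by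
  by_contra! hlt
  exact h.notMem_closure y hy z hz hzf hlt hyc

theorem abs_inner_le (h : IsApproxNormal Ω η δ x n) (hΩ : IsOpen Ω) {y z : E3}
    (hy : y ∈ Metric.ball x δ) (hz : z ∈ Metric.ball x δ) (hzf : z ∈ frontier Ω)
    (hyf : y ∈ frontier Ω) : |inner ℝ n (y - z)| ≤ η * ‖y - z‖ := by
  rw [abs_le]
  refine ⟨?_, h.inner_le hy hz hzf (frontier_subset_closure hyf)⟩
  by_contra! hlt
  have := h.mem y hy z hz hzf hlt
  rw [hΩ.frontier_eq] at hyf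
  exact hyf.2 this

/-- A line transversal to the boundary through a point close to it meets the boundary near that
point. -/
theorem exists_frontier_on_line (h : IsApproxNormal Ω η δ x n) (hΩ : IsOpen Ω)
    (hx : x ∈ frontier Ω) (hη : 0 < η) {M ν : E3} (hν : ‖ν‖ = 1) {c : ℝ} (hc : 0 < c)
    (hηc : 4 * η ≤ c) (hcν : c ≤ |inner ℝ n ν|) {ℓ : ℝ} (hℓ : 0 < ℓ) (hM : ‖M - x‖ ≤ ℓ)
    (hMn : |inner ℝ n (M - x)| ≤ η * ℓ) (hδ : 2 * ℓ < δ) :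
    ∃ t : ℝ, |t| ≤ 4 * η / c * ℓ ∧ M + t • ν ∈ frontier Ω := by
  wlog hpos : 0 ≤ inner ℝ n ν generalizing ν
  · obtain ⟨t, ht, htf⟩ := this (ν := -ν) (by rwa [norm_neg]) (by rwa [inner_neg_right, abs_neg])
      (by rw [inner_neg_right]; linarith [not_le.1 hpos])
    exact ⟨-t, by rwa [abs_neg], by rwa [neg_smul, ← smul_neg]⟩
  rw [abs_of_nonneg hpos] at hcν
  have hxb : x ∈ Metric.ball x δ := Metric.mem_ball_self (by linarith)
  -- At `t = ±τ` the displacement along `n` is at least `4 η ℓ`, which beats the offset `η ℓ` of `M`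
  -- plus the flatness error `η · 2 ℓ`: the two ends lie strictly on opposite sides.
  set τ := 4 * η / c * ℓ with hτ
  have hτ0 : 0 < τ := by positivity
  have hτc : c * τ = 4 * η * ℓ := by rw [hτ]; field_simp
  have hτℓ : τ ≤ ℓ := by
    have : 4 * η / c ≤ 1 := (div_le_one hc).2 hηc
    nlinarith
  have hnorm : ∀ t ∈ Set.Icc (-τ) τ, ‖M + t • ν - x‖ ≤ 2 * ℓ := by
    intro t ht
    have h1 : ‖t • ν‖ ≤ τ := by
      rw [norm_smul, hν, mul_one, Real.norm_eq_abs]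
      exact abs_le.2 ht
    calc ‖M + t • ν - x‖ = ‖(M - x) + t • ν‖ := by congr 1; abel
      _ ≤ ‖M - x‖ + ‖t • ν‖ := norm_add_le _ _
      _ ≤ 2 * ℓ := by linarith
  have hball : ∀ t ∈ Set.Icc (-τ) τ, M + t • ν ∈ Metric.ball x δ := by
    intro t ht
    rw [Metric.mem_ball, dist_eq_norm]
    linarith [hnorm t ht]
  have hin : ∀ t : ℝ, inner ℝ n (M + t • ν - x) = inner ℝ n (M - x) + t * inner ℝ n ν := by
    intro t
    rw [show M + t • ν - x = (M - x) + t • ν by abel, inner_add_right, real_inner_smul_right]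
  rw [abs_le] at hMn
  have hl : -τ ∈ Set.Icc (-τ) τ := ⟨le_rfl, by linarith⟩
  have hr : τ ∈ Set.Icc (-τ) τ := ⟨by linarith, le_rfl⟩
  have hprod : c * τ ≤ τ * inner ℝ n ν := by nlinarith
  have hηℓ : 0 < η * ℓ := by positivity
  have h1 : M + (-τ) • ν ∈ Ω := by
    refine h.mem _ (hball _ hl) x hxb hx ?_
    rw [hin]
    have := mul_le_mul_of_nonneg_left (hnorm _ hl) hη.le
    nlinarith [hMn.2]
  have h2 : M + τ • ν ∉ closure Ω := by
    refine h.notMem_closure _ (hball _ hr) x hxb hx ?_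
    rw [hin]
    have := mul_le_mul_of_nonneg_left (hnorm _ hr) hη.le
    nlinarith [hMn.1]
  by_contra! hno
  have hcont : Continuous fun t : ℝ => M + t • ν := by fun_prop
  -- A segment missing the boundary would be split by the disjoint open sets `Ω` and the complement
  -- of its closure.
  have hpre := isPreconnected_Icc (a := -τ) (b := τ) _ _ (hΩ.preimage hcont)
    (isClosed_closure.isOpen_compl.preimage hcont) (fun t ht => by
      by_cases htΩ : M + t • ν ∈ Ω
      · exact Or.inl htΩ
      · refine Or.inr fun hcl => hno t (abs_le.2 ht) ?_
        rw [hΩ.frontier_eq]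
        exact ⟨hcl, htΩ⟩) ⟨-τ, hl, h1⟩ ⟨τ, hr, h2⟩
  obtain ⟨t, -, ht1, ht2⟩ := hpre
  exact ht2 (subset_closure ht1)

end IsApproxNormal

/-! ### Nearest intersections, and transversality at boundary faces. -/

theorem exists_isNearestPoint {A : Set E3} (hA : IsClosed A) {M y : E3} (hy : y ∈ A) :
    ∃ P, IsNearestPoint A M P ∧ dist M P ≤ dist M y := by
  obtain ⟨P, hP, h⟩ := hA.exists_infDist_eq_dist ⟨y, hy⟩ M
  have h2 : ∀ z ∈ A, dist M P ≤ dist M z := fun z hz => by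
    rw [← h]
    exact Metric.infDist_le_dist_of_mem hz
  exact ⟨P, ⟨hP, h2⟩, h2 y hy⟩

theorem isClosed_line (M ν : E3) : IsClosed {x : E3 | ∃ t : ℝ, x = M + t • ν} := by
  have h : {x : E3 | ∃ t : ℝ, x = M + t • ν} =
      (fun x => x - M) ⁻¹' ((Submodule.span ℝ {ν} : Submodule ℝ E3) : Set E3) := by
    ext x
    simp only [Set.mem_ofPred_eq, Set.mem_preimage, SetLike.mem_coe, Submodule.mem_span_singleton]
    constructor
    · rintro ⟨t, rfl⟩
      exact ⟨t, by abel⟩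
    · rintro ⟨t, ht⟩
      exact ⟨t, by rw [ht]; abel⟩
  rw [h]
  exact (Submodule.closed_of_finiteDimensional _).preimage (by fun_prop)

/-- The tetrahedron `T` contains a ball of radius `r`, and its diameter is at most `σ r`. -/
structure IsFat (σ r : ℝ) (T : Finset E3) : Prop where
  pos : 0 < r
  exists_ball : ∃ c, Metric.ball c r ⊆ convexHull ℝ (T : Set E3)
  diam_le : Metric.diam (convexHull ℝ (T : Set E3)) ≤ σ * r

theorem norm_sub_le_diam {T : Finset E3} {x y : E3} (hx : x ∈ convexHull ℝ (T : Set E3))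
    (hy : y ∈ convexHull ℝ (T : Set E3)) :
    ‖x - y‖ ≤ Metric.diam (convexHull ℝ (T : Set E3)) := by
  rw [← dist_eq_norm]
  exact Metric.dist_le_diam_of_mem (isBounded_convexHull_finset T) hx hy

theorem inner_bounds_of_mem_convexHull {A : Set E3} {u a : E3} {α β : ℝ}
    (h : ∀ v ∈ A, α ≤ inner ℝ u (v - a) ∧ inner ℝ u (v - a) ≤ β) {x : E3}
    (hx : x ∈ convexHull ℝ A) : α ≤ inner ℝ u (x - a) ∧ inner ℝ u (x - a) ≤ β := by
  have hconv : Convex ℝ {x : E3 | α ≤ inner ℝ u (x - a) ∧ inner ℝ u (x - a) ≤ β} := by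
    have hl : IsLinearMap ℝ (fun x : E3 => (inner ℝ u x : ℝ)) :=
      ⟨fun x y => inner_add_right _ _ _, fun c x => real_inner_smul_right _ _ _⟩
    have : {x : E3 | α ≤ inner ℝ u (x - a) ∧ inner ℝ u (x - a) ≤ β} =
        {x : E3 | α + inner ℝ u a ≤ inner ℝ u x} ∩ {x : E3 | inner ℝ u x ≤ β + inner ℝ u a} := by
      ext x
      simp only [Set.mem_ofPred_eq, Set.mem_inter_iff, inner_sub_right]
      constructor <;> rintro ⟨h1, h2⟩ <;> constructor <;> linarith
    rw [this]
    exact (convex_halfSpace_ge hl _).inter (convex_halfSpace_le hl _)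
  exact convexHull_min h hconv hx

/-- The width of a convex set in any direction is at least the diameter of an inscribed ball. -/
theorem IsFat.width {σ r : ℝ} {T : Finset E3} (hT : IsFat σ r T) {u a : E3} (hu : ‖u‖ = 1)
    {α β : ℝ} (h : ∀ v ∈ T, α ≤ inner ℝ u (v - a) ∧ inner ℝ u (v - a) ≤ β) : 2 * r ≤ β - α := by
  obtain ⟨c, hc⟩ := hT.exists_ball
  have hb : ∀ x ∈ Metric.ball c r, α ≤ inner ℝ u (x - a) ∧ inner ℝ u (x - a) ≤ β := fun x hx =>
    inner_bounds_of_mem_convexHull (A := (T : Set E3)) h (hc hx)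
  have huu : inner ℝ u u = 1 := by rw [real_inner_self_eq_norm_sq, hu]; norm_num
  have key : ∀ t, 0 < t → t < r → 2 * t ≤ β - α := by
    intro t ht htr
    have hmem : ∀ s : ℝ, |s| = t → c + s • u ∈ Metric.ball c r := by
      intro s hs
      rw [Metric.mem_ball, dist_eq_norm, add_sub_cancel_left, norm_smul, hu, mul_one,
        Real.norm_eq_abs, hs]
      exact htr
    have h1 := (hb _ (hmem t (abs_of_pos ht))).2
    have h2 := (hb _ (hmem (-t) (by rw [abs_neg, abs_of_pos ht]))).1
    rw [show c + t • u - a = (c - a) + t • u by abel, inner_add_right, real_inner_smul_right,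
      huu] at h1
    rw [show c + (-t) • u - a = (c - a) + (-t) • u by abel, inner_add_right,
      real_inner_smul_right, huu] at h2
    linarith
  by_contra! hlt
  have hβα : 0 < β - α := by
    have := key (r / 2) (by linarith [hT.pos]) (by linarith [hT.pos])
    linarith [hT.pos]
  have := key (((β - α) / 2 + r) / 2) (by linarith [hT.pos]) (by linarith)
  linarith

theorem Finset.mem_of_ne_opposite {T F : Finset E3} (hT : T.card = 4) (hF : F.card = 3)
    (hFT : F ⊆ T) {O v : E3} (hO : O ∈ T) (hOF : O ∉ F) (hv : v ∈ T) (hvO : v ≠ O) : v ∈ F := by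
  classical
  have : F = T.erase O := by
    refine Finset.eq_of_subset_of_card_le (fun x hx => Finset.mem_erase.2 ⟨?_, hFT hx⟩) ?_
    · rintro rfl
      exact hOF hx
    · rw [Finset.card_erase_of_mem hO, hT, hF]
  rw [this]
  exact Finset.mem_erase.2 ⟨hvO, hv⟩

theorem mem_ball_of_diam_lt {T : Finset E3} {δ : ℝ}
    (hd : Metric.diam (convexHull ℝ (T : Set E3)) < δ) {a v : E3}
    (ha : a ∈ T) (hv : v ∈ T) : v ∈ Metric.ball a δ := by
  rw [Metric.mem_ball, dist_eq_norm]
  exact (norm_sub_le_diam (subset_convexHull ℝ _ hv) (subset_convexHull ℝ _ ha)).trans_lt hd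

section Transversality

variable {Ω : Set E3} {η δ σ r : ℝ} {n a : E3} {T F : Finset E3}

theorem IsApproxNormal.abs_inner_vertex_le (h : IsApproxNormal Ω η δ a n) (hΩ : IsOpen Ω)
    (hη : 0 < η) (hd : Metric.diam (convexHull ℝ (T : Set E3)) < δ) (hFT : F ⊆ T)
    (hFΓ : ∀ v ∈ F, v ∈ frontier Ω) (ha : a ∈ F) {v : E3} (hv : v ∈ F) :
    |inner ℝ n (v - a)| ≤ η * Metric.diam (convexHull ℝ (T : Set E3)) := by
  refine (h.abs_inner_le hΩ (mem_ball_of_diam_lt hd (hFT ha) (hFT hv))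
    (mem_ball_of_diam_lt hd (hFT ha) (hFT ha)) (hFΓ a ha) (hFΓ v hv)).trans ?_
  exact mul_le_mul_of_nonneg_left (norm_sub_le_diam (subset_convexHull ℝ _ (hFT hv))
    (subset_convexHull ℝ _ (hFT ha))) hη.le

/-- The vertex opposite to a face inscribed in the boundary is far from the tangent plane. -/
theorem IsApproxNormal.le_abs_inner_opposite (h : IsApproxNormal Ω η δ a n) (hΩ : IsOpen Ω)
    (hη : 0 < η) (hT : IsFat σ r T) (hT4 : T.card = 4) (hF3 : F.card = 3)
    (hd : Metric.diam (convexHull ℝ (T : Set E3)) < δ) (hησ : η * σ < 1) (hFT : F ⊆ T)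
    (hFΓ : ∀ v ∈ F, v ∈ frontier Ω) (ha : a ∈ F) {O : E3} (hO : O ∈ T) (hOF : O ∉ F) :
    r ≤ |inner ℝ n (O - a)| := by
  set D := Metric.diam (convexHull ℝ (T : Set E3))
  have hηD : η * D < r := by
    have := mul_le_mul_of_nonneg_left hT.diam_le hη.le
    nlinarith [hT.pos]
  by_contra! hlt
  -- Otherwise all four vertices would lie in a slab of width less than `2 r`, too thin for the
  -- inscribed ball.
  have hw := hT.width (u := n) (a := a) h.norm_eq (α := -max (η * D) |inner ℝ n (O - a)|)
    (β := max (η * D) |inner ℝ n (O - a)|) (fun v hv => by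
      rw [← abs_le]
      by_cases hvO : v = O
      · rw [hvO]
        exact le_max_right _ _
      · exact (h.abs_inner_vertex_le hΩ hη hd hFT hFΓ ha
          (Finset.mem_of_ne_opposite hT4 hF3 hFT hO hOF hv hvO)).trans (le_max_left _ _))
  have := max_lt hηD hlt
  linarith

/-- A point of the closure of `Ω` can exceed the tangent plane outwards by at most `η σ r < r`, so
the distance bound `r` must hold on the inner side. -/
theorem IsApproxNormal.inner_opposite_le (h : IsApproxNormal Ω η δ a n) (hΩ : IsOpen Ω)
    (hη : 0 < η) (hT : IsFat σ r T) (hT4 : T.card = 4) (hF3 : F.card = 3)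
    (hd : Metric.diam (convexHull ℝ (T : Set E3)) < δ) (hησ : η * σ < 1) (hFT : F ⊆ T)
    (hFΓ : ∀ v ∈ F, v ∈ frontier Ω) (ha : a ∈ F) {O : E3} (hO : O ∈ T) (hOF : O ∉ F)
    (hOc : O ∈ closure Ω) : inner ℝ n (O - a) ≤ -r := by
  have h1 := h.le_abs_inner_opposite hΩ hη hT hT4 hF3 hd hησ hFT hFΓ ha hO hOF
  have h2 := h.inner_le (mem_ball_of_diam_lt hd (hFT ha) hO)
    (mem_ball_of_diam_lt hd (hFT ha) (hFT ha)) (hFΓ a ha) hOc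
  have h3 : ‖O - a‖ ≤ σ * r := (norm_sub_le_diam (subset_convexHull ℝ _ hO)
    (subset_convexHull ℝ _ (hFT ha))).trans hT.diam_le
  have h4 : inner ℝ n (O - a) < r := by nlinarith [hT.pos]
  rcases le_abs'.1 h1 with h5 | h5
  · exact h5
  · linarith

/-- The line through a point of an inscribed face and the opposite vertex meets the boundary close
to that point. -/
theorem IsApproxNormal.exists_nearest_face (h : IsApproxNormal Ω η δ a n) (hΩ : IsOpen Ω)
    (hη : 0 < η) (hσ : 0 < σ) (hT : IsFat σ r T) (hT4 : T.card = 4) (hF3 : F.card = 3)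
    (hd : 2 * Metric.diam (convexHull ℝ (T : Set E3)) < δ) (hησ : 8 * (η * σ) ≤ 1) (hFT : F ⊆ T)
    (hFΓ : ∀ v ∈ F, v ∈ frontier Ω) (ha : a ∈ F) {O : E3} (hO : O ∈ T) (hOF : O ∉ F) {M : E3}
    (hM : M ∈ convexHull ℝ (F : Set E3)) :
    ∃ P, IsNearestPoint (frontier Ω ∩ {x | ∃ t : ℝ, x = M + t • (M - O)}) M P ∧
      dist M P ≤ 8 * (η * σ) * Metric.diam (convexHull ℝ (T : Set E3)) := by
  set D := Metric.diam (convexHull ℝ (T : Set E3)) with hD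
  have hD0 : 0 ≤ D := Metric.diam_nonneg
  have hr := hT.pos
  have hDr : D ≤ σ * r := hT.diam_le
  have h1 := h.le_abs_inner_opposite hΩ hη hT hT4 hF3 (by linarith) (by linarith) hFT hFΓ ha hO hOF
  have haT := subset_convexHull ℝ (T : Set E3) (hFT ha)
  have hOT := subset_convexHull ℝ (T : Set E3) hO
  have hMT : M ∈ convexHull ℝ (T : Set E3) := convexHull_mono (by exact_mod_cast hFT) hM
  have hMn : |inner ℝ n (M - a)| ≤ η * D := by
    rw [abs_le]
    refine inner_bounds_of_mem_convexHull (A := (F : Set E3)) (fun v hv => ?_) hM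
    rw [← abs_le]
    exact h.abs_inner_vertex_le hΩ hη (by linarith) hFT hFΓ ha hv
  have hηD : η * D ≤ r / 8 := by
    have := mul_le_mul_of_nonneg_left hDr hη.le
    nlinarith
  have hMO : r / 2 ≤ |inner ℝ n (M - O)| := by
    have e : inner ℝ n (M - O) = inner ℝ n (M - a) - inner ℝ n (O - a) := by
      rw [← inner_sub_right]
      congr 1
      abel
    have h3 := abs_sub_abs_le_abs_sub (inner ℝ n (O - a)) (inner ℝ n (M - a))
    rw [abs_sub_comm] at h3
    rw [e]
    linarith
  have hMO0 : 0 < ‖M - O‖ := by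
    rw [norm_pos_iff]
    intro h0
    rw [h0, inner_zero_right, abs_zero] at hMO
    linarith
  have hMOD : ‖M - O‖ ≤ D := norm_sub_le_diam hMT hOT
  -- The normal component of `M - O` is at least `r / 2` and its length at most `σ r`. With this
  -- `c`, the distance `4 η / c · D` becomes `8 η σ D`.
  have hcν : 1 / (2 * σ) ≤ |inner ℝ n (‖M - O‖⁻¹ • (M - O))| := by
    rw [real_inner_smul_right, abs_mul, abs_of_pos (inv_pos.2 hMO0), ← div_eq_inv_mul,
      div_le_div_iff₀ (by positivity) hMO0]
    nlinarith
  obtain ⟨t, ht, htf⟩ := h.exists_frontier_on_line hΩ (hFΓ a ha) hη (M := M)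
    (ν := ‖M - O‖⁻¹ • (M - O))
    (by rw [norm_smul, norm_inv, norm_norm, inv_mul_cancel₀ hMO0.ne']) (c := 1 / (2 * σ))
    (by positivity) (by rw [le_div_iff₀ (by positivity)]; linarith) hcν (ℓ := D)
    (by linarith) (norm_sub_le_diam hMT haT) hMn (by linarith)
  obtain ⟨P, hP, hMP⟩ := exists_isNearestPoint (M := M)
    (isClosed_frontier.inter (isClosed_line M (M - O)))
    ⟨htf, t * ‖M - O‖⁻¹, by rw [mul_smul]⟩
  refine ⟨P, hP, hMP.trans ?_⟩
  rw [dist_eq_norm, sub_add_cancel_left, norm_neg, norm_smul, norm_smul, norm_inv, norm_norm,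
    inv_mul_cancel₀ hMO0.ne', mul_one, Real.norm_eq_abs]
  refine ht.trans_eq ?_
  field_simp
  ring

end Transversality

/-! ### Transversality of the skins at boundary edges. -/

theorem exists_unit_orthogonal_pair (x y : E3) :
    ∃ u : E3, ‖u‖ = 1 ∧ inner ℝ u x = 0 ∧ inner ℝ u y = 0 := by
  classical
  let S : Submodule ℝ E3 := Submodule.span ℝ ({x, y} : Finset E3)
  have hS : Module.finrank ℝ S < 3 :=
    (finrank_span_finset_le_card _).trans_lt (Nat.lt_of_le_of_lt Finset.card_le_two (by norm_num))
  have hne : Sᗮ ≠ ⊥ := by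
    intro h
    rw [Submodule.orthogonal_eq_bot_iff] at h
    rw [h, finrank_top] at hS
    simp at hS
  obtain ⟨v, hv, hv0⟩ := Submodule.exists_mem_ne_zero_of_ne_bot hne
  have hv0' : ‖v‖ ≠ 0 := norm_ne_zero_iff.2 hv0
  have hor : ∀ z ∈ S, inner ℝ v z = 0 := fun z hz => by
    rw [real_inner_comm]
    exact hv z hz
  refine ⟨‖v‖⁻¹ • v, ?_, ?_, ?_⟩
  · rw [norm_smul, norm_inv, norm_norm, inv_mul_cancel₀ hv0']
  · rw [real_inner_smul_left, hor x (Submodule.subset_span (by simp)), mul_zero]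
  · rw [real_inner_smul_left, hor y (Submodule.subset_span (by simp)), mul_zero]

/-- Completion of two orthogonal unit vectors to an orthonormal frame. -/
theorem exists_frame {e τ : E3} (he : ‖e‖ = 1) (hτ : ‖τ‖ = 1) (heτ : inner ℝ e τ = 0) :
    ∃ m : E3, ∀ x y : E3, inner ℝ x y =
      inner ℝ x e * inner ℝ y e + inner ℝ x τ * inner ℝ y τ + inner ℝ x m * inner ℝ y m := by
  obtain ⟨m, hm, hme, hmτ⟩ := exists_unit_orthogonal_pair e τ
  have hon : Orthonormal ℝ ![e, τ, m] := by
    rw [orthonormal_iff_ite]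
    intro i j
    fin_cases i <;> fin_cases j <;>
      simp [he, hτ, hm, heτ, hme, hmτ,
        real_inner_comm e τ, real_inner_comm m e, real_inner_comm m τ]
  have hcard : Fintype.card (Fin 3) = Module.finrank ℝ E3 := by simp
  let B := (basisOfOrthonormalOfCardEqFinrank hon hcard).toOrthonormalBasis (by
    rw [coe_basisOfOrthonormalOfCardEqFinrank]; exact hon)
  have hB : ∀ i, B i = ![e, τ, m] i := by
    intro i
    simp [B]
  refine ⟨m, fun x y => ?_⟩
  have := B.sum_inner_mul_inner x y
  rw [Fin.sum_univ_three, hB, hB, hB] at this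
  simp only [Matrix.cons_val_zero, Matrix.cons_val_one, Matrix.cons_val] at this
  rw [← this, real_inner_comm y e, real_inner_comm y τ, real_inner_comm y m]

/-- Coordinates are taken along the edge, the first conormal `τ₁`, and a third axis `m`. The normal
is almost orthogonal to the first two, hence close to `±m`; a unit vector orthogonal to the edge and
almost tangent is then close to `±τ₁`. In the application `t` is the second conormal. -/
theorem normal_component_bounds {ε n1 n2 n3 t2 t3 : ℝ} (hε1 : 20 * ε ≤ 1)
    (hn : n1 ^ 2 + n2 ^ 2 + n3 ^ 2 = 1) (hn1 : |n1| ≤ ε) (hn2 : |n2| ≤ ε)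
    (ht : t2 ^ 2 + t3 ^ 2 = 1) (htn : |t2 * n2 + t3 * n3| ≤ ε) :
    9 / 10 ≤ |n3| ∧ |n3| ≤ 1 ∧ |t3| ≤ 3 * ε := by
  have hε : 0 ≤ ε := (abs_nonneg _).trans hn1
  have h1 : n1 ^ 2 ≤ ε ^ 2 := sq_le_sq' (by linarith [(abs_le.1 hn1).1]) (abs_le.1 hn1).2
  have h2 : n2 ^ 2 ≤ ε ^ 2 := sq_le_sq' (by linarith [(abs_le.1 hn2).1]) (abs_le.1 hn2).2
  have hεε : ε ^ 2 ≤ 1 / 400 := by nlinarith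
  have hn3 : 9 / 10 ≤ |n3| := by
    refine abs_le_of_sq_le_sq' ?_ (abs_nonneg _) |>.2
    rw [sq_abs]
    nlinarith
  have hn3' : |n3| ≤ 1 := abs_le_one_iff_mul_self_le_one.2 (by nlinarith)
  have ht2 : |t2| ≤ 1 := abs_le_one_iff_mul_self_le_one.2 (by nlinarith)
  refine ⟨hn3, hn3', ?_⟩
  have h3 : |t3 * n3| ≤ 2 * ε := by
    have e : t3 * n3 = (t2 * n2 + t3 * n3) - t2 * n2 := by ring
    rw [e]
    refine (abs_sub _ _).trans ?_
    have : |t2 * n2| ≤ ε := by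
      rw [abs_mul]
      nlinarith [abs_nonneg t2, abs_nonneg n2]
    linarith
  rw [abs_mul] at h3
  nlinarith [abs_nonneg t3]

/-- Two tetrahedra on the same side of the tangent plane cannot be separated by a plane through a
common edge if they have faces with almost equal conormals; scalar form. -/
theorem no_separation_aux {ε σ r₁ r₂ n1 n2 n3 t2 t3 u2 u3 : ℝ} {o p : Fin 3 → ℝ}
    (hε1 : 20 * ε ≤ 1) (hεσ : 20 * (ε * σ) ≤ 1) (hr₁ : 0 < r₁) (hr₂ : 0 < r₂)
    (hn : n1 ^ 2 + n2 ^ 2 + n3 ^ 2 = 1) (hn1 : |n1| ≤ ε) (hn2 : |n2| ≤ ε)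
    (ht : t2 ^ 2 + t3 ^ 2 = 1) (htn : |t2 * n2 + t3 * n3| ≤ ε) (ht2 : 0 ≤ t2)
    (hu : u2 ^ 2 + u3 ^ 2 = 1) (hu2 : u2 ≤ 0) (hut : 0 ≤ u2 * t2 + u3 * t3)
    (ho : ∀ i, |o i| ≤ σ * r₁) (hp : ∀ i, |p i| ≤ σ * r₂)
    (hno : n1 * o 0 + n2 * o 1 + n3 * o 2 ≤ -r₁) (hnp : n1 * p 0 + n2 * p 1 + n3 * p 2 ≤ -r₂)
    (huo : u2 * o 1 + u3 * o 2 ≤ 0) (hup : 0 ≤ u2 * p 1 + u3 * p 2) : False := by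
  have hε : 0 ≤ ε := (abs_nonneg _).trans hn1
  obtain ⟨-, hn3', ht3⟩ := normal_component_bounds hε1 hn hn1 hn2 ht htn
  have ht2' : 9 / 10 ≤ t2 := by
    have h1 : t3 ^ 2 ≤ (3 * ε) ^ 2 := sq_le_sq' (by linarith [(abs_le.1 ht3).1]) (abs_le.1 ht3).2
    refine abs_le_of_sq_le_sq' ?_ ht2 |>.2
    nlinarith
  have hu3 : |u3| ≤ 1 := abs_le_one_iff_mul_self_le_one.2 (by nlinarith)
  -- Here `u` is the normal of the separating plane and `t` is close to `(1, 0)`: the opposite signs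
  -- of `u` on two nearly equal conormals leave it almost no tangential part.
  have hu2' : |u2| ≤ 4 * ε := by
    rw [abs_of_nonpos hu2]
    have h1 : u3 * t3 ≤ 3 * ε := by
      refine (le_abs_self _).trans ?_
      rw [abs_mul]
      nlinarith [abs_nonneg u3, abs_nonneg t3]
    nlinarith
  have hu3' : 9 / 10 ≤ |u3| := by
    have h1 : u2 ^ 2 ≤ (4 * ε) ^ 2 := sq_le_sq' (by linarith [(abs_le.1 hu2').1]) (abs_le.1 hu2').2
    refine abs_le_of_sq_le_sq' ?_ (abs_nonneg _) |>.2
    rw [sq_abs]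
    nlinarith
  have key : ∀ (q : Fin 3 → ℝ) (r : ℝ), 0 < r → (∀ i, |q i| ≤ σ * r) →
      n1 * q 0 + n2 * q 1 + n3 * q 2 ≤ -r →
      n3 * q 2 ≤ -(9 / 10 * r) ∧ |n3 * (u2 * q 1)| ≤ 1 / 5 * r := by
    intro q r hr hq hnq
    have hεr : ε * (σ * r) ≤ r / 20 := by nlinarith
    have h1 : |n1 * q 0| ≤ ε * (σ * r) := by
      rw [abs_mul]; exact mul_le_mul hn1 (hq 0) (abs_nonneg _) hε
    have h2 : |n2 * q 1| ≤ ε * (σ * r) := by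
      rw [abs_mul]; exact mul_le_mul hn2 (hq 1) (abs_nonneg _) hε
    have h3 : |u2 * q 1| ≤ 4 * ε * (σ * r) := by
      rw [abs_mul]; exact mul_le_mul hu2' (hq 1) (abs_nonneg _) (by linarith)
    refine ⟨by linarith [(abs_le.1 h1).1, (abs_le.1 h2).1], ?_⟩
    rw [abs_mul]
    have : |n3| * |u2 * q 1| ≤ 1 * |u2 * q 1| := mul_le_mul_of_nonneg_right hn3' (abs_nonneg _)
    linarith
  obtain ⟨ho1, ho2⟩ := key o r₁ hr₁ ho hno
  obtain ⟨hp1, hp2⟩ := key p r₂ hr₂ hp hnp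
  rw [abs_le] at ho2 hp2
  -- As `u` is nearly `±m` and both opposite vertices are at depth comparable to `r` on the same
  -- side, `u` has the same strict sign on both, against separation.
  rcases le_abs'.1 hu3' with h | h
  · have key2 : ∀ (q : Fin 3 → ℝ) (r : ℝ), 0 < r → n3 * q 2 ≤ -(9 / 10 * r) →
        -(1 / 5 * r) ≤ n3 * (u2 * q 1) → 0 < n3 * (u2 * q 1 + u3 * q 2) := by
      intro q r hr h1 h2
      have h3 : 9 / 10 * (9 / 10 * r) ≤ -u3 * -(n3 * q 2) :=
        mul_le_mul (by linarith) (by linarith) (by positivity) (by linarith)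
      linarith
    have h1 := key2 o r₁ hr₁ ho1 ho2.1
    have h2 := key2 p r₂ hr₂ hp1 hp2.1
    rcases le_total 0 n3 with h3 | h3
    · exact h1.not_ge (mul_nonpos_of_nonneg_of_nonpos h3 huo)
    · exact h2.not_ge (mul_nonpos_of_nonpos_of_nonneg h3 hup)
  · have key2 : ∀ (q : Fin 3 → ℝ) (r : ℝ), 0 < r → n3 * q 2 ≤ -(9 / 10 * r) →
        n3 * (u2 * q 1) ≤ 1 / 5 * r → n3 * (u2 * q 1 + u3 * q 2) < 0 := by
      intro q r hr h1 h2
      have h3 : 9 / 10 * (9 / 10 * r) ≤ u3 * -(n3 * q 2) :=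
        mul_le_mul (by linarith) (by linarith) (by positivity) (by linarith)
      linarith
    have h1 := key2 o r₁ hr₁ ho1 ho2.2
    have h2 := key2 p r₂ hr₂ hp1 hp2.2
    rcases le_total 0 n3 with h3 | h3
    · exact h2.not_ge (mul_nonneg h3 hup)
    · exact h1.not_ge (mul_nonneg_of_nonpos_of_nonpos h3 huo)

/-- If the conormals are almost opposite, a skin direction close to their bisector is transversal
to the tangent plane; scalar form. -/
theorem skin_transversal_aux {ε s n1 n2 n3 t2 t3 d2 d3 : ℝ} (hs : 0 ≤ s) (hs1 : s < 1)
    (hε1 : 20 * ε ≤ 1 - s)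
    (hn : n1 ^ 2 + n2 ^ 2 + n3 ^ 2 = 1) (hn1 : |n1| ≤ ε) (hn2 : |n2| ≤ ε)
    (ht : t2 ^ 2 + t3 ^ 2 = 1) (htn : |t2 * n2 + t3 * n3| ≤ ε) (ht2 : t2 ≤ 0)
    (hd : d2 ^ 2 + d3 ^ 2 = 1) (hds : |d2 * (1 - t2) - d3 * t3| ≤ 2 * s) :
    (1 - s) / 4 ≤ |n2 * d2 + n3 * d3| := by
  have hε : 0 ≤ ε := (abs_nonneg _).trans hn1
  obtain ⟨hn3, hn3', ht3⟩ := normal_component_bounds (by linarith) hn hn1 hn2 ht htn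
  have hd2 : |d2| ≤ 1 := abs_le_one_iff_mul_self_le_one.2 (by nlinarith)
  have hd3 : |d3| ≤ 1 := abs_le_one_iff_mul_self_le_one.2 (by nlinarith)
  have ht2' : 1 - 9 * ε ^ 2 ≤ -t2 := by
    have h1 : t3 ^ 2 ≤ (3 * ε) ^ 2 := sq_le_sq' (by linarith [(abs_le.1 ht3).1]) (abs_le.1 ht3).2
    have h2 : -t2 ≤ 1 := by nlinarith
    nlinarith
  have h1 : |d2| * (1 - t2) ≤ 2 * s + 3 * ε := by
    have e : d2 * (1 - t2) = (d2 * (1 - t2) - d3 * t3) + d3 * t3 := by ring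
    have h2 : |d2 * (1 - t2)| ≤ 2 * s + |d3 * t3| := by
      rw [e]
      exact (abs_add_le _ _).trans (by linarith)
    rw [abs_mul, abs_mul, abs_of_nonneg (by linarith : 0 ≤ 1 - t2)] at h2
    have h3 : |d3| * |t3| ≤ 1 * (3 * ε) := mul_le_mul hd3 ht3 (abs_nonneg _) zero_le_one
    linarith
  -- With `t2` near `-1`, the bisector condition reads nearly `2 |d2| ≤ 2 s`; half of the gap `1 -
  -- s` absorbs the errors in `ε`.
  have h2 : |d2| ≤ (1 + s) / 2 := by
    by_contra! hlt
    have h3 : |d2| * (2 - 9 * ε ^ 2) ≤ 2 * s + 3 * ε := by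
      refine le_trans (mul_le_mul_of_nonneg_left (by linarith) (abs_nonneg _)) h1
    have h4 : ε ^ 2 ≤ ε * (1 / 20) := by nlinarith
    nlinarith
  have h3 : (1 - s) / 2 ≤ |d3| := by
    have h4 : d2 ^ 2 ≤ (1 + s) / 2 := by
      rw [← sq_abs]
      nlinarith [abs_nonneg d2]
    have h5 : d3 ^ 2 ≤ |d3| := by
      rw [← sq_abs]
      nlinarith [abs_nonneg d3]
    linarith
  have h4 : |n2 * d2| ≤ ε := by
    rw [abs_mul]
    nlinarith [abs_nonneg d2, abs_nonneg n2]
  have h5 : 9 / 10 * ((1 - s) / 2) ≤ |n3 * d3| := by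
    rw [abs_mul]
    exact mul_le_mul hn3 h3 (by linarith) (abs_nonneg _)
  have h6 := abs_sub_abs_le_abs_sub (n3 * d3) (-(n2 * d2))
  rw [abs_neg, sub_neg_eq_add, add_comm (n3 * d3)] at h6
  linarith

theorem abs_le_of_sum_sq_eq {N x y z : ℝ} (hN : 0 ≤ N) (h : N ^ 2 = x ^ 2 + y ^ 2 + z ^ 2) :
    |x| ≤ N ∧ |y| ≤ N ∧ |z| ≤ N := by
  have hx := sq_nonneg x
  have hy := sq_nonneg y
  have hz := sq_nonneg z
  exact ⟨abs_le_of_sq_le_sq (by linarith) hN, abs_le_of_sq_le_sq (by linarith) hN,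
    abs_le_of_sq_le_sq (by linarith) hN⟩

theorem IsConormal.exists_eq {a b τ : E3} {F : Finset E3} (h : IsConormal {a, b} F τ) :
    ∃ c ∈ F, c ≠ a ∧ c ≠ b ∧ ∃ l t : ℝ, 0 < t ∧ c - a = l • (b - a) + t • τ := by
  obtain ⟨-, -, c, hcF, hce, y, hy, t, ht, rfl⟩ := h
  rw [Finset.coe_pair, mem_affineSpan_pair_iff_exists_lineMap_eq] at hy
  obtain ⟨l, rfl⟩ := hy
  simp only [Finset.mem_insert, Finset.mem_singleton, not_or] at hce
  refine ⟨_, hcF, hce.1, hce.2, l, t, ht, ?_⟩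
  rw [AffineMap.lineMap_apply]
  simp only [vsub_eq_sub, vadd_eq_add]
  abel

theorem IsConormal.inner_edge {a b τ : E3} {F : Finset E3} (h : IsConormal {a, b} F τ) :
    inner ℝ τ (b - a) = 0 := h.2.1 a (by simp) b (by simp)

theorem Finset.exists_opposite {T F : Finset E3} (hT : T.card = 4) (hF : F.card = 3) :
    ∃ O ∈ T, O ∉ F := by
  by_contra! h
  have := Finset.card_le_card h
  omega

/-- Up to a multiple of the edge vector, `t τ` is the vector from `a` to the third vertex, so its
normal component is at most `2 η D`. Since the height `t` of the face is at least `2 r`, division by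
`t` gives `η σ`. -/
theorem IsApproxNormal.abs_inner_conormal_le {Ω : Set E3} {η δ σ r : ℝ} {n a b τ : E3}
    {T F : Finset E3} (h : IsApproxNormal Ω η δ a n) (hΩ : IsOpen Ω) (hη : 0 < η)
    (hT : IsFat σ r T) (hT4 : T.card = 4) (hF3 : F.card = 3)
    (hd : Metric.diam (convexHull ℝ (T : Set E3)) < δ) (hFT : F ⊆ T)
    (hFΓ : ∀ v ∈ F, v ∈ frontier Ω) (hab : a ≠ b) (ha : a ∈ F) (hb : b ∈ F)
    (hτ : IsConormal {a, b} F τ) : |inner ℝ n τ| ≤ η * σ := by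
  classical
  obtain ⟨c, hcF, hca, hcb, l, t, ht, hc⟩ := hτ.exists_eq
  obtain ⟨O, hO, hOF⟩ := Finset.exists_opposite hT4 hF3
  have hF : ∀ v ∈ F, v = a ∨ v = b ∨ v = c := by
    have h3 : ({a, b, c} : Finset E3).card = 3 := by
      rw [Finset.card_eq_three]
      exact ⟨a, b, c, hab, hca.symm, hcb.symm, rfl⟩
    have h4 : ({a, b, c} : Finset E3) = F := by
      refine Finset.eq_of_subset_of_card_le ?_ (by rw [h3, hF3])
      intro v hv
      simp only [Finset.mem_insert, Finset.mem_singleton] at hv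
      rcases hv with rfl | rfl | rfl <;> assumption
    intro v hv
    rw [← h4] at hv
    simpa using hv
  set D := Metric.diam (convexHull ℝ (T : Set E3)) with hD
  have hball : ∀ v ∈ F, v ∈ Metric.ball a δ := fun v hv => mem_ball_of_diam_lt hd (hFT ha) (hFT hv)
  -- In this direction `a`, `b` and `O` project to one point, so the width of `T` is due to the
  -- third vertex alone and is at most `t`.
  obtain ⟨u, hu, hub, huO⟩ := exists_unit_orthogonal_pair (b - a) (O - a)
  have huτ : |inner ℝ u τ| ≤ 1 := by
    refine (abs_real_inner_le_norm _ _).trans ?_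
    rw [hu, hτ.1, mul_one]
  have huc : inner ℝ u (c - a) = t * inner ℝ u τ := by
    rw [hc, inner_add_right, real_inner_smul_right, real_inner_smul_right, hub, mul_zero, zero_add]
  have ht2 : 2 * r ≤ t := by
    have hw := hT.width (u := u) (a := a) hu (α := min 0 (t * inner ℝ u τ))
      (β := max 0 (t * inner ℝ u τ)) (fun v hv => by
        by_cases hvO : v = O
        · rw [hvO, huO]; exact ⟨min_le_left _ _, le_max_left _ _⟩
        · rcases hF v (Finset.mem_of_ne_opposite hT4 hF3 hFT hO hOF hv hvO) with rfl | rfl | rfl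
          · rw [sub_self, inner_zero_right]; exact ⟨min_le_left _ _, le_max_left _ _⟩
          · rw [hub]; exact ⟨min_le_left _ _, le_max_left _ _⟩
          · rw [huc]; exact ⟨min_le_right _ _, le_max_right _ _⟩)
    rw [max_sub_min_eq_abs, sub_zero, abs_mul, abs_of_pos ht] at hw
    nlinarith
  have hDc : ‖c - a‖ ≤ D := norm_sub_le_diam (subset_convexHull ℝ _ (hFT hcF))
    (subset_convexHull ℝ _ (hFT ha))
  have hl : |l| * ‖b - a‖ ≤ D := by
    refine le_trans ?_ hDc
    rw [← Real.norm_eq_abs, ← norm_smul]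
    refine abs_le_of_sq_le_sq' ?_ (norm_nonneg _) |>.2
    rw [hc, norm_add_sq_real, real_inner_smul_left, real_inner_smul_right, real_inner_comm,
      hτ.inner_edge]
    nlinarith [sq_nonneg ‖t • τ‖]
  have h1 : |inner ℝ n (c - a)| ≤ η * D :=
    h.abs_inner_vertex_le hΩ hη hd hFT hFΓ ha hcF
  have h2 : |l * inner ℝ n (b - a)| ≤ η * D := by
    rw [abs_mul]
    have := h.abs_inner_le hΩ (hball b hb) (hball a ha) (hFΓ a ha) (hFΓ b hb)
    calc |l| * |inner ℝ n (b - a)| ≤ |l| * (η * ‖b - a‖) :=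
          mul_le_mul_of_nonneg_left this (abs_nonneg _)
      _ = η * (|l| * ‖b - a‖) := by ring
      _ ≤ η * D := mul_le_mul_of_nonneg_left hl hη.le
  have h3 : t * inner ℝ n τ = inner ℝ n (c - a) - l * inner ℝ n (b - a) := by
    rw [hc, inner_add_right, real_inner_smul_right, real_inner_smul_right]
    ring
  have h4 : t * |inner ℝ n τ| ≤ 2 * (η * D) := by
    have e : t * |inner ℝ n τ| = |t * inner ℝ n τ| := by rw [abs_mul, abs_of_pos ht]
    rw [e, h3]
    exact (abs_sub _ _).trans (by linarith)
  have hσ : 0 ≤ σ := by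
    have := (Metric.diam_nonneg (s := convexHull ℝ (T : Set E3))).trans hT.diam_le
    exact nonneg_of_mul_nonneg_left this hT.pos
  have h5 : t * |inner ℝ n τ| ≤ t * (η * σ) := by
    have h6 : η * D ≤ η * (σ * r) := mul_le_mul_of_nonneg_left hT.diam_le hη.le
    have h7 : η * σ * (2 * r) ≤ η * σ * t := mul_le_mul_of_nonneg_left ht2 (by positivity)
    linarith
  exact le_of_mul_le_mul_left h5 ht

namespace TetMesh

variable {K : TetMesh} {Ω : Set E3}

theorem Fits.mem_frontier (hK : K.Fits Ω) {T τ : Finset E3} (hT : T ∈ K.elements) (hτ : τ ⊆ T)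
    (hb : convexHull ℝ (τ : Set E3) ⊆ K.boundary) : ∀ v ∈ τ, v ∈ frontier Ω :=
  fun v hv => hK.boundary_vertex_mem T hT v (hτ hv) (hb (subset_convexHull ℝ _ hv))

/-- A closed half-space separating two elements of the mesh. -/
theorem exists_separation (K : TetMesh) {T₁ T₂ : Finset E3} (hT₁ : T₁ ∈ K.elements)
    (hT₂ : T₂ ∈ K.elements) (hne : T₁ ≠ T₂) :
    ∃ (g : E3) (α : ℝ), ‖g‖ = 1 ∧ (∀ x ∈ T₁, inner ℝ g x ≤ α) ∧ ∀ x ∈ T₂, α ≤ inner ℝ g x := by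
  obtain ⟨f, α, h1, h2⟩ := geometric_hahn_banach_open_open
    (convex_convexHull ℝ (T₁ : Set E3)).interior isOpen_interior
    (convex_convexHull ℝ (T₂ : Set E3)).interior isOpen_interior
    (K.disjoint_interior hT₁ hT₂ hne)
  have hcl : ∀ T ∈ K.elements, ∀ x ∈ T, x ∈ closure (interior (convexHull ℝ (T : Set E3))) := by
    intro T hT x hx
    rw [(convex_convexHull ℝ _).closure_interior_eq_closure_of_nonempty_interior
      (K.interior_convexHull_nonempty hT)]
    exact subset_closure (subset_convexHull ℝ _ hx)
  obtain ⟨x₁, hx₁⟩ := K.interior_convexHull_nonempty hT₁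
  obtain ⟨x₂, hx₂⟩ := K.interior_convexHull_nonempty hT₂
  set g := (InnerProductSpace.toDual ℝ E3).symm f with hg
  have hgf : ∀ x, inner ℝ g x = f x := fun x => InnerProductSpace.toDual_symm_apply
  have hg0 : 0 < ‖g‖ := by
    rw [norm_pos_iff]
    intro h0
    have e1 := h1 x₁ hx₁
    have e2 := h2 x₂ hx₂
    rw [← hgf, h0, inner_zero_left] at e1 e2
    linarith
  refine ⟨‖g‖⁻¹ • g, ‖g‖⁻¹ * α, ?_, fun x hx => ?_, fun x hx => ?_⟩
  · rw [norm_smul, norm_inv, norm_norm, inv_mul_cancel₀ hg0.ne']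
  · rw [real_inner_smul_left, hgf]
    refine mul_le_mul_of_nonneg_left ?_ (by positivity)
    exact closure_minimal (s := interior (convexHull ℝ (T₁ : Set E3))) (t := {y | f y ≤ α})
      (fun y hy => (h1 y hy).le) (isClosed_le f.continuous continuous_const) (hcl T₁ hT₁ x hx)
  · rw [real_inner_smul_left, hgf]
    refine mul_le_mul_of_nonneg_left ?_ (by positivity)
    exact closure_minimal (s := interior (convexHull ℝ (T₂ : Set E3))) (t := {y | α ≤ f y})
      (fun y hy => (h2 y hy).le) (isClosed_le continuous_const f.continuous) (hcl T₂ hT₂ x hx)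

/-- The skins are transversal to the boundary of the domain. -/
theorem IsSkinChoice.le_abs_inner {η δ σ s : ℝ} {n a b : E3} {d : Finset E3 → E3}
    (hd : K.IsSkinChoice s d) (hK : K.Fits Ω) (hΩ : IsOpen Ω) (hη : 0 < η) (hσ : 1 ≤ σ)
    (hfat : ∀ T ∈ K.elements, ∃ r, IsFat σ r T)
    (hdiam : ∀ T ∈ K.elements, Metric.diam (convexHull ℝ (T : Set E3)) < δ)
    (hs : 0 ≤ s) (hs1 : s < 1) (hηs : 20 * (η * σ) ≤ 1 - s) (hησ : 20 * (η * σ * σ) ≤ 1)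
    (hab : a ≠ b) (he : K.IsBoundaryEdge {a, b}) (h : IsApproxNormal Ω η δ a n) :
    (1 - s) / 4 ≤ |inner ℝ n (d {a, b})| := by
  classical
  obtain ⟨hd1, hde, F₁, F₂, hF, heF₁, heF₂, hF₁, hF₂, τ₁, τ₂, hτ₁, hτ₂, hds⟩ := hd _ he
  obtain ⟨hF₁3, ⟨T₁, hT₁, hFT₁⟩, hFb₁⟩ := hF₁
  obtain ⟨hF₂3, ⟨T₂, hT₂, hFT₂⟩, hFb₂⟩ := hF₂
  have ha₁ : a ∈ F₁ := heF₁ (by simp)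
  have hb₁ : b ∈ F₁ := heF₁ (by simp)
  have ha₂ : a ∈ F₂ := heF₂ (by simp)
  have hb₂ : b ∈ F₂ := heF₂ (by simp)
  have hΓ₁ := hK.mem_frontier hT₁ hFT₁ hFb₁
  have hΓ₂ := hK.mem_frontier hT₂ hFT₂ hFb₂
  obtain ⟨r₁, hr₁⟩ := hfat T₁ hT₁
  obtain ⟨r₂, hr₂⟩ := hfat T₂ hT₂
  have h4₁ := K.card_eq_four T₁ hT₁
  have h4₂ := K.card_eq_four T₂ hT₂
  have hησ1 : η * σ < 1 := by linarith
  have hηε : η ≤ η * σ := le_mul_of_one_le_right hη.le hσ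
  obtain ⟨O₁, hO₁, hOF₁⟩ := Finset.exists_opposite h4₁ hF₁3
  obtain ⟨O₂, hO₂, hOF₂⟩ := Finset.exists_opposite h4₂ hF₂3
  have hin₁ := h.inner_opposite_le hΩ hη hr₁ h4₁ hF₁3 (hdiam T₁ hT₁) hησ1 hFT₁ hΓ₁ ha₁ hO₁ hOF₁
    (hK.vertex_mem T₁ hT₁ O₁ hO₁)
  have hin₂ := h.inner_opposite_le hΩ hη hr₂ h4₂ hF₂3 (hdiam T₂ hT₂) hησ1 hFT₂ hΓ₂ ha₂ hO₂ hOF₂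
    (hK.vertex_mem T₂ hT₂ O₂ hO₂)
  have hnτ₁ := h.abs_inner_conormal_le hΩ hη hr₁ h4₁ hF₁3 (hdiam T₁ hT₁) hFT₁ hΓ₁ hab ha₁ hb₁ hτ₁
  have hnτ₂ := h.abs_inner_conormal_le hΩ hη hr₂ h4₂ hF₂3 (hdiam T₂ hT₂) hFT₂ hΓ₂ hab ha₂ hb₂ hτ₂
  have hba : 0 < ‖b - a‖ := norm_pos_iff.2 (sub_ne_zero.2 hab.symm)
  set e := ‖b - a‖⁻¹ • (b - a) with he_def
  have hor : ∀ x : E3, inner ℝ x (b - a) = 0 → inner ℝ x e = 0 := fun x hx => by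
    rw [he_def, real_inner_smul_right, hx, mul_zero]
  have heτ : inner ℝ e τ₁ = 0 := by rw [real_inner_comm]; exact hor _ hτ₁.inner_edge
  have he1 : ‖e‖ = 1 := by rw [he_def, norm_smul, norm_inv, norm_norm, inv_mul_cancel₀ hba.ne']
  obtain ⟨m, hm⟩ := exists_frame he1 hτ₁.1 heτ
  have hsq : ∀ x : E3, ‖x‖ ^ 2 = inner ℝ x e ^ 2 + inner ℝ x τ₁ ^ 2 + inner ℝ x m ^ 2 := by
    intro x
    rw [← real_inner_self_eq_norm_sq, hm]
    ring
  have hne : |inner ℝ n e| ≤ η * σ := by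
    refine le_trans ?_ hηε
    rw [he_def, real_inner_smul_right, abs_mul, abs_of_pos (inv_pos.2 hba), inv_mul_le_iff₀ hba,
      mul_comm]
    exact h.abs_inner_le hΩ (mem_ball_of_diam_lt (hdiam T₁ hT₁) (hFT₁ ha₁) (hFT₁ hb₁))
      (mem_ball_of_diam_lt (hdiam T₁ hT₁) (hFT₁ ha₁) (hFT₁ ha₁)) (hΓ₁ a ha₁) (hΓ₁ b hb₁)
  have hnsq : inner ℝ n e ^ 2 + inner ℝ n τ₁ ^ 2 + inner ℝ n m ^ 2 = 1 := by
    rw [← hsq, h.norm_eq, one_pow]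
  have hτ₂e := hor _ hτ₂.inner_edge
  have hτ₂sq : inner ℝ τ₂ τ₁ ^ 2 + inner ℝ τ₂ m ^ 2 = 1 := by
    have := hsq τ₂
    rw [hτ₂.1, hτ₂e] at this
    linarith
  have hnτ₂' : |inner ℝ τ₂ τ₁ * inner ℝ n τ₁ + inner ℝ τ₂ m * inner ℝ n m| ≤ η * σ := by
    have := hm τ₂ n
    rw [hτ₂e, zero_mul, zero_add, real_inner_comm] at this
    rwa [← this]
  have hd_e := hor _ (hde a (by simp) b (by simp))
  -- The nonpositive case is that of nearly opposite conormals; the other one is refuted.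
  rcases le_total (inner ℝ τ₂ τ₁) 0 with ht | ht
  · have hdsq : inner ℝ (d {a, b}) τ₁ ^ 2 + inner ℝ (d {a, b}) m ^ 2 = 1 := by
      have := hsq (d {a, b})
      rw [hd1, hd_e] at this
      linarith
    have hds' : |inner ℝ (d {a, b}) τ₁ * (1 - inner ℝ τ₂ τ₁) -
        inner ℝ (d {a, b}) m * inner ℝ τ₂ m| ≤ 2 * s := by
      have e1 : inner ℝ (d {a, b}) (τ₁ - τ₂) = inner ℝ (d {a, b}) τ₁ * (1 - inner ℝ τ₂ τ₁) -
          inner ℝ (d {a, b}) m * inner ℝ τ₂ m := by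
        rw [inner_sub_right, hm (d {a, b}) τ₂, hd_e]
        ring
      rw [← e1]
      refine hds.trans ?_
      have := norm_sub_le τ₁ τ₂
      rw [hτ₁.1, hτ₂.1] at this
      nlinarith
    have := skin_transversal_aux hs hs1 hηs hnsq hne hnτ₁ hτ₂sq hnτ₂' ht hdsq hds'
    rwa [hm n (d {a, b}), hd_e, mul_zero, zero_add]
  · exfalso
    by_cases hTT : T₁ = T₂
    · subst hTT
      -- If one tetrahedron had both faces, the vertex opposite to the first would belong to the
      -- second, hence lie near the tangent plane instead of at depth `r`.
      have hO₁F₂ : O₁ ∈ F₂ := by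
        by_contra hcon
        apply hF
        refine (Finset.eq_of_subset_of_card_le (fun v hv => ?_) (by rw [hF₁3, hF₂3])).symm
        refine Finset.mem_of_ne_opposite h4₁ hF₁3 hFT₁ hO₁ hOF₁ (hFT₂ hv) ?_
        rintro rfl
        exact hcon hv
      have h1 := h.abs_inner_vertex_le hΩ hη (hdiam T₁ hT₁) hFT₂ hΓ₂ ha₂ hO₁F₂
      have h2 := mul_le_mul_of_nonneg_left hr₁.diam_le hη.le
      have h3 := (abs_le.1 h1).1
      nlinarith [hr₁.pos]
    · obtain ⟨g, α, hg1, hgT₁, hgT₂⟩ := K.exists_separation hT₁ hT₂ hTT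
      -- The separating plane contains the common edge, so only its components across the edge
      -- matter.
      have hga : inner ℝ g a = α := le_antisymm (hgT₁ a (hFT₁ ha₁)) (hgT₂ a (hFT₂ ha₂))
      have hgb : inner ℝ g b = α := le_antisymm (hgT₁ b (hFT₁ hb₁)) (hgT₂ b (hFT₂ hb₂))
      have hgba : inner ℝ g (b - a) = 0 := by rw [inner_sub_right, hga, hgb, sub_self]
      have hge := hor g hgba
      have hgsq : inner ℝ g τ₁ ^ 2 + inner ℝ g m ^ 2 = 1 := by
        have := hsq g
        rw [hg1, hge] at this
        linarith
      have hgτ₁ : inner ℝ g τ₁ ≤ 0 := by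
        obtain ⟨c, hcF, -, -, l, t, ht, hc⟩ := hτ₁.exists_eq
        have h1 : inner ℝ g (c - a) ≤ 0 := by
          rw [inner_sub_right, hga]; linarith [hgT₁ c (hFT₁ hcF)]
        rw [hc, inner_add_right, real_inner_smul_right, real_inner_smul_right, hgba] at h1
        by_contra! hlt
        linarith [mul_pos ht hlt]
      have hgτ₂ : 0 ≤ inner ℝ g τ₂ := by
        obtain ⟨c, hcF, -, -, l, t, ht, hc⟩ := hτ₂.exists_eq
        have h1 : 0 ≤ inner ℝ g (c - a) := by
          rw [inner_sub_right, hga]; linarith [hgT₂ c (hFT₂ hcF)]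
        rw [hc, inner_add_right, real_inner_smul_right, real_inner_smul_right, hgba] at h1
        by_contra! hlt
        linarith [mul_neg_of_pos_of_neg ht hlt]
      rw [hm g τ₂, hge, zero_mul, zero_add] at hgτ₂
      have hcoord : ∀ (O : E3) (T : Finset E3) (r : ℝ), IsFat σ r T → O ∈ T → a ∈ T →
          ∀ i, |(![inner ℝ (O - a) e, inner ℝ (O - a) τ₁, inner ℝ (O - a) m] : Fin 3 → ℝ) i| ≤
            σ * r := by
        intro O T r hr hO ha i
        have hle : ‖O - a‖ ≤ σ * r := (norm_sub_le_diam (subset_convexHull ℝ _ hO)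
          (subset_convexHull ℝ _ ha)).trans hr.diam_le
        refine le_trans ?_ hle
        obtain ⟨h1, h2, h3⟩ := abs_le_of_sum_sq_eq (norm_nonneg _) (hsq (O - a))
        fin_cases i
        · exact h1
        · exact h2
        · exact h3
      rw [hm] at hin₁ hin₂
      have hgo₁ : inner ℝ g (O₁ - a) ≤ 0 := by
        rw [inner_sub_right, hga]; linarith [hgT₁ O₁ hO₁]
      have hgo₂ : 0 ≤ inner ℝ g (O₂ - a) := by
        rw [inner_sub_right, hga]; linarith [hgT₂ O₂ hO₂]
      rw [hm g, hge, zero_mul, zero_add] at hgo₁ hgo₂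
      exact no_separation_aux (by linarith) hησ hr₁.pos hr₂.pos hnsq hne hnτ₁ hτ₂sq hnτ₂' ht hgsq
        hgτ₁ hgτ₂ (hcoord O₁ T₁ r₁ hr₁ hO₁ (hFT₁ ha₁)) (hcoord O₂ T₂ r₂ hr₂ hO₂ (hFT₂ ha₂))
        (by simpa using hin₁) (by simpa using hin₂) (by simpa using hgo₁) (by simpa using hgo₂)

/-- The normal line to a boundary edge in the plane skin meets the boundary close to the edge. -/
theorem IsSkinChoice.exists_nearest_edge {η δ σ s : ℝ} {n a b : E3} {d : Finset E3 → E3}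
    (hd : K.IsSkinChoice s d) (hK : K.Fits Ω) (hΩ : IsOpen Ω) (hη : 0 < η) (hσ : 1 ≤ σ)
    (hfat : ∀ T ∈ K.elements, ∃ r, IsFat σ r T)
    (hdiam : ∀ T ∈ K.elements, 2 * Metric.diam (convexHull ℝ (T : Set E3)) < δ)
    (hs : 0 ≤ s) (hs1 : s < 1) (hηs : 20 * (η * σ) ≤ 1 - s) (hησ : 20 * (η * σ * σ) ≤ 1)
    (hab : a ≠ b) (he : K.IsBoundaryEdge {a, b}) (h : IsApproxNormal Ω η δ a n)
    {T : Finset E3} (hT : T ∈ K.elements) (heT : {a, b} ⊆ T) {M : E3}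
    (hM : M ∈ convexHull ℝ (({a, b} : Finset E3) : Set E3)) :
    ∃ Q, IsNearestPoint (frontier Ω ∩ {x | ∃ t : ℝ, x = M + t • d {a, b}}) M Q ∧
      dist M Q ≤ 16 * η / (1 - s) * Metric.diam (convexHull ℝ (T : Set E3)) := by
  have hdiam' : ∀ T ∈ K.elements, Metric.diam (convexHull ℝ (T : Set E3)) < δ := fun T hT => by
    linarith [hdiam T hT, Metric.diam_nonneg (s := convexHull ℝ (T : Set E3))]
  have htr := hd.le_abs_inner hK hΩ hη hσ hfat hdiam' hs hs1 hηs hησ hab he h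
  have hΓ := hK.mem_frontier hT heT he.2.2
  set D := Metric.diam (convexHull ℝ (T : Set E3)) with hD
  have haT := subset_convexHull ℝ (T : Set E3) (heT (by simp : a ∈ ({a, b} : Finset E3)))
  have hbT := subset_convexHull ℝ (T : Set E3) (heT (by simp : b ∈ ({a, b} : Finset E3)))
  have hMT : M ∈ convexHull ℝ (T : Set E3) := convexHull_mono (by exact_mod_cast heT) hM
  have hD0 : 0 < D :=
    (norm_pos_iff.2 (sub_ne_zero.2 hab.symm)).trans_le (norm_sub_le_diam hbT haT)
  have hMn : |inner ℝ n (M - a)| ≤ η * D := by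
    rw [abs_le]
    refine inner_bounds_of_mem_convexHull (A := (({a, b} : Finset E3) : Set E3)) (fun v hv => ?_) hM
    rw [← abs_le]
    exact h.abs_inner_vertex_le hΩ hη (hdiam' T hT) heT hΓ (by simp) hv
  have hηε : η ≤ η * σ := le_mul_of_one_le_right hη.le hσ
  obtain ⟨t, ht, htf⟩ := h.exists_frontier_on_line hΩ (hΓ a (by simp)) hη (M := M)
    (ν := d {a, b}) (hd _ he).1 (c := (1 - s) / 4) (by linarith) (by linarith) htr (ℓ := D)
    hD0 (norm_sub_le_diam hMT haT) hMn (by linarith [hdiam T hT])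
  obtain ⟨Q, hQ, hMQ⟩ := exists_isNearestPoint (M := M)
    (isClosed_frontier.inter (isClosed_line M (d {a, b}))) ⟨htf, t, rfl⟩
  refine ⟨Q, hQ, hMQ.trans ?_⟩
  rw [dist_eq_norm, sub_add_cancel_left, norm_neg, norm_smul, (hd _ he).1, mul_one,
    Real.norm_eq_abs]
  refine ht.trans_eq ?_
  have : 1 - s ≠ 0 := by linarith
  field_simp
  ring

end TetMesh

/-! ### Energy of piecewise polynomials, and membership in the test space. -/

/-- The range is connected. This shows that a test function of zero energy vanishes without
following chains of adjacent tetrahedra. -/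
theorem eq_of_finite_range {v : E3 → ℝ} (hv : Continuous v) (hf : (Set.range v).Finite) (x y : E3) :
    v x = v y := by
  by_contra hne
  wlog hlt : v x < v y generalizing x y
  · exact this y x (Ne.symm hne) (lt_of_le_of_ne (not_lt.1 hlt) (Ne.symm hne))
  have h := (isPreconnected_range hv).Icc_subset ⟨x, rfl⟩ ⟨y, rfl⟩
  exact (Set.Icc_infinite hlt) (hf.subset h)

theorem IsLatticePoint.mono {k : ℕ} {τ T : Finset E3} (hτ : τ ⊆ T) {x : E3}
    (hx : IsLatticePoint k τ x) : IsLatticePoint k T x := by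
  classical
  obtain ⟨a, ha, rfl⟩ := hx
  refine ⟨fun v => if v ∈ τ then a v else 0, ?_, ?_⟩
  · rw [Finset.sum_ite_mem, Finset.inter_eq_right.2 hτ, ha]
  · rw [← Finset.sum_subset hτ (fun v _ hv => by simp [hv])]
    exact Finset.sum_congr rfl fun v hv => by simp [hv]

theorem isLatticePoint_of_mem {k : ℕ} (hk : 0 < k) {T : Finset E3} {S : E3} (hS : S ∈ T) :
    IsLatticePoint k T S := by
  refine IsLatticePoint.mono (Finset.singleton_subset_iff.2 hS) ⟨fun _ => k, by simp, ?_⟩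
  have : (k : ℝ) ≠ 0 := by exact_mod_cast hk.ne'
  rw [Finset.sum_singleton, div_self this, one_smul]

theorem IsInnerLatticePoint.isLatticePoint {k : ℕ} {τ : Finset E3} {x : E3}
    (h : IsInnerLatticePoint k τ x) : IsLatticePoint k τ x := by
  obtain ⟨a, -, h1, h2⟩ := h
  exact ⟨a, h1, h2⟩

/-- A polynomial of zero energy on a nonempty open convex set is constant. -/
theorem eq_C_of_energy_eq_zero {p : MvPolynomial (Fin 3) ℝ} {U : Set E3} (hU : IsOpen U)
    (hUc : Convex ℝ U) (hUb : Bornology.IsBounded U) (hne : U.Nonempty)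
    (h : ∫ x in U, ‖gradient (polyFun p) x‖ ^ 2 = 0) : ∃ c, p = MvPolynomial.C c := by
  rw [setIntegral_eq_zero_iff_of_nonneg_ae (ae_of_all _ fun x => sq_nonneg _)
    (integrableOn_norm_gradient_polyFun_sq p hUb)] at h
  have h1 := Measure.eqOn_open_of_ae_eq h hU
    ((continuous_gradient_polyFun p).norm.pow 2).continuousOn continuousOn_const
  obtain ⟨x0, hx0⟩ := hne
  refine ⟨polyFun p x0, ?_⟩
  rw [← sub_eq_zero]
  refine eq_zero_of_polyFun_eq_zero hU ⟨x0, hx0⟩ fun x hx => ?_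
  have hfd : U.EqOn (fderiv ℝ (polyFun p)) 0 := by
    intro y hy
    have h2 : ‖gradient (polyFun p) y‖ ^ 2 = 0 := h1 hy
    have h3 : gradient (polyFun p) y = 0 := by simpa using h2
    rw [← toDual_gradient, h3, map_zero]
    rfl
  have h4 := hU.is_const_of_fderiv_eq_zero (𝕜 := ℝ) hUc.isPreconnected
    (differentiable_polyFun p).differentiableOn hfd hx hx0
  rw [polyFun_sub, h4]
  simp [polyFun]

namespace TetMesh

variable (K : TetMesh)

/-- The difference lies in finitely many frontiers of convex sets, which are null. -/
theorem domain_ae_eq :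
    (K.domain : Set E3) =ᵐ[volume] ⋃ T ∈ K.elements, interior (convexHull ℝ (T : Set E3)) := by
  refine Filter.EventuallyLE.antisymm ?_ (LE.le.eventuallyLE
    (Set.iUnion₂_subset fun T hT => K.interior_subset_domain hT))
  rw [ae_le_set]
  have hsub : K.domain \ (⋃ T ∈ K.elements, interior (convexHull ℝ (T : Set E3))) ⊆
      ⋃ T ∈ K.elements, frontier (convexHull ℝ (T : Set E3)) := by
    rintro x ⟨hx, hx'⟩
    obtain ⟨T, hT, hxT⟩ := Set.mem_iUnion₂.1 (interior_subset hx)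
    refine Set.mem_iUnion₂.2 ⟨T, hT, subset_closure hxT, fun hxi => hx' ?_⟩
    exact Set.mem_iUnion₂.2 ⟨T, hT, hxi⟩
  refine measure_mono_null hsub ?_
  exact (measure_biUnion_null_iff K.elements.countable_toSet).2
    fun T _ => (convex_convexHull ℝ _).addHaar_frontier volume

variable {K}

theorem brokenGrad_eq (w : Finset E3 → MvPolynomial (Fin 3) ℝ) {T : Finset E3}
    (hT : T ∈ K.elements) {x : E3} (hx : x ∈ interior (convexHull ℝ (T : Set E3))) :
    K.brokenGrad w x = gradient (polyFun (w T)) x := by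
  unfold brokenGrad
  rw [Finset.sum_eq_single T, Set.indicator_of_mem hx]
  · intro T' hT' hne
    refine Set.indicator_of_notMem (fun hx' => ?_) _
    exact Set.disjoint_left.1 (K.disjoint_interior hT hT' (Ne.symm hne)) hx hx'
  · exact fun h => absurd hT h

theorem brokenGrad_sub (w p : Finset E3 → MvPolynomial (Fin 3) ℝ) (x : E3) :
    K.brokenGrad (fun T => w T - p T) x = K.brokenGrad w x - K.brokenGrad p x := by
  unfold brokenGrad
  rw [← Finset.sum_sub_distrib]
  refine Finset.sum_congr rfl fun T _ => ?_
  by_cases hx : x ∈ interior (convexHull ℝ (T : Set E3))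
  · simp only [Set.indicator_of_mem hx, gradient_polyFun_sub]
  · simp only [Set.indicator_of_notMem hx, sub_zero]

theorem ae_mem_interior : ∀ᵐ x ∂(volume.restrict K.domain),
    ∃ T ∈ K.elements, x ∈ interior (convexHull ℝ (T : Set E3)) := by
  rw [Measure.restrict_congr_set K.domain_ae_eq]
  refine (ae_restrict_mem ?_).mono fun x hx => ?_
  · exact K.elements.measurableSet_biUnion fun T _ => isOpen_interior.measurableSet
  · simpa using hx

theorem memLp_brokenGrad (K : TetMesh) (w : Finset E3 → MvPolynomial (Fin 3) ℝ) :
    MemLp (K.brokenGrad w) 2 (volume.restrict K.domain) := by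
  unfold brokenGrad
  refine memLp_finsetSum _ fun T _ => ?_
  exact ((continuous_gradient_polyFun (w T)).memLp_restrict_of_isBounded
    K.isBounded_domain).indicator isOpen_interior.measurableSet

/-- The energy of a piecewise polynomial function is the sum of the energies of its pieces. -/
theorem integral_norm_brokenGrad_sq (K : TetMesh) (w : Finset E3 → MvPolynomial (Fin 3) ℝ) :
    ∫ x in K.domain, ‖K.brokenGrad w x‖ ^ 2 = ∑ T ∈ K.elements,
      ∫ x in interior (convexHull ℝ (T : Set E3)), ‖gradient (polyFun (w T)) x‖ ^ 2 := by
  have hint : IntegrableOn (fun x => ‖K.brokenGrad w x‖ ^ 2) K.domain :=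
    (K.memLp_brokenGrad w).norm.integrable_sq
  rw [setIntegral_congr_set K.domain_ae_eq, integral_biUnion_finset]
  · refine Finset.sum_congr rfl fun T hT => ?_
    refine setIntegral_congr_fun isOpen_interior.measurableSet fun x hx => ?_
    simp only [brokenGrad_eq w hT hx]
  · exact fun T _ => isOpen_interior.measurableSet
  · exact fun T hT T' hT' hne => K.disjoint_interior hT hT' hne
  · exact fun T hT => hint.mono_set (K.interior_subset_domain hT)

/-- The broken gradient as an element of `L²`. -/
def gradLp (K : TetMesh) (w : Finset E3 → MvPolynomial (Fin 3) ℝ) :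
    Lp E3 2 (volume.restrict K.domain) := (K.memLp_brokenGrad w).toLp

theorem l2Norm_brokenGrad (K : TetMesh) (w : Finset E3 → MvPolynomial (Fin 3) ℝ) :
    K.l2Norm (K.brokenGrad w) = ‖K.gradLp w‖ := by
  unfold l2Norm gradLp
  rw [← norm_toLp_sq_eq_integral (K.memLp_brokenGrad w), Real.sqrt_sq (norm_nonneg _)]

theorem norm_gradLp_sq (K : TetMesh) (w : Finset E3 → MvPolynomial (Fin 3) ℝ) :
    ‖K.gradLp w‖ ^ 2 = ∑ T ∈ K.elements,
      ∫ x in interior (convexHull ℝ (T : Set E3)), ‖gradient (polyFun (w T)) x‖ ^ 2 := by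
  rw [← integral_norm_brokenGrad_sq, gradLp, norm_toLp_sq_eq_integral]

theorem gradLp_sub (K : TetMesh) (w p : Finset E3 → MvPolynomial (Fin 3) ℝ) :
    K.gradLp w - K.gradLp p = K.gradLp (fun T => w T - p T) := by
  unfold gradLp
  rw [← MemLp.toLp_sub]
  exact MemLp.toLp_congr _ _ (ae_of_all _ fun x => (brokenGrad_sub w p x).symm)

/-- `p` is the family of polynomial expressions of the function `v`. -/
def IsPiecewise (K : TetMesh) (v : E3 → ℝ) (p : Finset E3 → MvPolynomial (Fin 3) ℝ) : Prop :=
  ∀ T ∈ K.elements, ∀ x ∈ convexHull ℝ (T : Set E3), v x = polyFun (p T) x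

theorem exists_isPiecewise {k : ℕ} {v : E3 → ℝ} (hv : v ∈ K.testSpace k) :
    ∃ p, K.IsPiecewise v p := by
  classical
  choose p _ hp using hv.2.2
  refine ⟨fun T => if hT : T ∈ K.elements then p T hT else 0, fun T hT x hx => ?_⟩
  simp only [dif_pos hT]
  exact hp T hT x hx

theorem IsPiecewise.gradient_ae_eq {v : E3 → ℝ} {p : Finset E3 → MvPolynomial (Fin 3) ℝ}
    (h : K.IsPiecewise v p) : gradient v =ᵐ[volume.restrict K.domain] K.brokenGrad p := by
  filter_upwards [ae_mem_interior (K := K)] with x ⟨T, hT, hx⟩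
  rw [brokenGrad_eq p hT hx]
  have : v =ᶠ[nhds x] polyFun (p T) :=
    Filter.eventuallyEq_of_mem (mem_interior_iff_mem_nhds.1 hx) fun y hy => h T hT y hy
  unfold gradient
  rw [this.fderiv_eq]

theorem IsPiecewise.l2Norm_gradient {v : E3 → ℝ} {p : Finset E3 → MvPolynomial (Fin 3) ℝ}
    (h : K.IsPiecewise v p) : K.l2Norm (gradient v) = ‖K.gradLp p‖ := by
  rw [← l2Norm_brokenGrad]
  unfold l2Norm
  congr 1
  refine integral_congr_ae ?_
  filter_upwards [h.gradient_ae_eq] with x hx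
  rw [hx]

theorem IsPiecewise.form_eq {v : E3 → ℝ} {p : Finset E3 → MvPolynomial (Fin 3) ℝ}
    (h : K.IsPiecewise v p) (w : Finset E3 → MvPolynomial (Fin 3) ℝ) :
    K.form w v = inner ℝ (K.gradLp w) (K.gradLp p) := by
  unfold gradLp form
  rw [inner_toLp_eq_integral]
  refine integral_congr_ae ?_
  filter_upwards [h.gradient_ae_eq] with x hx
  rw [hx]

theorem exists_eq_C_of_gradLp_eq_zero {w : Finset E3 → MvPolynomial (Fin 3) ℝ}
    (h : ‖K.gradLp w‖ = 0) : ∀ T ∈ K.elements, ∃ c, w T = MvPolynomial.C c := by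
  intro T hT
  have h1 := K.norm_gradLp_sq w
  rw [h, zero_pow two_ne_zero, eq_comm, Finset.sum_eq_zero_iff_of_nonneg
    (fun T _ => integral_nonneg fun x => sq_nonneg _)] at h1
  exact eq_C_of_energy_eq_zero isOpen_interior (convex_convexHull ℝ _).interior
    ((isBounded_convexHull_finset T).subset interior_subset)
    (K.interior_convexHull_nonempty hT) (h1 T hT)

/-- The gradient is a norm on the test space. -/
theorem l2Norm_gradient_pos {k : ℕ} {v : E3 → ℝ} (hv : v ∈ K.testSpace k) (hv0 : v ≠ 0) :
    0 < K.l2Norm (gradient v) := by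
  obtain ⟨p, hp⟩ := exists_isPiecewise hv
  rw [hp.l2Norm_gradient]
  refine (norm_nonneg _).lt_of_ne fun h0 => hv0 ?_
  choose c hc using exists_eq_C_of_gradLp_eq_zero h0.symm
  -- Extended by zero, `v` is continuous on the whole space, takes finitely many values, and
  -- vanishes off the bounded domain.
  have hcont : Continuous v := by
    rw [← continuousOn_univ]
    have hout : ContinuousOn v K.domainᶜ :=
      continuousOn_const.congr (f := fun _ => (0 : ℝ)) fun x hx => hv.2.1 x hx
    have := hv.1.union_of_isClosed hout isClosed_closure K.isOpen_domain.isClosed_compl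
    refine this.mono fun x _ => ?_
    by_cases hx : x ∈ K.domain
    · exact Or.inl (subset_closure hx)
    · exact Or.inr hx
  have hfin : (Set.range v).Finite := by
    refine ((K.elements.attach.image fun T => c T.1 T.2).finite_toSet.insert 0).subset ?_
    rintro _ ⟨x, rfl⟩
    by_cases hx : x ∈ K.domain
    · obtain ⟨T, hT, hxT⟩ := Set.mem_iUnion₂.1 (interior_subset hx)
      refine Or.inr ?_
      rw [Finset.mem_coe, Finset.mem_image]
      refine ⟨⟨T, hT⟩, Finset.mem_attach _ _, ?_⟩
      rw [hp T hT x hxT, hc T hT]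
      simp [polyFun]
    · exact Or.inl (hv.2.1 x hx)
  obtain ⟨y, hy⟩ : ∃ y, y ∉ K.domain := by
    by_contra! h
    exact NormedSpace.unbounded_univ ℝ E3 (K.isBounded_domain.subset fun x _ => h x)
  funext x
  rw [eq_of_finite_range hcont hfin x y, hv.2.1 y hy]
  rfl

/-- Piecewise polynomials with compatible nodal values, vanishing at the nodes of the boundary,
are the pieces of a function of the test space. -/
theorem exists_mem_testSpace {k : ℕ} (hk : 0 < k) (p : Finset E3 → MvPolynomial (Fin 3) ℝ)
    (hdeg : ∀ T ∈ K.elements, (p T).totalDegree ≤ k)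
    (hbd : ∀ T ∈ K.elements, ∀ x, IsLatticePoint k T x → x ∈ K.boundary → polyFun (p T) x = 0)
    (hcomp : ∀ T ∈ K.elements, ∀ T' ∈ K.elements, ∀ x, IsLatticePoint k T x →
      IsLatticePoint k T' x → x ∉ K.boundary → polyFun (p T) x = polyFun (p T') x) :
    ∃ v ∈ K.testSpace k, K.IsPiecewise v p := by
  classical
  -- The nodes of the common face are nodes of both elements, and they determine both polynomials on
  -- it.
  have hcons : ∀ T ∈ K.elements, ∀ T' ∈ K.elements, ∀ x ∈ convexHull ℝ (T : Set E3),
      x ∈ convexHull ℝ (T' : Set E3) → polyFun (p T) x = polyFun (p T') x := by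
    intro T hT T' hT' x hx hx'
    have hxx := K.inter_subset T hT T' hT' ⟨hx, hx'⟩
    rw [← Finset.coe_inter] at hxx
    rw [← sub_eq_zero, ← polyFun_sub]
    refine polyFun_eq_zero_of_lattice hk (T ∩ T')
      ((MvPolynomial.totalDegree_sub _ _).trans (max_le (hdeg T hT) (hdeg T' hT')))
      (fun y hy => ?_) hxx
    have hyT := hy.mono (T := T) Finset.inter_subset_left
    have hyT' := hy.mono (T := T') Finset.inter_subset_right
    rw [polyFun_sub, sub_eq_zero]
    by_cases hyb : y ∈ K.boundary
    · rw [hbd T hT y hyT hyb, hbd T' hT' y hyT' hyb]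
    · exact hcomp T hT T' hT' y hyT hyT' hyb
  have hzero : ∀ T ∈ K.elements, ∀ x ∈ convexHull ℝ (T : Set E3), x ∉ K.domain →
      polyFun (p T) x = 0 := by
    intro T hT x hx hxd
    obtain ⟨b, hb⟩ := K.exists_isBarycentric hT
    -- The face with `x` in its relative interior lies wholly in the boundary, so every node of it
    -- carries the value 0.
    set τ := T.filter (fun v => 0 < b v x) with hτd
    have hτ : τ ⊆ T := Finset.filter_subset _ _
    have h0 := (hb.mem_convexHull_iff x).1 hx
    have h1 : ∀ v ∈ T, v ∉ τ → b v x = 0 := by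
      intro v hv hvτ
      by_contra hne
      exact hvτ (Finset.mem_filter.2 ⟨hv, (h0 v hv).lt_of_ne (Ne.symm hne)⟩)
    have hsub := K.convexHull_subset_boundary hT hb hτ
      (K.mem_boundary_of_notMem_domain hT hx hxd) (fun v hv => (Finset.mem_filter.1 hv).2) h1
    refine polyFun_eq_zero_of_lattice hk τ (hdeg T hT) (fun y hy => ?_)
      ((hb.mem_convexHull_subset_iff hτ x).2 ⟨h0, h1⟩)
    exact hbd T hT y (hy.mono hτ) (hsub (hy.mem_convexHull hk))
  let v : E3 → ℝ := fun x =>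
    if x ∈ K.domain then
      if h : ∃ T ∈ K.elements, x ∈ convexHull ℝ (T : Set E3) then polyFun (p h.choose) x else 0
    else 0
  have hv : K.IsPiecewise v p := by
    intro T hT x hx
    by_cases hxd : x ∈ K.domain
    · have h : ∃ T ∈ K.elements, x ∈ convexHull ℝ (T : Set E3) := ⟨T, hT, hx⟩
      simp only [v, if_pos hxd, dif_pos h]
      exact hcons _ h.choose_spec.1 T hT x h.choose_spec.2 hx
    · simp only [v, if_neg hxd]
      exact (hzero T hT x hx hxd).symm
  refine ⟨v, ⟨?_, fun x hx => if_neg hx, fun T hT => ⟨p T, hdeg T hT, hv T hT⟩⟩, hv⟩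
  refine ContinuousOn.mono ?_ K.closure_domain_subset
  have hU : (⋃ T ∈ K.elements, convexHull ℝ (T : Set E3)) =
      ⋃ T : K.elements, convexHull ℝ ((T : Finset E3) : Set E3) := by
    ext x
    simp
  rw [hU]
  refine (locallyFinite_of_finite _).continuousOn_iUnion (fun T => isClosed_convexHull _) ?_
  intro T
  exact (continuous_polyFun (p T)).continuousOn.congr fun x hx => hv T T.2 x hx

end TetMesh

/-! ### The inf-sup estimate from the local energy bounds. -/

namespace TetMesh

variable {K : TetMesh}

/-- The conclusion of the stability estimate, for a mesh on which each boundary node is close to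
zeros of the trial functions. -/
theorem inf_sup_of_energy_le {Ω : Set E3} {k : ℕ} (hk : 0 < k) {d : Finset E3 → E3}
    {w : Finset E3 → MvPolynomial (Fin 3) ℝ} (hw : K.IsTrial Ω k d 0 w)
    (hw0 : ∃ T ∈ K.elements, w T ≠ 0)
    (hE : ∀ T ∈ K.elements, ∃ q : MvPolynomial (Fin 3) ℝ, q.totalDegree ≤ k ∧
      (∀ x, IsLatticePoint k T x → (x ∈ K.boundary → polyFun q x = polyFun (w T) x) ∧
        (x ∉ K.boundary → polyFun q x = 0)) ∧
      ∫ x in interior (convexHull ℝ (T : Set E3)), ‖gradient (polyFun q) x‖ ^ 2 ≤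
        1 / 4 * ∫ x in interior (convexHull ℝ (T : Set E3)), ‖gradient (polyFun (w T)) x‖ ^ 2) :
    0 < K.l2Norm (K.brokenGrad w) ∧
      ∃ L : ℝ, IsLUB {r : ℝ | ∃ v ∈ K.testSpace k, v ≠ 0 ∧
          r = K.form w v / (K.l2Norm (K.brokenGrad w) * K.l2Norm (gradient v))} L ∧
        1 / 3 ≤ L := by
  classical
  choose q' hq'deg hq'node hq'E using hE
  let q : Finset E3 → MvPolynomial (Fin 3) ℝ := fun T => if hT : T ∈ K.elements then q' T hT else 0
  have hq : ∀ T (hT : T ∈ K.elements), q T = q' T hT := fun T hT => dif_pos hT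
  let p : Finset E3 → MvPolynomial (Fin 3) ℝ := fun T => w T - q T
  obtain ⟨v, hvV, hvp⟩ := exists_mem_testSpace (K := K) hk p
    (fun T hT => (MvPolynomial.totalDegree_sub _ _).trans (max_le (hw.degree_le T hT)
      (by rw [hq T hT]; exact hq'deg T hT)))
    (fun T hT x hx hxb => by
      rw [polyFun_sub, hq T hT, (hq'node T hT x hx).1 hxb, sub_self])
    (fun T hT T' hT' x hx hx' hxb => by
      rw [polyFun_sub, polyFun_sub, hq T hT, hq T' hT', (hq'node T hT x hx).2 hxb,
        (hq'node T' hT' x hx').2 hxb, hw.single_valued T hT T' hT' x hx hx' (Or.inl hxb)])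
  have hwp : ‖K.gradLp w - K.gradLp p‖ ≤ 1 / 2 * ‖K.gradLp w‖ := by
    have h1 : K.gradLp w - K.gradLp p = K.gradLp q := by
      rw [gradLp_sub]
      congr 1
      funext T
      exact sub_sub_cancel _ _
    rw [h1]
    refine abs_le_of_sq_le_sq' ?_ (by positivity) |>.2
    rw [mul_pow, norm_gradLp_sq, norm_gradLp_sq, Finset.mul_sum]
    refine Finset.sum_le_sum fun T hT => ?_
    rw [hq T hT]
    refine (hq'E T hT).trans_eq ?_
    norm_num
  -- If `w` had zero energy, so would `v`, whence `v = 0`. Then `w` is constant on each element and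
  -- vanishes at its vertices: on the boundary by the trial condition, elsewhere because `v` and `w`
  -- agree there.
  have hpos : 0 < ‖K.gradLp w‖ := by
    refine (norm_nonneg _).lt_of_ne fun h0 => ?_
    obtain ⟨T, hT, hTw⟩ := hw0
    have hp0 : ‖K.gradLp p‖ = 0 := by
      have h1 := norm_sub_norm_le (K.gradLp p) (K.gradLp w)
      rw [norm_sub_rev] at h1
      exact le_antisymm (by linarith) (norm_nonneg _)
    have hv0 : v = 0 := by
      by_contra hne
      have := l2Norm_gradient_pos hvV hne
      rw [hvp.l2Norm_gradient, hp0] at this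
      exact lt_irrefl 0 this
    obtain ⟨c, hc⟩ := exists_eq_C_of_gradLp_eq_zero h0.symm T hT
    obtain ⟨S, hS⟩ : T.Nonempty := Finset.card_pos.1 (by rw [K.card_eq_four T hT]; norm_num)
    have hSl := isLatticePoint_of_mem (k := k) hk hS
    have hwS : polyFun (w T) S = 0 := by
      by_cases hSb : S ∈ K.boundary
      · exact hw.vertex T hT S hS hSb
      · have h1 := hvp T hT S (subset_convexHull ℝ _ hS)
        rw [hv0, polyFun_sub, hq T hT, (hq'node T hT S hSl).2 hSb, sub_zero] at h1
        exact h1.symm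
    have hc0 : c = 0 := by
      rw [hc] at hwS
      simpa [polyFun] using hwS
    exact hTw (by rw [hc, hc0, map_zero])
  have hcs : ∀ x y : Lp E3 2 (volume.restrict K.domain), inner ℝ x y ≤ ‖x‖ * ‖y‖ :=
    real_inner_le_norm
  have hlow : 1 / 3 * (‖K.gradLp w‖ * ‖K.gradLp p‖) ≤ inner ℝ (K.gradLp w) (K.gradLp p) := by
    have h1 : inner ℝ (K.gradLp w) (K.gradLp p) =
        ‖K.gradLp w‖ ^ 2 - inner ℝ (K.gradLp w) (K.gradLp w - K.gradLp p) := by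
      rw [inner_sub_right, real_inner_self_eq_norm_sq, sub_sub_cancel]
    have h2 := hcs (K.gradLp w) (K.gradLp w - K.gradLp p)
    have h3 : ‖K.gradLp p‖ ≤ 3 / 2 * ‖K.gradLp w‖ := by
      have := norm_sub_norm_le (K.gradLp p) (K.gradLp w)
      rw [norm_sub_rev] at this
      linarith
    rw [h1]
    have h4 := mul_le_mul_of_nonneg_left hwp hpos.le
    have h5 := mul_le_mul_of_nonneg_left h3 hpos.le
    nlinarith
  -- The energy norm of `v` is at least half that of `w`, so `v` is admissible in the supremum.
  have hp_pos : 0 < ‖K.gradLp p‖ := by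
    have := norm_sub_norm_le (K.gradLp w) (K.gradLp p)
    linarith
  have hv0 : v ≠ 0 := by
    rintro rfl
    have h1 := hvp.l2Norm_gradient
    have h2 : gradient (0 : E3 → ℝ) = 0 := by
      funext x
      exact gradient_const (F := E3) (c := (0 : ℝ)) (x := x)
    rw [h2] at h1
    simp [l2Norm] at h1
    linarith
  rw [l2Norm_brokenGrad]
  refine ⟨hpos, _, isLUB_csSup ⟨_, v, hvV, hv0, rfl⟩ ⟨1, ?_⟩, ?_⟩
  · rintro _ ⟨u, hu, hu0, rfl⟩
    obtain ⟨b, hb⟩ := exists_isPiecewise hu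
    rw [hb.form_eq, hb.l2Norm_gradient]
    exact div_le_one_of_le₀ (hcs _ _) (by positivity)
  · refine le_trans ?_ (le_csSup ⟨1, ?_⟩ ⟨v, hvV, hv0, rfl⟩)
    · rw [hvp.form_eq, hvp.l2Norm_gradient, le_div_iff₀ (by positivity)]
      exact hlow
    · rintro _ ⟨u, hu, hu0, rfl⟩
      obtain ⟨b, hb⟩ := exists_isPiecewise hu
      rw [hb.form_eq, hb.l2Norm_gradient]
      exact div_le_one_of_le₀ (hcs _ _) (by positivity)

theorem ShapeRegular.exists_isFat {σ σ' : ℝ} (h : K.ShapeRegular σ) (hσ : σ ≤ σ') :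
    ∀ T ∈ K.elements, ∃ r, IsFat σ' r T := by
  intro T hT
  obtain ⟨c, r, hr, hball, hd⟩ := h T hT
  exact ⟨r, hr, ⟨c, hball⟩, hd.trans (mul_le_mul_of_nonneg_right hσ hr.le)⟩

theorem IsSkinChoice.mono {s s' : ℝ} {d : Finset E3 → E3} (h : K.IsSkinChoice s d) (hs : s ≤ s') :
    K.IsSkinChoice s' d := by
  intro e he
  obtain ⟨h1, h2, F₁, F₂, h3, h4, h5, h6, h7, τ₁, τ₂, h8, h9, h10⟩ := h e he
  exact ⟨h1, h2, F₁, F₂, h3, h4, h5, h6, h7, τ₁, τ₂, h8, h9,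
    h10.trans (mul_le_mul_of_nonneg_right hs (norm_nonneg _))⟩

end TetMesh

end

/-! ### Choice of the parameters and conclusion. -/

theorem mainTheorem7 (Ω : Set E3) (hΩ : IsOpen Ω) (hΩb : Bornology.IsBounded Ω)
    (hΓ : HasC1Boundary Ω) (k : ℕ) (hk : 2 ≤ k) (σ s : ℝ) (hs : s < 1) :
    ∃ h₀ : ℝ, 0 < h₀ ∧ ∀ K : TetMesh, K.Fits Ω → K.ShapeRegular σ →
      (∀ T ∈ K.elements, Metric.diam (convexHull ℝ (T : Set E3)) ≤ h₀) →
      ∀ d : Finset E3 → E3, K.IsSkinChoice s d →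
      (∀ v ∈ K.testSpace k, v ≠ 0 → 0 < K.l2Norm (gradient v)) ∧
      ∀ w : Finset E3 → MvPolynomial (Fin 3) ℝ, K.IsTrial Ω k d 0 w →
        (∃ T ∈ K.elements, w T ≠ 0) →
        0 < K.l2Norm (K.brokenGrad w) ∧
        ∃ L : ℝ, IsLUB {r : ℝ | ∃ v ∈ K.testSpace k, v ≠ 0 ∧
            r = K.form w v / (K.l2Norm (K.brokenGrad w) * K.l2Norm (gradient v))} L ∧
          1 / 3 ≤ L := by
  classical
  have hk0 : 0 < k := by omega
  -- Shape regularity and the skin condition weaken as their parameters grow, so `σ ≥ 1` and `s ≥ 0`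
  -- may be assumed.
  set A := max σ 1 with hA
  set S := max s 0 with hS
  have hA1 : 1 ≤ A := le_max_right _ _
  have hS0 : 0 ≤ S := le_max_right _ _
  have hS1 : S < 1 := max_lt hs one_pos
  have hA0 : 0 < A := by linarith
  obtain ⟨ε, hε, hloc⟩ := exists_energy_le_of_nodes k hk0 hA0
  -- The first and third bounds make the skins transversal; the second and fourth bring the zeros
  -- attached to faces and to edges within `ε h_T`.
  obtain ⟨η, hη, hη1, hη2, hη3, hη4⟩ : ∃ η : ℝ, 0 < η ∧ 20 * (η * A * A) ≤ 1 ∧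
      8 * (η * A) ≤ ε ∧ 20 * (η * A) ≤ 1 - S ∧ 16 * η / (1 - S) ≤ ε := by
    have h1 : 0 < 1 - S := by linarith
    obtain ⟨η, hη, h⟩ : ∃ η : ℝ, 0 < η ∧ η ≤ min (min (1 / (20 * A * A)) (ε / (8 * A)))
        (min ((1 - S) / (20 * A)) (ε * (1 - S) / 16)) := ⟨_, by positivity, le_rfl⟩
    simp only [le_min_iff] at h
    obtain ⟨⟨h2, h3⟩, h4, h5⟩ := h
    rw [le_div_iff₀ (by positivity)] at h2 h3 h4
    refine ⟨η, hη, by linarith, by linarith, by linarith, ?_⟩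
    rw [div_le_iff₀ h1]
    linarith
  obtain ⟨δ, hδ, hn⟩ := hΓ.exists_uniform_normal hΩ hΩb hη
  -- Twice the diameter then stays below the scale `δ` at which the boundary is flat.
  refine ⟨δ / 3, by positivity, fun K hK hreg hdiam d hd => ⟨fun v hv hv0 =>
    TetMesh.l2Norm_gradient_pos hv hv0, fun w hw hw0 => ?_⟩⟩
  have hfat := hreg.exists_isFat (σ' := A) (le_max_left _ _)
  have hdS := hd.mono (s' := S) (le_max_left _ _)
  have hdiam2 : ∀ T ∈ K.elements, 2 * Metric.diam (convexHull ℝ (T : Set E3)) < δ :=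
    fun T hT => by linarith [hdiam T hT]
  refine TetMesh.inf_sup_of_energy_le hk0 hw hw0 fun T hT => ?_
  obtain ⟨r, hr⟩ := hfat T hT
  obtain ⟨c, hball⟩ := hr.exists_ball
  have hT4 := K.card_eq_four T hT
  have hη5 : 8 * (η * A) ≤ 1 := by linarith
  obtain ⟨q, hq1, hq2, hq3⟩ := hloc T hT4 (K.affineIndependent T hT) (w T) (hw.degree_le T hT)
    c r hr.pos hball hr.diam_le (fun x => if x ∈ K.boundary then polyFun (w T) x else 0) (by
      intro x hx
      by_cases hxb : x ∈ K.boundary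
      · simp only [if_pos hxb]
        rcases K.lattice_mem_boundary_cases hk0 hT hx hxb with
          hxT | ⟨e, heT, he, hxe⟩ | ⟨F, hFT, hF, hxF⟩
        · exact Or.inl (hw.vertex T hT x hxT hxb)
        · refine Or.inr ⟨trivial, ?_⟩
          obtain ⟨a, b, hab, rfl⟩ := Finset.card_eq_two.1 he.1
          obtain ⟨n, hn⟩ := hn a (hK.mem_frontier hT heT he.2.2 a (by simp))
          -- The trial condition holds at every nearest intersection, so any one of them can serve
          -- as the zero.
          obtain ⟨Q, hQ, hxQ⟩ := hdS.exists_nearest_edge hK hΩ hη hA1 hfat hdiam2 hS0 hS1 hη3 hη1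
            hab he hn hT heT (hxe.isLatticePoint.mem_convexHull hk0)
          exact ⟨Q, hxQ.trans (mul_le_mul_of_nonneg_right hη4 Metric.diam_nonneg),
            hw.edge T hT _ heT he x Q hxe hQ⟩
        · refine Or.inr ⟨trivial, ?_⟩
          have hΓF := hK.mem_frontier hT hFT hF.2.2
          obtain ⟨a, ha⟩ : F.Nonempty := Finset.card_pos.1 (by rw [hF.1]; norm_num)
          obtain ⟨n, hn⟩ := hn a (hΓF a ha)
          obtain ⟨O, hO, hOF⟩ := Finset.exists_opposite hT4 hF.1
          obtain ⟨P, hP, hxP⟩ := hn.exists_nearest_face hΩ hη hA0 hr hT4 hF.1 (hdiam2 T hT) hη5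
            hFT hΓF ha hO hOF (hxF.isLatticePoint.mem_convexHull hk0)
          exact ⟨P, hxP.trans (mul_le_mul_of_nonneg_right hη2 Metric.diam_nonneg),
            hw.face T hT F hFT hF O hO hOF x P hxF hP⟩
      · exact Or.inl (if_neg hxb))
  refine ⟨q, hq1, fun x hx => ⟨fun hxb => ?_, fun hxb => ?_⟩, hq3⟩
  · rw [hq2 x hx, if_pos hxb]
  · rw [hq2 x hx, if_neg hxb]
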